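/- **Model.** Time is $t\in\mathbf R_+=[0,\infty)$ and $r>0$ is a discount rate. The frontiers $F^0,F^1:[0,\infty)\to[-\infty,\infty)$ are concave and upper semi-continuous, with unique peaks $u^0,u^1$ respectively (i.e. $F^j(u)<F^j(u^j)$ for all $u\neq u^j$), where $0\le u^1<u^0$; moreover $F^0$ is finite on $(0,u^0]$ and $F^1\ge F^0$. Put $F^1(\infty):=-\infty$. A *mechanism* is a pair $(x^0,X^1)$ where $x^0:\mathbf R_+\to\mathbf R_+$ (the pre-disclosure flow) is Lebesgue-measurable and $X^1:\mathbf R_+\to[0,\infty]$ (the disclosure reward) is a function. It is *incentive-compatible (IC)* if for every $t\ge 0$ $$X^1_t\ \ge\ r\int_t^{t+d}e^{-r(s-t)}x^0_s\,ds+e^{-rd}X^1_{t+d}\quad\text{for all } d>0,\qquad X^1_t\ \ge\ r\int_t^\infty e^{-r(s-t)}x^0_s\,ds .$$ For a distribution (Borel probability measure) $G$ on $\mathbf R_+$ of the breakthrough time $\tau$, the principal's payoff is $$\Pi_G(x^0,X^1)=\mathbf E_{\tau\sim G}\Big(r\int_0^\tau e^{-rt}F^0(x^0_t)\,dt+e^{-r\tau}F^1(X^1_\tau)\Big)\in[-\infty,\infty).$$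 An IC mechanism *dominates* another if it yields a weakly higher payoff $\Pi_G$ for every distribution $G$ and a strictly higher one for some $G$. An IC mechanism is *undominated* if no IC mechanism dominates it, and it is *optimal for $G$* if it maximises $\Pi_G$ among IC mechanisms and is undominated. **Theorem.** Suppose that $F^0$ is strictly concave on its effective domain $\{F^0>-\infty\}$. Let $G,G^\dagger$ be distributions on $\mathbf R_+$ that are absolutely continuous with respect to Lebesgue measure and have equal, unbounded support. Suppose that $G$ MLR-dominates $G^\dagger$, i.e. the ratio $g/g^\dagger$ of (versions of) their densities is increasing on the support, in the sense that $g(s)\,g^\dagger(t)\le g(t)\,g^\dagger(s)$ for all $s\le t$ in the support. If the mechanism $(x,X)$ is optimal for $G$ and the mechanism $(x^\dagger,X^\dagger)$ is optimal for $G^\dagger$, then $$X_t\ \ge\ X^\dagger_t\qquad\text{for every } t\ge 0 .$$ -/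

import Mathlib

open MeasureTheory Set
open scoped NNReal ENNReal

noncomputable section

namespace Breakthrough

/-- The Lebesgue integral of an extended-real function: integral of the positive part minus
integral of the negative part. It is used only for functions that are bounded above and measures
that are finite, so that the positive part always has a finite integral. -/
def erealIntegral (μ : Measure ℝ) (f : ℝ → EReal) : EReal :=
  ((∫⁻ t, (f t).toENNReal ∂μ : ℝ≥0∞) : EReal) - ((∫⁻ t, (-f t).toENNReal ∂μ : ℝ≥0∞) : EReal)

/-- Concavity of a utility possibility frontier `[0,∞) → [-∞,∞)`. -/
def IsConcave (F : ℝ≥0 → EReal) : Prop :=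
  ∀ u v a b : ℝ≥0, a + b = 1 →
    ((a : ℝ) : EReal) * F u + ((b : ℝ) : EReal) * F v ≤ F (a * u + b * v)

/-- Strict concavity of a frontier, on its effective domain `{u | F u > -∞}`. -/
def IsStrictlyConcave (F : ℝ≥0 → EReal) : Prop :=
  ∀ u v a b : ℝ≥0, F u ≠ ⊥ → F v ≠ ⊥ → u ≠ v → 0 < a → 0 < b → a + b = 1 →
    ((a : ℝ) : EReal) * F u + ((b : ℝ) : EReal) * F v < F (a * u + b * v)

/-- A concave, upper semi-continuous frontier `[0,∞) → [-∞,∞)` with unique peak `p`. -/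
structure IsFrontier (F : ℝ≥0 → EReal) (p : ℝ≥0) : Prop where
  lt_top : ∀ u, F u < ⊤
  concave : IsConcave F
  usc : UpperSemicontinuous F
  peak : ∀ u, u ≠ p → F u < F p

/-- The standing assumptions on the old frontier `F0` (with peak `u0`) and the new frontier `F1`
(with peak `u1`), including the conflict of interest `u1 < u0`. -/
structure IsTechnology (F0 F1 : ℝ≥0 → EReal) (u0 u1 : ℝ≥0) : Prop where
  frontier0 : IsFrontier F0 u0
  frontier1 : IsFrontier F1 u1
  u0_pos : 0 < u0
  finite0 : ∀ u, 0 < u → u ≤ u0 → ⊥ < F0 u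
  le : ∀ u, F0 u ≤ F1 u
  conflict : u1 < u0

/-- A mechanism: a Lebesgue-measurable pre-disclosure utility flow `x⁰` and a disclosure reward `X¹`.
Times are the nonnegative reals; the values at negative times play no role. -/
structure Mechanism where
  flow : ℝ → ℝ≥0
  measurable_flow : AEMeasurable flow volume
  reward : ℝ → ℝ≥0∞

/-- `r ∫_S e^{-r(s-t)} x_s ds`, the period-`t` value of the flow `x` over the set `S` of times. -/
def flowValue (r : ℝ) (x : ℝ → ℝ≥0) (t : ℝ) (S : Set ℝ) : ℝ≥0∞ :=
  ∫⁻ s in S, ENNReal.ofReal (r * Real.exp (-r * (s - t))) * (x s : ℝ≥0∞)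

/-- Incentive-compatibility: prompt disclosure is at least as good as (a) disclosing with a delay
`d` and (b) never disclosing. -/
def IsIC (r : ℝ) (m : Mechanism) : Prop :=
  ∀ t : ℝ, 0 ≤ t →
    (∀ d : ℝ, 0 < d →
      flowValue r m.flow t (Ioo t (t + d))
        + ENNReal.ofReal (Real.exp (-r * d)) * m.reward (t + d) ≤ m.reward t) ∧
    flowValue r m.flow t (Ioi t) ≤ m.reward t

/-- The upper semi-continuous extension of a frontier to `[0,∞]`, with value `-∞` at `∞`. -/
def extendFrontier (F : ℝ≥0 → EReal) (X : ℝ≥0∞) : EReal :=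
  if X = ⊤ then ⊥ else F X.toNNReal

/-- Distributions of the breakthrough time: probability measures on `[0,∞)`. -/
def IsDistribution (G : Measure ℝ) : Prop :=
  IsProbabilityMeasure G ∧ G (Iio 0) = 0

/-- The principal's payoff
`Π_G(x⁰,X¹) = E_G( r ∫_0^τ e^{-rt} F⁰(x⁰_t) dt + e^{-rτ} F¹(X¹_τ) ) ∈ [-∞,∞)`. -/
def payoff (r : ℝ) (F0 F1 : ℝ≥0 → EReal) (G : Measure ℝ) (m : Mechanism) : EReal :=
  erealIntegral G fun τ =>
    erealIntegral (volume.restrict (Ioo 0 τ))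
        (fun t => ((r * Real.exp (-r * t) : ℝ) : EReal) * F0 (m.flow t))
      + ((Real.exp (-r * τ) : ℝ) : EReal) * extendFrontier F1 (m.reward τ)

/-- `m` dominates `m'`: weakly better for every distribution, strictly better for some. -/
def Dominates (r : ℝ) (F0 F1 : ℝ≥0 → EReal) (m m' : Mechanism) : Prop :=
  (∀ G : Measure ℝ, IsDistribution G → payoff r F0 F1 G m' ≤ payoff r F0 F1 G m) ∧
    ∃ G : Measure ℝ, IsDistribution G ∧ payoff r F0 F1 G m' < payoff r F0 F1 G m

/-- An IC mechanism is undominated iff no IC mechanism dominates it. -/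
def IsUndominated (r : ℝ) (F0 F1 : ℝ≥0 → EReal) (m : Mechanism) : Prop :=
  IsIC r m ∧ ∀ m' : Mechanism, IsIC r m' → ¬ Dominates r F0 F1 m' m

/-- An IC mechanism is optimal for `G` iff it maximises `Π_G` among IC mechanisms and is
undominated. -/
def IsOptimal (r : ℝ) (F0 F1 : ℝ≥0 → EReal) (G : Measure ℝ) (m : Mechanism) : Prop :=
  IsUndominated r F0 F1 m ∧
    ∀ m' : Mechanism, IsIC r m' → payoff r F0 F1 G m' ≤ payoff r F0 F1 G m

/-- `G` MLR-dominates `G'`: for some versions `g`, `g'` of their Lebesgue densities, the ratio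
`g / g'` is increasing on the support. The monotonicity of the ratio is written in
cross-multiplied form, so that it also makes sense where a density vanishes. -/
def MLRDominates (G G' : Measure ℝ) : Prop :=
  ∃ g g' : ℝ → ℝ≥0, Measurable g ∧ Measurable g' ∧
    G = volume.withDensity (fun t => (g t : ℝ≥0∞)) ∧
    G' = volume.withDensity (fun t => (g' t : ℝ≥0∞)) ∧
    ∀ s ∈ G.support ∪ G'.support, ∀ t ∈ G.support ∪ G'.support, s ≤ t →
      g s * g' t ≤ g t * g' s

end Breakthrough

end

/-! Optimality forces incentive-compatibility to bind. Capping the flow at `u0` is harmless, an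
undominated reward cannot be moved towards `u1`, and any slack left in the promise can be spent on
raising the flow towards `u0`. So an optimal mechanism is a flow `x` with values in `[0,u0]`, and
its reward `X` is the discounted value of the flow still to come (`IsOptimal.exists_isOptimalPath`).
What remains is a variational problem in `x`.

The basic tool is a needle variation (`IsOptimalPath.needle`): moving a little flow from about `t1`
to about `t2 > t1` raises the reward in between. It gains the slope of `F0` at `t2` if the
breakthrough comes after `t2`, loses the slope at `t1` if it comes after `t1`, and earns the slope
of `F1` if it comes in between. Two monotonicity facts are needed first. The reward decreases,
because an excursion across a level `m` could be replaced by the constant flow `m`, with a strict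
gain from the strict concavity of `F0` (`IsOptimalPath.antitoneOn`). The flow decreases up to null
sets, by needle variations (`IsOptimalPath.not_leftAcc`).

For the comparison, suppose `X < X'` at some time. Rewards are values of future flows, so `x < x'`
near some later `t2`, with `X < X'` up to then. Going back, either `x' < x` near some `t1` with `X <
X'` from there on, or `X < X'` all the way from `t1 = 0`. Let `c` be the secant slope of `F1`
between `X` and `X'`. It increases in time, since both rewards decrease and `F1` is concave. Moving
flow of `x` from `t1` to `t2`, and flow of `x'` from any `s ≤ t2` to `t1`, pushes the two rewards
towards each other, so the same `c` bounds both effects. With `α ≤ β` slopes of `F0` at `t1` and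
`t2`, the optimality of `x'` bounds the integral of `β - c` over `[t1,s)` by `(β - α) G'[t1,∞)`. The
optimality of `x` gives the strictly opposite bound under `G` when `s` is the time at which `c`
crosses `β`. But `β - c`, cut off at that time, is nonnegative and decreasing, so under MLR
dominance its mean conditional on `[t1,∞)` is no larger for `G` than for `G'`: a contradiction
(`IsOptimalPath.comparison_core`). -/

noncomputable section

namespace Breakthrough

/-! ### Bounded flows and their discounted values -/

/-- Bounded measurable real functions of time. -/
def BddMeas (x : ℝ → ℝ) : Prop := Measurable x ∧ ∃ C, ∀ t, |x t| ≤ C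

/-- The value at time `0` of the flow `x` over `(t,∞)`. -/
def tailValue (r : ℝ) (x : ℝ → ℝ) (t : ℝ) : ℝ := ∫ s in Ioi t, r * Real.exp (-r * s) * x s

/-- The period-`t` value of the flow `x` over `(t,∞)`. -/
def promised (r : ℝ) (x : ℝ → ℝ) (t : ℝ) : ℝ := Real.exp (r * t) * tailValue r x t

/-- `S` has positive measure immediately to the left of `t`. -/
def LeftAcc (S : Set ℝ) (t : ℝ) : Prop := ∀ s < t, 0 < volume (S ∩ Ioo s t)

theorem BddMeas.const (c : ℝ) : BddMeas fun _ => c := ⟨measurable_const, |c|, fun _ => le_rfl⟩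

theorem BddMeas.add {x y : ℝ → ℝ} (hx : BddMeas x) (hy : BddMeas y) :
    BddMeas fun t => x t + y t := by
  obtain ⟨hx, C, hC⟩ := hx
  obtain ⟨hy, D, hD⟩ := hy
  exact ⟨hx.add hy, C + D, fun t => (abs_add_le _ _).trans (add_le_add (hC t) (hD t))⟩

theorem BddMeas.mul {x y : ℝ → ℝ} (hx : BddMeas x) (hy : BddMeas y) :
    BddMeas fun t => x t * y t := by
  obtain ⟨hx, C, hC⟩ := hx
  obtain ⟨hy, D, hD⟩ := hy
  refine ⟨hx.mul hy, C * D, fun t => ?_⟩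
  rw [abs_mul]
  exact mul_le_mul (hC t) (hD t) (abs_nonneg _) ((abs_nonneg _).trans (hC t))

theorem BddMeas.const_mul {x : ℝ → ℝ} (c : ℝ) (hx : BddMeas x) : BddMeas fun t => c * x t :=
  (BddMeas.const c).mul hx

theorem BddMeas.sub {x y : ℝ → ℝ} (hx : BddMeas x) (hy : BddMeas y) :
    BddMeas fun t => x t - y t := by
  simpa [sub_eq_add_neg] using hx.add (hy.const_mul (-1))

theorem BddMeas.indicator {x : ℝ → ℝ} (hx : BddMeas x) {S : Set ℝ} (hS : MeasurableSet S) :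
    BddMeas (S.indicator x) := by
  obtain ⟨hx, C, hC⟩ := hx
  refine ⟨hx.indicator hS, C, fun t => ?_⟩
  by_cases h : t ∈ S
  · simpa [h] using hC t
  · simpa [h] using (abs_nonneg _).trans (hC t)

theorem BddMeas.of_mem_Icc {x : ℝ → ℝ} (hx : Measurable x) {a b : ℝ} (h : ∀ t, x t ∈ Icc a b) :
    BddMeas x :=
  ⟨hx, max |a| |b|, fun t => abs_le_max_abs_abs (h t).1 (h t).2⟩

theorem BddMeas.integrable {x : ℝ → ℝ} (hx : BddMeas x) (G : Measure ℝ) [IsFiniteMeasure G] :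
    Integrable x G := by
  obtain ⟨hx, C, hC⟩ := hx
  exact Integrable.of_bound hx.aestronglyMeasurable C (Filter.Eventually.of_forall hC)

theorem integrableOn_weight {r : ℝ} (hr : 0 < r) (t : ℝ) :
    IntegrableOn (fun s => r * Real.exp (-r * s)) (Ioi t) :=
  (integrableOn_exp_mul_Ioi (by linarith) t).const_mul r

theorem integral_weight {r : ℝ} (hr : 0 < r) (t : ℝ) :
    ∫ s in Ioi t, r * Real.exp (-r * s) = Real.exp (-r * t) := by
  rw [integral_const_mul, integral_exp_mul_Ioi (by linarith)]
  field_simp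

theorem weight_pos {r : ℝ} (hr : 0 < r) (s : ℝ) : 0 < r * Real.exp (-r * s) := by positivity

section
variable {r : ℝ} (hr : 0 < r) {x y : ℝ → ℝ} (hx : BddMeas x) (hy : BddMeas y)
include hr hx

theorem BddMeas.integrableOn_Ioi (t : ℝ) :
    IntegrableOn (fun s => r * Real.exp (-r * s) * x s) (Ioi t) := by
  obtain ⟨hx, C, hC⟩ := hx
  exact (integrableOn_weight hr t).mul_bdd (c := C) hx.aestronglyMeasurable
    (Filter.Eventually.of_forall hC)

theorem BddMeas.intervalIntegrable (s t : ℝ) :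
    IntervalIntegrable (fun s => r * Real.exp (-r * s) * x s) volume s t := by
  rw [intervalIntegrable_iff]
  exact (hx.integrableOn_Ioi hr (min s t)).mono_set (fun u hu => hu.1)

theorem tailValue_eq_add {s t : ℝ} (hst : s ≤ t) :
    tailValue r x s = (∫ u in Ioo s t, r * Real.exp (-r * u) * x u) + tailValue r x t := by
  unfold tailValue
  rw [← integral_Ioc_eq_integral_Ioo, ← Ioc_union_Ioi_eq_Ioi hst,
    setIntegral_union (Ioc_disjoint_Ioi le_rfl) measurableSet_Ioi
      ((hx.integrableOn_Ioi hr s).mono_set Ioc_subset_Ioi_self) (hx.integrableOn_Ioi hr t)]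

theorem setIntegral_Ioo_eq {s t : ℝ} (hst : s ≤ t) :
    ∫ u in Ioo s t, r * Real.exp (-r * u) * x u = tailValue r x s - tailValue r x t := by
  rw [tailValue_eq_add hr hx hst]; ring

omit hr hx in
theorem tailValue_const_mul (c t : ℝ) :
    tailValue r (fun s => c * x s) t = c * tailValue r x t := by
  unfold tailValue
  rw [← integral_const_mul]
  congr 1; ext s; ring

include hy in
theorem tailValue_add (t : ℝ) :
    tailValue r (fun s => x s + y s) t = tailValue r x t + tailValue r y t := by
  unfold tailValue
  rw [← integral_add (hx.integrableOn_Ioi hr t) (hy.integrableOn_Ioi hr t)]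
  congr 1; ext s; ring

include hy in
theorem tailValue_sub (t : ℝ) :
    tailValue r (fun s => x s - y s) t = tailValue r x t - tailValue r y t := by
  unfold tailValue
  rw [← integral_sub (hx.integrableOn_Ioi hr t) (hy.integrableOn_Ioi hr t)]
  congr 1; ext s; ring

include hy in
theorem tailValue_mono {t : ℝ} (h : ∀ᵐ s, t < s → x s ≤ y s) : tailValue r x t ≤ tailValue r y t := by
  refine setIntegral_mono_on_ae (hx.integrableOn_Ioi hr t) (hy.integrableOn_Ioi hr t)
    measurableSet_Ioi ?_
  filter_upwards [h] with s hs hst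
  exact mul_le_mul_of_nonneg_left (hs hst) (weight_pos hr s).le

omit hx in
theorem tailValue_const (c t : ℝ) : tailValue r (fun _ => c) t = c * Real.exp (-r * t) := by
  unfold tailValue
  rw [integral_mul_const, integral_weight hr, mul_comm]

theorem tailValue_lt {t : ℝ} {c : ℝ} (h : ∀ᵐ s, t < s → c < x s) :
    c * Real.exp (-r * t) < tailValue r x t := by
  rw [← sub_pos, ← tailValue_const hr, ← tailValue_sub hr hx (BddMeas.const c)]
  unfold tailValue
  have hi := (hx.sub (BddMeas.const c)).integrableOn_Ioi hr t
  rw [setIntegral_pos_iff_support_of_nonneg_ae _ hi]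
  · have : (Ioi t : Set ℝ) ≤ᵐ[volume]
        ((Function.support fun s => r * Real.exp (-r * s) * (x s - c)) ∩ Ioi t : Set ℝ) := by
      filter_upwards [h] with s hs hst
      exact ⟨(mul_pos (weight_pos hr s) (sub_pos.2 (hs hst))).ne', hst⟩
    exact lt_of_lt_of_le (by simp) (measure_mono_ae this)
  · rw [Filter.EventuallyLE, ae_restrict_iff' measurableSet_Ioi]
    filter_upwards [h] with s hs hst
    exact (mul_pos (weight_pos hr s) (sub_pos.2 (hs hst))).le

theorem tailValue_indicator_Ioo {s t u : ℝ} :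
    tailValue r ((Ioo s t).indicator x) u
      = tailValue r x (min (max s u) t) - tailValue r x t := by
  rw [← setIntegral_Ioo_eq hr hx (min_le_right _ _)]
  unfold tailValue
  have : (fun v => r * Real.exp (-r * v) * (Ioo s t).indicator x v)
      = (Ioo s t).indicator fun v => r * Real.exp (-r * v) * x v := by
    ext v; by_cases h : v ∈ Ioo s t <;> simp [h]
  rw [this, setIntegral_indicator measurableSet_Ioo]
  congr 2
  ext v
  simp only [mem_inter_iff, mem_Ioi, mem_Ioo, min_lt_iff, max_lt_iff]
  constructor
  · rintro ⟨h1, h2, h3⟩; exact ⟨Or.inl ⟨h2, h1⟩, h3⟩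
  · rintro ⟨h1 | h1, h3⟩
    · exact ⟨h1.2, h1.1, h3⟩
    · exact absurd h3 h1.le.not_gt

theorem continuous_tailValue : Continuous (tailValue r x) := by
  have : tailValue r x = fun t => tailValue r x 0 - ∫ s in (0 : ℝ)..t, r * Real.exp (-r * s) * x s := by
    ext t
    rcases le_total 0 t with h | h
    · rw [intervalIntegral.integral_of_le h, integral_Ioc_eq_integral_Ioo, setIntegral_Ioo_eq hr hx h]
      ring
    · rw [intervalIntegral.integral_of_ge h, integral_Ioc_eq_integral_Ioo, setIntegral_Ioo_eq hr hx h]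
      ring
  rw [this]
  exact continuous_const.sub
    (intervalIntegral.continuous_primitive (fun a b => hx.intervalIntegrable hr a b) 0)

theorem continuous_promised : Continuous (promised r x) :=
  (by fun_prop : Continuous fun t => Real.exp (r * t)).mul (continuous_tailValue hr hx)

omit hr hx in
theorem tailValue_eq_promised (t : ℝ) : tailValue r x t = Real.exp (-r * t) * promised r x t := by
  unfold promised
  rw [← mul_assoc, ← Real.exp_add]; simp

omit hr hx in
theorem tailValue_congr_ae {t : ℝ} (h : ∀ᵐ s, t < s → x s = y s) :
    tailValue r x t = tailValue r y t := by
  unfold tailValue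
  refine setIntegral_congr_ae measurableSet_Ioi ?_
  filter_upwards [h] with s hs hst
  rw [hs hst]

theorem tendsto_tailValue : Filter.Tendsto (tailValue r x) Filter.atTop (nhds 0) := by
  have hx' := hx
  obtain ⟨C, hC⟩ := hx.2
  have hexp : Filter.Tendsto (fun t => C * Real.exp (-r * t)) Filter.atTop (nhds 0) := by
    rw [← mul_zero C]
    refine Filter.Tendsto.const_mul _ (Real.tendsto_exp_atBot.comp ?_)
    exact Filter.tendsto_id.const_mul_atTop_of_neg (by linarith)
  refine squeeze_zero_norm (fun t => ?_) hexp
  rw [Real.norm_eq_abs, abs_le]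
  constructor
  · rw [← neg_mul, ← tailValue_const hr]
    exact tailValue_mono hr (BddMeas.const _) hx'
      (Filter.Eventually.of_forall fun s _ => (abs_le.1 (hC s)).1)
  · rw [← tailValue_const hr]
    exact tailValue_mono hr hx' (BddMeas.const _)
      (Filter.Eventually.of_forall fun s _ => (abs_le.1 (hC s)).2)

/-- If the value of `x` over every subinterval is at least that of the constant flow `c`, then
`x ≥ c` almost everywhere. -/
theorem ae_ge_of_tailValue {a b c : ℝ} (h : ∀ s t, a < s → s < t → t < b →
      c * (Real.exp (-r * s) - Real.exp (-r * t)) ≤ tailValue r x s - tailValue r x t) :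
    ∀ᵐ t, t ∈ Ioo a b → c ≤ x t := by
  have hd := hx.sub (BddMeas.const c)
  have key : ∀ s t, a < s → s < t → t < b →
      0 ≤ ∫ u in s..t, r * Real.exp (-r * u) * (x u - c) := by
    intro s t h1 h2 h3
    rw [intervalIntegral.integral_of_le h2.le, integral_Ioc_eq_integral_Ioo,
      setIntegral_Ioo_eq hr hd h2.le, tailValue_sub hr hx (BddMeas.const c),
      tailValue_sub hr hx (BddMeas.const c), tailValue_const hr, tailValue_const hr]
    linarith [h s t h1 h2 h3]
  -- Lebesgue differentiation: almost everywhere the weighted integrand is the derivative of its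
  -- primitive, whose forward increments are nonnegative.
  filter_upwards [IntervalIntegrable.ae_hasDerivAt_integral (hd.intervalIntegrable hr a b)]
    with t ht htab
  have hab := htab.1.trans htab.2
  have h1 : t ∈ uIcc a b := by rw [uIcc_of_le hab.le]; exact Ioo_subset_Icc_self htab
  have h2 := ht h1 t h1
  have h3 : 0 ≤ r * Real.exp (-r * t) * (x t - c) := by
    refine ge_of_tendsto h2.tendsto_slope_zero_right ?_
    filter_upwards [Ioo_mem_nhdsGT (sub_pos.2 htab.2)] with e he
    simp only [intervalIntegral.integral_same, sub_zero, smul_eq_mul]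
    exact mul_nonneg (inv_nonneg.2 he.1.le)
      (key t (t + e) htab.1 (by linarith [he.1]) (by linarith [he.2]))
  have := nonneg_of_mul_nonneg_right h3 (weight_pos hr t)
  linarith

end

/-! ### Times of left accumulation -/

/-- The witness is the least `u` for which `S` is null on `(u,b')`: from any earlier time on `S` is
not null, and the excess must lie to the left of `u`. Such points serve as times at which the flow
satisfies an inequality, although a flow is only defined up to null sets. -/
theorem exists_leftAcc {S : Set ℝ} {a b : ℝ} (h : 0 < volume (S ∩ Ioo a b)) :
    ∃ t ∈ Ioo a b, LeftAcc S t := by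
  -- Stopping at `b' < b` keeps the witness strictly below `b`.
  obtain ⟨b', hb', hS⟩ : ∃ b' < b, 0 < volume (S ∩ Ioo a b') := by
    by_contra! hcon
    have hU : S ∩ Ioo a b ⊆ ⋃ n : ℕ, S ∩ Ioo a (b - 1 / (n + 1)) := by
      rintro u ⟨hu, hua, hub⟩
      obtain ⟨n, hn⟩ := exists_nat_one_div_lt (sub_pos.2 hub)
      exact mem_iUnion.2 ⟨n, hu, hua, by linarith⟩
    have := measure_mono_null hU (measure_iUnion_null fun n =>
      le_antisymm (hcon _ (by have : (0 : ℝ) < 1 / (n + 1) := by positivity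
                              linarith)) bot_le)
    exact h.ne' this
  set T := {u | volume (S ∩ Ioo u b') = 0} with hT
  have hbT : b' ∈ T := by simp [hT]
  have hlow : ∀ u ∈ T, a ≤ u := by
    intro u hu
    by_contra! hua
    exact hS.ne' (measure_mono_null (by gcongr) hu)
  have hbdd : BddBelow T := ⟨a, hlow⟩
  have hinf : sInf T ∈ T := by
    have hU : S ∩ Ioo (sInf T) b' ⊆ ⋃ n : ℕ, S ∩ Ioo (sInf T + 1 / (n + 1)) b' := by
      rintro u ⟨hu, hua, hub⟩
      obtain ⟨n, hn⟩ := exists_nat_one_div_lt (sub_pos.2 hua)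
      exact mem_iUnion.2 ⟨n, hu, by linarith, hub⟩
    refine measure_mono_null hU (measure_iUnion_null fun n => ?_)
    have h0 : (0 : ℝ) < 1 / (n + 1) := by positivity
    obtain ⟨u, huT, hu⟩ := exists_lt_of_csInf_lt ⟨b', hbT⟩ (show sInf T < sInf T + 1 / ((n : ℝ) + 1) by linarith)
    exact measure_mono_null (by gcongr) huT
  refine ⟨sInf T, ⟨lt_of_le_of_ne (hlow _ hinf) ?_, (csInf_le hbdd hbT).trans_lt hb'⟩, ?_⟩
  · intro h; rw [← h] at hinf; exact hS.ne' hinf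
  · intro s hs
    rw [pos_iff_ne_zero]
    intro h0
    have : s ∈ T := by
      have hsub : S ∩ Ioo s b' ⊆ (S ∩ Ioo s (sInf T)) ∪ (S ∩ Ioo (sInf T) b') ∪ {sInf T} := by
        rintro u ⟨hu, h1, h2⟩
        rcases lt_trichotomy u (sInf T) with h | h | h
        · exact Or.inl (Or.inl ⟨hu, h1, h⟩)
        · exact Or.inr h
        · exact Or.inl (Or.inr ⟨hu, h, h2⟩)
      exact measure_mono_null hsub (measure_union_null (measure_union_null h0 hinf) (by simp))
    exact absurd (csInf_le hbdd this) (not_le.2 hs)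

theorem LeftAcc.mono {S T : Set ℝ} {t : ℝ} (h : LeftAcc S t) (hST : S ⊆ T) : LeftAcc T t :=
  fun s hs => (h s hs).trans_le (measure_mono (by gcongr))

theorem LeftAcc.exists_lt {S : Set ℝ} {s t : ℝ} (h : LeftAcc S t) (hs : s < t) :
    ∃ t' ∈ Ioo s t, LeftAcc S t' := exists_leftAcc (h s hs)

theorem LeftAcc.exists_mem {S : Set ℝ} {s t : ℝ} (h : LeftAcc S t) (hs : s < t) {p : ℝ → Prop}
    (hp : ∀ᵐ u, p u) : ∃ u ∈ Ioo s t, u ∈ S ∧ p u := by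
  by_contra! hcon
  refine (h s hs).ne' (measure_mono_null ?_ hp)
  intro u hu
  exact hcon u hu.2 hu.1

/-! ### Secants and supergradients of concave functions -/

/-- Concave functions have decreasing secant slopes. -/
theorem ConcaveOn.secant_le {I : Set ℝ} {f : ℝ → ℝ} (hf : ConcaveOn ℝ I f) {u w u' w' : ℝ}
    (hu : u ∈ I) (hw' : w' ∈ I) (huw : u < w) (huw' : u' < w') (h1 : u ≤ u') (h2 : w ≤ w') :
    (f w' - f u') / (w' - u') ≤ (f w - f u) / (w - u) := by
  have hI := hf.1.ordConnected
  have hw : w ∈ I := hI.out hu hw' ⟨huw.le, h2⟩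
  have hu' : u' ∈ I := hI.out hu hw' ⟨h1, huw'.le⟩
  have A : (f w' - f u) / (w' - u) ≤ (f w - f u) / (w - u) := by
    rcases h2.eq_or_lt with rfl | h2
    · rfl
    · have := hf.slope_anti_adjacent hu hw' huw h2
      rw [div_le_div_iff₀ (by linarith) (by linarith)] at this ⊢
      nlinarith
  have B : (f w' - f u') / (w' - u') ≤ (f w' - f u) / (w' - u) := by
    rcases h1.eq_or_lt with rfl | h1
    · rfl
    · have := hf.slope_anti_adjacent hu hw' h1 huw'
      rw [div_le_div_iff₀ (by linarith) (by linarith)] at this ⊢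
      nlinarith
  exact B.trans A

/-- To the left of a chord the function climbs at least as steeply as the chord. The slope does not
depend on the base point `u`, so the same constant serves at all times at which a flow lies below a
level; `ConcaveOn.lower` is the counterpart above a level. -/
theorem ConcaveOn.raise {I : Set ℝ} {f : ℝ → ℝ} (hf : ConcaveOn ℝ I f) {u a b e : ℝ}
    (hu : u ∈ I) (hb : b ∈ I) (hua : u ≤ a) (hab : a < b) (he : 0 ≤ e) (heb : u + e ≤ b) :
    f u + (f b - f a) / (b - a) * e ≤ f (u + e) := by
  rcases he.eq_or_lt with rfl | he
  · simp
  · have := ConcaveOn.secant_le hf hu hb (lt_add_of_pos_right u he) hab hua heb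
    rw [add_sub_cancel_left, le_div_iff₀ he] at this
    linarith

theorem ConcaveOn.lower {I : Set ℝ} {f : ℝ → ℝ} (hf : ConcaveOn ℝ I f) {u a b e : ℝ}
    (ha : a ∈ I) (hu : u ∈ I) (hbu : b ≤ u) (hab : a < b) (he : 0 ≤ e) (hea : a ≤ u - e) :
    f u - (f b - f a) / (b - a) * e ≤ f (u - e) := by
  rcases he.eq_or_lt with rfl | he
  · simp
  · have := ConcaveOn.secant_le hf ha hu hab (sub_lt_self u he) hea hbu
    rw [sub_sub_cancel, div_le_iff₀ he] at this
    linarith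

theorem StrictConcaveOn.secant_lt {I : Set ℝ} {f : ℝ → ℝ} (hf : StrictConcaveOn ℝ I f)
    {u v w : ℝ} (hu : u ∈ I) (hw : w ∈ I) (huv : u < v) (hvw : v < w) :
    (f w - f v) / (w - v) < (f v - f u) / (v - u) :=
  hf.slope_anti_adjacent hu hw huv hvw

/-- The supremum of the secant slopes to the right of `m` works, as it is at most every secant slope
to the left. -/
theorem ConcaveOn.exists_supergradient {I : Set ℝ} {f : ℝ → ℝ} (hf : ConcaveOn ℝ I f) {a m b : ℝ}
    (ha : a ∈ I) (hb : b ∈ I) (ham : a < m) (hmb : m < b) :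
    ∃ p, ∀ v ∈ I, f v ≤ f m + p * (v - m) := by
  have hm : m ∈ I := hf.1.ordConnected.out ha hb ⟨ham.le, hmb.le⟩
  set T := (fun v => (f v - f m) / (v - m)) '' (I ∩ Ioi m) with hT
  have hne : T.Nonempty := ⟨_, b, ⟨hb, hmb⟩, rfl⟩
  have hub : ∀ u ∈ I, u < m → ∀ s ∈ T, s ≤ (f m - f u) / (m - u) := by
    rintro u hu hum _ ⟨v, ⟨hv, hvm⟩, rfl⟩
    exact hf.slope_anti_adjacent hu hv hum hvm
  have hbdd : BddAbove T := ⟨_, hub a ha ham⟩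
  refine ⟨sSup T, fun v hv => ?_⟩
  rcases lt_trichotomy v m with h | rfl | h
  · have := csSup_le hne (hub v hv h)
    rw [le_div_iff₀ (by linarith)] at this
    nlinarith
  · simp
  · have : (f v - f m) / (v - m) ≤ sSup T := le_csSup hbdd ⟨v, ⟨hv, h⟩, rfl⟩
    rw [div_le_iff₀ (by linarith)] at this
    linarith

/-! ### Optimal paths and replacement by a constant flow -/

/-- `I` is one of the intervals `(0,p]` and `[0,p]`, and `f` is concave on it. -/
structure IsDomain (p : ℝ) (I : Set ℝ) (f : ℝ → ℝ) : Prop where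
  Ioc_subset : Ioc 0 p ⊆ I
  subset_Icc : I ⊆ Icc 0 p
  concave : ConcaveOn ℝ I f

/-- The flow `x`, with reward equal to its value, maximises the payoff `Π_G`: no other such flow
`y` gains. The inequality is stated for bounded lower bounds `q`, `j` of the gains. -/
structure IsOptimalPath (r : ℝ) (I0 I1 : Set ℝ) (f0 f1 : ℝ → ℝ) (G : Measure ℝ) (x : ℝ → ℝ) :
    Prop where
  bddMeas : BddMeas x
  mem0 : ∀ t, x t ∈ I0
  mem1 : ∀ t, 0 ≤ t → promised r x t ∈ I1
  optimal : ∀ y q j : ℝ → ℝ, BddMeas y → BddMeas q → BddMeas j → (∀ t, 0 < t → y t ∈ I0) →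
    (∀ t, 0 ≤ t → promised r y t ∈ I1) → (∀ t, 0 < t → f0 (x t) + q t ≤ f0 (y t)) →
    (∀ t, 0 ≤ t → f1 (promised r x t) + j t ≤ f1 (promised r y t)) →
    ∫ τ, ((∫ s in Ioo 0 τ, r * Real.exp (-r * s) * q s) + Real.exp (-r * τ) * j τ) ∂G ≤ 0

/-- A probability measure on `[0,∞)` without atoms and with unbounded support. -/
structure IsUnboundedDistribution (G : Measure ℝ) : Prop where
  prob : IsProbabilityMeasure G
  neg : G (Iio 0) = 0
  noAtoms : NullSingletonClass G
  tail_pos : ∀ t, 0 < G (Ioi t)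

section
variable {r u0 : ℝ} {I0 I1 : Set ℝ} {f0 f1 : ℝ → ℝ} {G : Measure ℝ} {x : ℝ → ℝ}

theorem IsUnboundedDistribution.ae_nonneg (hG : IsUnboundedDistribution G) : ∀ᵐ τ ∂G, 0 ≤ τ := by
  rw [ae_iff]
  simpa [Iio] using hG.neg

theorem setIntegral_Ioo_eq_max (hr : 0 < r) (hx : BddMeas x) (t : ℝ) :
    ∫ u in Ioo 0 t, r * Real.exp (-r * u) * x u = tailValue r x 0 - tailValue r x (max 0 t) := by
  rcases le_total 0 t with h | h
  · rw [setIntegral_Ioo_eq hr hx h, max_eq_right h]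
  · rw [Ioo_eq_empty (not_lt.2 h), max_eq_left h]; simp

theorem BddMeas.of_setIntegral (hr : 0 < r) (hx : BddMeas x) :
    BddMeas fun t => ∫ u in Ioo 0 t, r * Real.exp (-r * u) * x u := by
  have hx' := hx
  obtain ⟨-, C, hC⟩ := hx
  simp only [setIntegral_Ioo_eq_max hr hx']
  have hb : ∀ t, 0 ≤ t → |tailValue r x t| ≤ C := by
    intro t ht
    have hC0 : 0 ≤ C := (abs_nonneg _).trans (hC 0)
    have he : Real.exp (-r * t) ≤ 1 := Real.exp_le_one_iff.2 (by nlinarith)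
    have h1 := tailValue_mono hr hx' (BddMeas.const C) (t := t)
      (Filter.Eventually.of_forall fun s _ => (abs_le.1 (hC s)).2)
    have h2 := tailValue_mono hr (BddMeas.const (-C)) hx' (t := t)
      (Filter.Eventually.of_forall fun s _ => (abs_le.1 (hC s)).1)
    rw [tailValue_const hr] at h1 h2
    rw [abs_le]
    constructor <;> nlinarith
  refine ⟨?_, 2 * C, fun t => ?_⟩
  · have := continuous_tailValue hr hx'
    exact (by fun_prop : Continuous fun t => tailValue r x 0 - tailValue r x (max 0 t)).measurable
  · have h1 := hb 0 le_rfl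
    have h2 := hb (max 0 t) (le_max_left _ _)
    calc _ ≤ |tailValue r x 0| + |tailValue r x (max 0 t)| := abs_sub _ _
      _ ≤ _ := by linarith

theorem IsDomain.exists_supergradient (h : IsDomain u0 I0 f0) {m : ℝ} (hm : m ∈ Ioo 0 u0) :
    ∃ p, ∀ v ∈ I0, f0 v ≤ f0 m + p * (v - m) :=
  ConcaveOn.exists_supergradient h.concave (a := m / 2) (b := u0)
    (h.Ioc_subset ⟨by linarith [hm.1], by linarith [hm.1, hm.2]⟩)
    (h.Ioc_subset ⟨hm.1.trans hm.2, le_rfl⟩) (by linarith [hm.1]) hm.2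

/-- Uniform strictness in the supergradient inequality away from `m`. -/
theorem StrictConcaveOn.exists_gap (hf : StrictConcaveOn ℝ I0 f0) {m p e : ℝ} (he : 0 < e)
    (hm : m ∈ I0) (hp : ∀ v ∈ I0, f0 v ≤ f0 m + p * (v - m)) :
    ∃ d > 0, ∀ v ∈ I0, e ≤ |v - m| → f0 v + d ≤ f0 m + p * (v - m) := by
  -- one-sided version
  have key : ∀ w, w ≠ m → ∃ d > 0, ∀ v ∈ I0, (∃ k ≥ (1 : ℝ), v - m = k * (w - m)) →
      f0 v + d ≤ f0 m + p * (v - m) := by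
    intro w hwm
    by_cases hw : w ∈ I0
    -- Equality at `w` would put the midpoint of `w` and `m` strictly above the supporting line.
    · have hlt : f0 w < f0 m + p * (w - m) := by
        have hmid := hf.2 hw hm hwm (show (0 : ℝ) < 1 / 2 by norm_num)
          (show (0 : ℝ) < 1 / 2 by norm_num) (by norm_num)
        have hI := hf.1 hw hm (show (0 : ℝ) ≤ 1 / 2 by norm_num)
          (show (0 : ℝ) ≤ 1 / 2 by norm_num) (by norm_num)
        have := hp _ hI
        simp only [smul_eq_mul] at hmid this
        linarith
      refine ⟨_, sub_pos.2 hlt, ?_⟩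
      rintro v hv ⟨k, hk, hvk⟩
      -- The point `w` lies between `m` and `v`, so by concavity the gap at `v` is at least `k ≥ 1`
      -- times the gap at `w`.
      have hc := hf.concaveOn.2 hv hm (show 0 ≤ 1 / k by positivity)
        (show 0 ≤ 1 - 1 / k by rw [sub_nonneg, div_le_one (by linarith)]; exact hk) (by ring)
      simp only [smul_eq_mul] at hc
      have hkw : 1 / k * v + (1 - 1 / k) * m = w := by
        have : v = m + k * (w - m) := by linarith
        rw [this]; field_simp; ring
      rw [hkw] at hc
      have hk0 : 0 < k := by linarith
      have h1 : 1 / k * f0 v + (1 - 1 / k) * f0 m = f0 m - (f0 m - f0 v) / k := by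
        field_simp; ring
      rw [h1, sub_le_iff_le_add, ← sub_le_iff_le_add', le_div_iff₀ hk0] at hc
      rw [hvk]
      nlinarith
    · refine ⟨1, one_pos, ?_⟩
      rintro v hv ⟨k, hk, hvk⟩
      refine absurd (hf.1.ordConnected.uIcc_subset hm hv ?_) hw
      rw [mem_uIcc]
      rcases le_total m w with h | h
      · left; constructor <;> nlinarith
      · right; constructor <;> nlinarith
  obtain ⟨d1, hd1, h1⟩ := key (m + e) (by simpa using he.ne')
  obtain ⟨d2, hd2, h2⟩ := key (m - e) (by simpa using he.ne')
  refine ⟨min d1 d2, lt_min hd1 hd2, fun v hv hev => ?_⟩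
  rcases le_total m v with h | h
  · rw [abs_of_nonneg (by linarith)] at hev
    have := h1 v hv ⟨(v - m) / e, by rwa [ge_iff_le, le_div_iff₀ he, one_mul], by field_simp; ring⟩
    linarith [min_le_left d1 d2]
  · rw [abs_of_nonpos (by linarith)] at hev
    have := h2 v hv ⟨(m - v) / e, by rw [ge_iff_le, le_div_iff₀ he, one_mul]; linarith,
      by field_simp; ring⟩
    linarith [min_le_right d1 d2]

/-- The accumulated flow vanishes for `G`-almost every `τ`, and unbounded support supplies such `τ`
beyond any given time. -/
theorem ae_eq_zero_of_integral (hr : 0 < r) (hG : IsUnboundedDistribution G) {q : ℝ → ℝ}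
    (hq : BddMeas q) (hq0 : ∀ t, 0 ≤ q t)
    (h : ∫ τ, (∫ s in Ioo 0 τ, r * Real.exp (-r * s) * q s) ∂G ≤ 0) :
    ∀ᵐ t, 0 < t → q t = 0 := by
  have := hG.prob
  have hw : ∀ s, 0 ≤ r * Real.exp (-r * s) * q s := fun s =>
    mul_nonneg (weight_pos hr s).le (hq0 s)
  have h0 : ∀ τ, 0 ≤ ∫ s in Ioo 0 τ, r * Real.exp (-r * s) * q s := fun τ =>
    integral_nonneg hw
  have h1 := (integral_eq_zero_iff_of_nonneg h0 ((hq.of_setIntegral hr).integrable G)).1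
    (le_antisymm h (integral_nonneg h0))
  have h2 : ∀ n : ℕ, ∀ᵐ t, t ∈ Ioo (0 : ℝ) n → q t = 0 := by
    intro n
    obtain ⟨τ, hτ, hnτ⟩ : ∃ τ, (∫ s in Ioo 0 τ, r * Real.exp (-r * s) * q s) = 0 ∧ (n : ℝ) < τ := by
      by_contra! hcon
      refine (hG.tail_pos n).ne' (measure_mono_null ?_ h1)
      intro τ hτ hz
      exact absurd (hcon τ hz) (not_le.2 hτ)
    rw [setIntegral_eq_zero_iff_of_nonneg_ae (Filter.Eventually.of_forall hw)
      ((hq.integrableOn_Ioi hr 0).mono_set Ioo_subset_Ioi_self)] at hτ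
    rw [Filter.EventuallyEq, ae_restrict_iff' measurableSet_Ioo] at hτ
    filter_upwards [hτ] with t ht htn
    have := ht ⟨htn.1, htn.2.trans hnτ⟩
    simpa [(weight_pos hr t).ne', hr.ne'] using this
  filter_upwards [ae_all_iff.2 h2] with t ht ht0
  obtain ⟨n, hn⟩ := exists_nat_gt t
  exact ht n ⟨ht0, hn⟩

/-- An optimal flow cannot be replaced by a constant on an excursion of the reward from a level at
which the supergradients `p0`, `p1` of the frontiers are ordered suitably. -/
theorem IsOptimalPath.ae_eq_of_excursion (hr : 0 < r) (hf0 : StrictConcaveOn ℝ I0 f0)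
    (hG : IsUnboundedDistribution G) (hx : IsOptimalPath r I0 I1 f0 f1 G x) {y : ℝ → ℝ} {m p0 p1 : ℝ}
    (hm0 : m ∈ I0) (hm1 : m ∈ I1)
    (hp0 : ∀ v ∈ I0, f0 v ≤ f0 m + p0 * (v - m)) (hp1 : ∀ v ∈ I1, f1 v ≤ f1 m + p1 * (v - m))
    (hp0' : 0 ≤ p0) (hy : BddMeas y) (hym : ∀ t, y t = m ∨ y t = x t)
    (hY : ∀ t, 0 ≤ t → promised r y t = m ∨ promised r y t = promised r x t)
    (hsign : ∀ t, 0 ≤ t → 0 ≤ (p1 - p0) * (promised r y t - promised r x t))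
    (hY0 : promised r x 0 ≤ promised r y 0) :
    ∀ᵐ t, 0 < t → y t = x t := by
  have := hG.prob
  have hxb := hx.bddMeas
  have hall : ∀ n : ℕ, ∀ᵐ t, 0 < t → |x t - y t| < 1 / ((n : ℝ) + 1) := by
    intro n
    have he : (0 : ℝ) < 1 / ((n : ℝ) + 1) := by positivity
    obtain ⟨d, hd, hgap⟩ := StrictConcaveOn.exists_gap hf0 he hm0 hp0
    -- On `S` the replacement moves the flow by an amount bounded below, so strict concavity yields
    -- a uniform extra gain `d` over the supporting line. It suffices that each such `S` is null.
    set S := {t | 1 / ((n : ℝ) + 1) ≤ |x t - y t|} with hS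
    have hSm : MeasurableSet S := measurableSet_le measurable_const (hxb.1.sub hy.1).abs
    have hσ : BddMeas (S.indicator fun _ => d) := (BddMeas.const d).indicator hSm
    have hyx := (hy.sub hxb).const_mul p0
    have hjm : BddMeas fun t => p1 * (promised r y (max 0 t) - promised r x (max 0 t)) := by
      have hc1 := continuous_promised hr hy
      have hc2 := continuous_promised hr hxb
      obtain ⟨C, hC⟩ := hxb.2
      obtain ⟨D, hD⟩ := hy.2
      have hb : ∀ (z : ℝ → ℝ) (C : ℝ) (hz : BddMeas z) (hC : ∀ t, |z t| ≤ C) (t : ℝ),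
          |promised r z t| ≤ C := by
        intro z C hz hC t
        have h1 := tailValue_mono hr hz (BddMeas.const C) (t := t)
          (Filter.Eventually.of_forall fun s _ => (abs_le.1 (hC s)).2)
        have h2 := tailValue_mono hr (BddMeas.const (-C)) hz (t := t)
          (Filter.Eventually.of_forall fun s _ => (abs_le.1 (hC s)).1)
        rw [tailValue_const hr, tailValue_eq_promised, mul_comm] at h1 h2
        have he := Real.exp_pos (-r * t)
        rw [abs_le]
        exact ⟨le_of_mul_le_mul_left (by linarith) he, le_of_mul_le_mul_left (by linarith) he⟩
      refine BddMeas.const_mul p1 ⟨(by fun_prop : Continuous _).measurable, D + C, fun t => ?_⟩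
      exact (abs_sub _ _).trans (add_le_add (hb y D hy hD _) (hb x C hxb hC _))
    have hopt := hx.optimal y (fun t => p0 * (y t - x t) + S.indicator (fun _ => d) t)
      (fun t => p1 * (promised r y (max 0 t) - promised r x (max 0 t))) hy (hyx.add hσ) hjm
      (fun t _ => by rcases hym t with h | h <;> rw [h]; exacts [hm0, hx.mem0 t])
      (fun t ht => by rcases hY t ht with h | h <;> rw [h]; exacts [hm1, hx.mem1 t ht])
      (fun t _ => by
        by_cases ht : t ∈ S
        · rcases hym t with h | h
          · have := hgap (x t) (hx.mem0 t) (by rw [← h]; exact ht)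
            simp only [ht, indicator_of_mem, h]
            linarith
          · simp only [hS, mem_ofPred_eq, h, sub_self, abs_zero] at ht
            linarith
        · rcases hym t with h | h
          · have := hp0 (x t) (hx.mem0 t)
            simp only [ht, not_false_eq_true, indicator_of_notMem, h]
            linarith
          · simp [ht, h])
      (fun t ht => by
        rw [max_eq_right ht]
        rcases hY t ht with h | h
        · have := hp1 _ (hx.mem1 t ht)
          rw [h]; linarith
        · rw [h]; simp)
    have hz := ae_eq_zero_of_integral hr hG hσ (fun t => indicator_nonneg (fun _ _ => hd.le) t) <| by
      refine le_trans (integral_mono_ae ((hσ.of_setIntegral hr).integrable G) ?_ ?_) hopt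
      · have hE : BddMeas fun τ => Real.exp (-r * max 0 τ) := by
          refine ⟨(by fun_prop : Continuous _).measurable, 1, fun t => ?_⟩
          rw [abs_of_pos (Real.exp_pos _)]
          exact Real.exp_le_one_iff.2 (by nlinarith [le_max_left 0 t])
        have := (((hyx.add hσ).of_setIntegral hr).add (hE.mul hjm)).integrable G
        refine this.congr ?_
        filter_upwards [hG.ae_nonneg] with τ hτ
        rw [max_eq_right hτ]
      · filter_upwards [hG.ae_nonneg] with τ hτ
        -- The linear part telescopes. With `D = Y - X`, the flow contributes `p0 (D 0 - e^{-rτ} D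
        -- τ)` and the reward `p1 e^{-rτ} D τ`, so the total is `p0 D 0 + e^{-rτ} (p1 - p0) D τ`,
        -- which is nonnegative by the sign hypotheses. Only the strict gain on `S` is left.
        have hint : (∫ s in Ioo 0 τ, r * Real.exp (-r * s) * (p0 * (y s - x s) + S.indicator (fun _ => d) s))
            = p0 * ((tailValue r y 0 - tailValue r x 0) - (tailValue r y τ - tailValue r x τ))
              + ∫ s in Ioo 0 τ, r * Real.exp (-r * s) * S.indicator (fun _ => d) s := by
          rw [setIntegral_Ioo_eq hr (hyx.add hσ) hτ, setIntegral_Ioo_eq hr hσ hτ,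
            tailValue_add hr hyx hσ, tailValue_add hr hyx hσ, tailValue_const_mul,
            tailValue_const_mul, tailValue_sub hr hy hxb, tailValue_sub hr hy hxb]
          ring
        simp only [hint, max_eq_right hτ]
        simp only [tailValue_eq_promised, mul_zero, Real.exp_zero, one_mul]
        have h1 := mul_nonneg (Real.exp_pos (-r * τ)).le (hsign τ hτ)
        have h2 := mul_nonneg hp0' (sub_nonneg.2 hY0)
        nlinarith
    filter_upwards [hz] with t ht ht0
    by_contra! hcon
    have : t ∈ S := hcon
    have := ht ht0
    simp_all
  filter_upwards [ae_all_iff.2 hall] with t ht ht0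
  by_contra hne
  have hpos : 0 < |x t - y t| := abs_pos.2 (sub_ne_zero.2 (Ne.symm hne))
  obtain ⟨n, hn⟩ := exists_nat_one_div_lt hpos
  exact absurd (ht n ht0) (not_lt.2 hn.le)

end

/-! ### The reward decreases -/

theorem exists_last_le {X : ℝ → ℝ} (hX : Continuous X) {s t m : ℝ} (hst : s ≤ t) (hs : X s ≤ m)
    (ht : m < X t) : ∃ a ∈ Ico s t, X a = m ∧ ∀ τ ∈ Ioc a t, m < X τ := by
  have hne : (Icc s t ∩ {τ | X τ = m}).Nonempty := by
    obtain ⟨c, hc, hc'⟩ := intermediate_value_Icc hst hX.continuousOn ⟨hs, ht.le⟩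
    exact ⟨c, hc, hc'⟩
  obtain ⟨a, ⟨ha, ham⟩, hmax⟩ := (isCompact_Icc.inter_right
    (isClosed_eq hX continuous_const)).exists_isGreatest hne
  have ham : X a = m := ham
  refine ⟨a, ⟨ha.1, ha.2.lt_of_ne ?_⟩, ham, fun τ hτ => ?_⟩
  · rintro rfl; linarith
  · by_contra! hcon
    obtain ⟨c, hc, hc'⟩ := intermediate_value_Icc hτ.2 hX.continuousOn ⟨hcon, ht.le⟩
    exact absurd (hmax ⟨⟨ha.1.trans (hτ.1.le.trans hc.1), hc.2⟩, hc'⟩)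
      (not_le.2 (hτ.1.trans_le hc.1))

theorem exists_first_le {X : ℝ → ℝ} (hX : Continuous X) {s t m : ℝ} (hst : s ≤ t) (hs : m < X s)
    (ht : X t ≤ m) : ∃ b ∈ Ioc s t, X b = m ∧ ∀ τ ∈ Ico s b, m < X τ := by
  obtain ⟨a, ha, ham, h⟩ := exists_last_le (X := fun τ => X (-τ)) (by fun_prop)
    (neg_le_neg hst) (by simpa using ht) (by simpa using hs)
  refine ⟨-a, ⟨by linarith [ha.2], by linarith [ha.1]⟩, ham, fun τ hτ => ?_⟩
  simpa using h (-τ) ⟨by linarith [hτ.2], by linarith [hτ.1]⟩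

section
variable {r u0 : ℝ} {I0 I1 : Set ℝ} {f0 f1 : ℝ → ℝ} {G : Measure ℝ} {x : ℝ → ℝ}

theorem tailValue_const_sub (hr : 0 < r) (hx : BddMeas x) (m t : ℝ) :
    tailValue r (fun s => m - x s) t = Real.exp (-r * t) * (m - promised r x t) := by
  rw [tailValue_sub hr (BddMeas.const m) hx, tailValue_const hr, tailValue_eq_promised]; ring

theorem exp_mul_exp_neg (r t : ℝ) : Real.exp (r * t) * Real.exp (-r * t) = 1 := by
  rw [← Real.exp_add]; simp

/-- Because the reward at `b` is already `m`, the constant flow `m` on `(a,b)` keeps it at `m` back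
to `a`. Earlier rewards change only by the discounted jump `m - X a`, which vanishes when the
excursion also starts at level `m`. -/
theorem promised_replace_Ioo (hr : 0 < r) (hx : BddMeas x) {a b m : ℝ} (hab : a ≤ b)
    (hb : promised r x b = m) {u : ℝ} :
    promised r (fun s => x s + (Ioo a b).indicator (fun s => m - x s) s) u =
      if u ≤ a then promised r x u + Real.exp (r * u) * (Real.exp (-r * a) * (m - promised r x a))
      else if u ≤ b then m else promised r x u := by
  have hd := (BddMeas.const m).sub hx
  have h1 : promised r (fun s => x s + (Ioo a b).indicator (fun s => m - x s) s) u
      = promised r x u + Real.exp (r * u) *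
        tailValue r (fun s => m - x s) (min (max a u) b) := by
    unfold promised
    rw [tailValue_add hr hx (hd.indicator measurableSet_Ioo), tailValue_indicator_Ioo hr hd,
      tailValue_const_sub hr hx m b, hb]
    ring
  rw [h1, tailValue_const_sub hr hx]
  split_ifs with h h'
  · rw [max_eq_left h, min_eq_left hab]
  · rw [max_eq_right (not_le.1 h).le, min_eq_left h', ← mul_assoc, exp_mul_exp_neg]; ring
  · rw [min_eq_right ((not_le.1 h').le.trans (le_max_right _ _)), hb]; ring

theorem promised_replace_Ioi (hr : 0 < r) (hx : BddMeas x) {a m : ℝ} {u : ℝ} :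
    promised r (fun s => x s + (Ioi a).indicator (fun s => m - x s) s) u =
      if u ≤ a then promised r x u + Real.exp (r * u) * (Real.exp (-r * a) * (m - promised r x a))
      else m := by
  have hd := (BddMeas.const m).sub hx
  have h0 : tailValue r ((Ioi a).indicator fun s => m - x s) u
      = tailValue r (fun s => m - x s) (max a u) := by
    unfold tailValue
    have : (fun v => r * Real.exp (-r * v) * (Ioi a).indicator (fun s => m - x s) v)
        = (Ioi a).indicator fun v => r * Real.exp (-r * v) * (m - x v) := by
      ext v; by_cases h : v ∈ Ioi a <;> simp [h]
    rw [this, setIntegral_indicator measurableSet_Ioi, Ioi_inter_Ioi, max_comm]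
  have h1 : promised r (fun s => x s + (Ioi a).indicator (fun s => m - x s) s) u
      = promised r x u + Real.exp (r * u) * tailValue r (fun s => m - x s) (max a u) := by
    unfold promised
    rw [tailValue_add hr hx (hd.indicator measurableSet_Ioi), h0]
    ring
  rw [h1, tailValue_const_sub hr hx]
  split_ifs with h
  · rw [max_eq_left h]
  · rw [max_eq_right (not_le.1 h).le, ← mul_assoc, exp_mul_exp_neg]; ring

theorem promised_congr_ae {y : ℝ → ℝ} (h : ∀ᵐ t, 0 < t → y t = x t) {t : ℝ} (ht : 0 ≤ t) :
    promised r y t = promised r x t := by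
  unfold promised
  rw [tailValue_congr_ae]
  filter_upwards [h] with s hs hst using hs (ht.trans_lt hst)

/-- The reward of an optimal path is decreasing. -/
theorem IsOptimalPath.antitoneOn (hr : 0 < r) (h0 : IsDomain u0 I0 f0) (h1 : IsDomain u0 I1 f1)
    (hf0 : StrictConcaveOn ℝ I0 f0) (hmono : MonotoneOn f0 I0)
    (hG : IsUnboundedDistribution G) (hx : IsOptimalPath r I0 I1 f0 f1 G x) :
    AntitoneOn (promised r x) (Ici 0) := by
  intro s hs t ht hst
  by_contra! hlt
  have hs : 0 ≤ s := hs
  have ht : 0 ≤ t := ht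
  have hxb := hx.bddMeas
  have hX := continuous_promised hr hxb
  -- A level strictly between the two rewards is interior to both domains, so both frontiers have
  -- supergradients there.
  obtain ⟨m, hsm, hmt⟩ := exists_between hlt
  have hm : m ∈ Ioo 0 u0 :=
    ⟨(h1.subset_Icc (hx.mem1 s hs)).1.trans_lt hsm, hmt.trans_le (h1.subset_Icc (hx.mem1 t ht)).2⟩
  have hm0 : m ∈ I0 := h0.Ioc_subset ⟨hm.1, hm.2.le⟩
  have hm1 : m ∈ I1 := h1.Ioc_subset ⟨hm.1, hm.2.le⟩
  obtain ⟨p0, hp0⟩ := h0.exists_supergradient hm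
  obtain ⟨p1, hp1⟩ := h1.exists_supergradient hm
  have hp0' : 0 ≤ p0 := by
    have hu0 : u0 ∈ I0 := h0.Ioc_subset ⟨hm.1.trans hm.2, le_rfl⟩
    have h2 := hp0 u0 hu0
    have h3 := hmono hm0 hu0 hm.2.le
    exact nonneg_of_mul_nonneg_left (by linarith) (sub_pos.2 hm.2)
  have hd := (BddMeas.const m).sub hxb
  -- replacing the flow by `m` on a set `J` of times is impossible
  have key : ∀ (J : Set ℝ), MeasurableSet J → ∀ σ : ℝ, 0 ≤ σ → promised r x σ ≠ m →
      promised r (fun s => x s + J.indicator (fun s => m - x s) s) σ = m →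
      (∀ t, 0 ≤ t →
        promised r (fun s => x s + J.indicator (fun s => m - x s) s) t = m ∧
          0 ≤ (p1 - p0) * (m - promised r x t) ∨
        promised r (fun s => x s + J.indicator (fun s => m - x s) s) t = promised r x t) →
      promised r x 0 ≤ promised r (fun s => x s + J.indicator (fun s => m - x s) s) 0 → False := by
    intro J hJ σ hσ hne hYσ hY hY0
    have := hx.ae_eq_of_excursion hr hf0 hG hm0 hm1 hp0 hp1 hp0' (hxb.add (hd.indicator hJ))
      (fun t => by
        by_cases h : t ∈ J
        · left; simp [h]
        · right; simp [h])
      (fun t ht => (hY t ht).imp (fun h => h.1) id)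
      (fun t ht => by
        rcases hY t ht with h | h
        · rw [h.1]; exact h.2
        · rw [h]; simp) hY0
    rw [promised_congr_ae this hσ] at hYσ
    exact hne hYσ
  -- If `p1 ≤ p0`, lowering the reward to `m` pays to first order, so the excursion above `m` around
  -- `t` is flattened; otherwise the excursion below `m` around `s` is.
  rcases le_total p1 p0 with hp | hp
  · obtain ⟨a, ha, ham, hat⟩ := exists_last_le hX hst hsm.le hmt
    have ha0 : 0 ≤ a := hs.trans ha.1
    by_cases hb : ∃ τ, t ≤ τ ∧ promised r x τ ≤ m
    · obtain ⟨τ, hτ, hτm⟩ := hb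
      obtain ⟨b, hb, hbm, htb⟩ := exists_first_le hX hτ hmt hτm
      have hab : a ≤ b := ha.2.le.trans hb.1.le
      refine key (Ioo a b) measurableSet_Ioo t ht hmt.ne' ?_ (fun u hu => ?_) ?_
      · rw [promised_replace_Ioo hr hxb hab hbm, if_neg (not_le.2 ha.2), if_pos hb.1.le]
      · rw [promised_replace_Ioo hr hxb hab hbm, ham]
        split_ifs with h h'
        · right; simp
        · left
          refine ⟨rfl, mul_nonneg_of_nonpos_of_nonpos (by linarith) (sub_nonpos.2 ?_)⟩
          rcases h'.eq_or_lt with rfl | h'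
          · exact hbm.ge
          · rcases le_total u t with h2 | h2
            · exact (hat u ⟨not_le.1 h, h2⟩).le
            · exact (htb u ⟨h2, h'⟩).le
        · right; rfl
      · rw [promised_replace_Ioo hr hxb hab hbm, ham, if_pos ha0]; simp
    -- The excursion above `m` never ends; the constant `m` is then used forever after `a`.
    · push Not at hb
      refine key (Ioi a) measurableSet_Ioi t ht hmt.ne' ?_ (fun u hu => ?_) ?_
      · rw [promised_replace_Ioi hr hxb, if_neg (not_le.2 ha.2)]
      · rw [promised_replace_Ioi hr hxb, ham]
        split_ifs with h
        · right; simp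
        · left
          refine ⟨rfl, mul_nonneg_of_nonpos_of_nonpos (by linarith) (sub_nonpos.2 ?_)⟩
          rcases le_total u t with h2 | h2
          · exact (hat u ⟨not_le.1 h, h2⟩).le
          · exact (hb u h2).le
      · rw [promised_replace_Ioi hr hxb, ham, if_pos ha0]; simp
  · obtain ⟨b, hb, hbm', hsb⟩ := exists_first_le (X := fun τ => -promised r x τ) hX.neg hst
      (neg_lt_neg hsm) (neg_le_neg hmt.le)
    have hbm : promised r x b = m := neg_injective hbm'
    by_cases ha : ∃ τ ∈ Icc 0 s, m ≤ promised r x τ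
    · obtain ⟨τ, hτ, hτm⟩ := ha
      obtain ⟨a, ha, ham', hat⟩ := exists_last_le (X := fun τ => -promised r x τ) hX.neg hτ.2
        (neg_le_neg hτm) (neg_lt_neg hsm)
      have ham : promised r x a = m := neg_injective ham'
      have ha0 : 0 ≤ a := hτ.1.trans ha.1
      have hab : a ≤ b := ha.2.le.trans hb.1.le
      refine key (Ioo a b) measurableSet_Ioo s hs hsm.ne ?_ (fun u hu => ?_) ?_
      · rw [promised_replace_Ioo hr hxb hab hbm, if_neg (not_le.2 ha.2), if_pos hb.1.le]
      · rw [promised_replace_Ioo hr hxb hab hbm, ham]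
        split_ifs with h h'
        · right; simp
        · left
          refine ⟨rfl, mul_nonneg (by linarith) (sub_nonneg.2 ?_)⟩
          rcases h'.eq_or_lt with rfl | h'
          · exact hbm.le
          · rcases le_total u s with h2 | h2
            · exact (neg_lt_neg_iff.1 (hat u ⟨not_le.1 h, h2⟩)).le
            · exact (neg_lt_neg_iff.1 (hsb u ⟨h2, h'⟩)).le
        · right; rfl
      · rw [promised_replace_Ioo hr hxb hab hbm, ham, if_pos ha0]; simp
    -- The excursion below `m` has been running since time `0`. There is no matching level at its
    -- start, but the initial reward only rises, which is harmless as `p0 ≥ 0`.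
    · push Not at ha
      have hb0 : 0 ≤ b := hs.trans hb.1.le
      have hval : ∀ u, 0 ≤ u → promised r (fun s => x s + (Ioo 0 b).indicator (fun s => m - x s) s) u
          = if u ≤ b then m else promised r x u := by
        intro u hu
        rw [promised_replace_Ioo hr hxb hb0 hbm]
        rcases hu.eq_or_lt with rfl | hu
        · simp [hb0]
        · rw [if_neg (not_le.2 hu)]
      refine key (Ioo 0 b) measurableSet_Ioo s hs hsm.ne ?_ (fun u hu => ?_) ?_
      · rw [hval s hs, if_pos hb.1.le]
      · rw [hval u hu]
        split_ifs with h'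
        · left
          refine ⟨rfl, mul_nonneg (by linarith) (sub_nonneg.2 ?_)⟩
          rcases h'.eq_or_lt with rfl | h'
          · exact hbm.le
          · rcases le_total u s with h2 | h2
            · exact (ha u ⟨hu, h2⟩).le
            · exact (neg_lt_neg_iff.1 (hsb u ⟨h2, h'⟩)).le
        · right; rfl
      · rw [hval 0 le_rfl, if_pos hb0]
        exact (ha 0 ⟨le_rfl, hs⟩).le

end

/-! ### First-order conditions for shifting flow in time -/

/-- The flow that is constant on `B` and whose value is `1`. -/
def unitFlow (r : ℝ) (B : Set ℝ) (t : ℝ) : ℝ :=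
  (∫ s in B, r * Real.exp (-r * s))⁻¹ * B.indicator (fun _ => 1) t

section
variable {r u0 : ℝ} {I0 I1 : Set ℝ} {f0 f1 : ℝ → ℝ} {G : Measure ℝ} {x : ℝ → ℝ} {B : Set ℝ} {a b : ℝ}

theorem unitFlow_of_mem {t : ℝ} (ht : t ∈ B) :
    unitFlow r B t = (∫ s in B, r * Real.exp (-r * s))⁻¹ := by simp [unitFlow, ht]

theorem unitFlow_of_notMem {t : ℝ} (ht : t ∉ B) : unitFlow r B t = 0 := by simp [unitFlow, ht]

theorem bddMeas_unitFlow (hB : MeasurableSet B) : BddMeas (unitFlow r B) :=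
  ((BddMeas.const 1).indicator hB).const_mul _

theorem integrableOn_weight_of_subset (hr : 0 < r) (hBab : B ⊆ Ioo a b) :
    IntegrableOn (fun s => r * Real.exp (-r * s)) B :=
  (integrableOn_weight hr a).mono_set fun _ ht => (hBab ht).1

theorem weight_set_pos (hr : 0 < r) (hBab : B ⊆ Ioo a b)
    (hpos : 0 < volume B) : 0 < ∫ s in B, r * Real.exp (-r * s) := by
  rw [setIntegral_pos_iff_support_of_nonneg_ae
    (Filter.Eventually.of_forall fun s => (weight_pos hr s).le)
    (integrableOn_weight_of_subset hr hBab)]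
  have : (Function.support fun s => r * Real.exp (-r * s)) = univ :=
    eq_univ_of_forall fun s => (weight_pos hr s).ne'
  rwa [this, univ_inter]

theorem tailValue_unitFlow (hB : MeasurableSet B) (t : ℝ) :
    tailValue r (unitFlow r B) t =
      (∫ s in B, r * Real.exp (-r * s))⁻¹ * ∫ s in Ioi t ∩ B, r * Real.exp (-r * s) := by
  unfold tailValue
  rw [← setIntegral_indicator hB, ← integral_const_mul]
  congr 1
  ext s
  by_cases h : s ∈ B <;> simp [unitFlow, h, mul_comm]

/-- The tail value of a unit flow is a smoothed step, falling from `1` before `a` to `0` after `b`.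
-/
theorem tailValue_unitFlow_of_le (hr : 0 < r) (hB : MeasurableSet B) (hBab : B ⊆ Ioo a b)
    (hpos : 0 < volume B) {t : ℝ} (ht : t ≤ a) : tailValue r (unitFlow r B) t = 1 := by
  rw [tailValue_unitFlow hB, inter_eq_right.2 (show B ⊆ Ioi t from fun s hs => ht.trans_lt (hBab hs).1)]
  exact inv_mul_cancel₀ (weight_set_pos hr hBab hpos).ne'

theorem tailValue_unitFlow_of_ge (hB : MeasurableSet B) (hBab : B ⊆ Ioo a b) {t : ℝ} (ht : b ≤ t) :
    tailValue r (unitFlow r B) t = 0 := by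
  have : Ioi t ∩ B = ∅ := by
    ext s
    simp only [mem_inter_iff, mem_Ioi, mem_empty_iff_false, iff_false, not_and]
    intro h1 h2
    linarith [(hBab h2).2]
  rw [tailValue_unitFlow hB, this]
  simp

theorem tailValue_unitFlow_mem_Icc (hr : 0 < r) (hB : MeasurableSet B) (hBab : B ⊆ Ioo a b)
    (hpos : 0 < volume B) (t : ℝ) : tailValue r (unitFlow r B) t ∈ Icc (0 : ℝ) 1 := by
  have hw := weight_set_pos hr hBab hpos
  rw [tailValue_unitFlow hB]
  constructor
  · exact mul_nonneg (inv_nonneg.2 hw.le) (integral_nonneg fun s => (weight_pos hr s).le)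
  · rw [inv_mul_le_one₀ hw]
    exact setIntegral_mono_set (integrableOn_weight_of_subset hr hBab)
      (Filter.Eventually.of_forall fun s => (weight_pos hr s).le)
      (Filter.Eventually.of_forall fun s hs => hs.2)

theorem setIntegral_unitFlow_of_nonneg (hr : 0 < r) (hB : MeasurableSet B)
    (hBab : B ⊆ Ioo a b) (ha : 0 ≤ a) (hpos : 0 < volume B) {t : ℝ} (ht : 0 ≤ t) :
    ∫ s in Ioo 0 t, r * Real.exp (-r * s) * unitFlow r B s = 1 - tailValue r (unitFlow r B) t := by
  rw [setIntegral_Ioo_eq hr (bddMeas_unitFlow hB) ht, tailValue_unitFlow_of_le hr hB hBab hpos ha]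

/-- No gain from shifting a small amount of flow between two sets of times. -/
theorem IsOptimalPath.shift (hr : 0 < r) (hG : IsUnboundedDistribution G)
    (hx : IsOptimalPath r I0 I1 f0 f1 G x) {σ s1 t1 t2 α β δ C : ℝ} {B1 B2 : Set ℝ} {c : ℝ → ℝ}
    (hB1 : MeasurableSet B1) (hB2 : MeasurableSet B2) (hB1s : B1 ⊆ Ioo s1 t1) (hB2s : B2 ⊆ Ioo t1 t2)
    (hp1 : 0 < volume B1) (hp2 : 0 < volume B2)
    (hc : Measurable c) (hcC : ∀ t, |c t| ≤ C) (h12 : t1 < t2) (hδ : 0 < δ)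
    (hI1 : ∀ t ∈ B1, 0 < t → ∀ e, 0 ≤ e → e ≤ δ →
      x t - σ * e ∈ I0 ∧ f0 (x t) - σ * α * e ≤ f0 (x t - σ * e))
    (hI2 : ∀ t ∈ B2, 0 < t → ∀ e, 0 ≤ e → e ≤ δ →
      x t + σ * e ∈ I0 ∧ f0 (x t) + σ * β * e ≤ f0 (x t + σ * e))
    (hF : ∀ t, 0 ≤ t → s1 < t → t < t2 → ∀ e, 0 ≤ e → e ≤ δ →
      promised r x t + σ * e ∈ I1 ∧
        f1 (promised r x t) + σ * c t * e ≤ f1 (promised r x t + σ * e)) :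
    σ * ∫ τ, (β * (∫ s in Ioo 0 τ, r * Real.exp (-r * s) * unitFlow r B2 s)
      - α * (∫ s in Ioo 0 τ, r * Real.exp (-r * s) * unitFlow r B1 s)
      + c τ * (tailValue r (unitFlow r B2) τ - tailValue r (unitFlow r B1) τ)) ∂G ≤ 0 := by
  have := hG.prob
  set w1 := ∫ s in B1, r * Real.exp (-r * s) with hw1
  set w2 := ∫ s in B2, r * Real.exp (-r * s) with hw2
  have hw1p : 0 < w1 := weight_set_pos hr hB1s hp1
  have hw2p : 0 < w2 := weight_set_pos hr hB2s hp2
  -- The first two bounds keep the flow changes `ε / w1` and `ε / w2` within `δ`; the third does so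
  -- for the reward change, which is at most `e^{r t2} ε`.
  set ε := min (min (δ * w1) (δ * w2)) (δ * Real.exp (-r * t2)) with hε
  have hε0 : 0 < ε := lt_min (lt_min (by positivity) (by positivity)) (by positivity)
  have hε1 : ε * w1⁻¹ ≤ δ := by
    rw [← div_eq_mul_inv, div_le_iff₀ hw1p]; exact (min_le_left _ _).trans (min_le_left _ _)
  have hε2 : ε * w2⁻¹ ≤ δ := by
    rw [← div_eq_mul_inv, div_le_iff₀ hw2p]; exact (min_le_left _ _).trans (min_le_right _ _)
  have hε3 : Real.exp (r * t2) * ε ≤ δ := by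
    calc Real.exp (r * t2) * ε ≤ Real.exp (r * t2) * (δ * Real.exp (-r * t2)) :=
          mul_le_mul_of_nonneg_left (min_le_right _ _) (Real.exp_pos _).le
      _ = δ * (Real.exp (r * t2) * Real.exp (-r * t2)) := by ring
      _ = δ := by rw [exp_mul_exp_neg, mul_one]
  set d1 := unitFlow r B1 with hd1
  set d2 := unitFlow r B2 with hd2
  have hb1 : BddMeas d1 := bddMeas_unitFlow hB1
  have hb2 : BddMeas d2 := bddMeas_unitFlow hB2
  set H1 := tailValue r d1 with hH1
  set H2 := tailValue r d2 with hH2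
  have hH1c : Continuous H1 := continuous_tailValue hr hb1
  have hH2c : Continuous H2 := continuous_tailValue hr hb2
  have hm1 := tailValue_unitFlow_mem_Icc hr hB1 hB1s hp1
  have hm2 := tailValue_unitFlow_mem_Icc hr hB2 hB2s hp2
  have hle : ∀ t, 0 ≤ H2 t - H1 t := by
    intro t
    rcases le_total t t1 with h | h
    · rw [hH2, hd2, tailValue_unitFlow_of_le hr hB2 hB2s hp2 h]; linarith [(hm1 t).2]
    · rw [hH1, hd1, tailValue_unitFlow_of_ge hB1 hB1s h]; linarith [(hm2 t).1]
  have hle1 : ∀ t, H2 t - H1 t ≤ 1 := fun t => by linarith [(hm1 t).1, (hm2 t).2]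
  have hout : ∀ t, ¬ (s1 < t ∧ t < t2) → H2 t - H1 t = 0 := by
    intro t ht
    by_cases h : t ≤ s1
    · rw [hH1, hd1, tailValue_unitFlow_of_le hr hB1 hB1s hp1 h]
      obtain ⟨s, hs⟩ := nonempty_of_measure_ne_zero hp1.ne'
      rw [hH2, hd2, tailValue_unitFlow_of_le hr hB2 hB2s hp2
        (h.trans ((hB1s hs).1.trans (hB1s hs).2).le), sub_self]
    · have h2 : t2 ≤ t := by
        by_contra! h2; exact ht ⟨not_le.1 h, h2⟩
      rw [hH1, hd1, tailValue_unitFlow_of_ge hB1 hB1s (h12.le.trans h2),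
        hH2, hd2, tailValue_unitFlow_of_ge hB2 hB2s h2, sub_self]
  have hdd := hb2.sub hb1
  -- The shift has value zero at time `0`, so the reward moves only between `s1` and `t2`, and there
  -- in the direction of `σ`.
  have hy : BddMeas fun t => x t + σ * ε * (d2 t - d1 t) := hx.bddMeas.add (hdd.const_mul _)
  have hY : ∀ t, promised r (fun t => x t + σ * ε * (d2 t - d1 t)) t
      = promised r x t + σ * (Real.exp (r * t) * ε * (H2 t - H1 t)) := by
    intro t
    unfold promised
    rw [tailValue_add hr hx.bddMeas (hdd.const_mul _), tailValue_const_mul, tailValue_sub hr hb2 hb1]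
    ring
  have hsize : ∀ t, s1 < t → t < t2 → 0 ≤ Real.exp (r * t) * ε * (H2 t - H1 t) ∧
      Real.exp (r * t) * ε * (H2 t - H1 t) ≤ δ := by
    intro t h1 h2
    have h3 : Real.exp (r * t) * ε ≤ Real.exp (r * t2) * ε :=
      mul_le_mul_of_nonneg_right (Real.exp_le_exp.2 (by nlinarith)) hε0.le
    have h4 : 0 ≤ Real.exp (r * t) * ε := by positivity
    exact ⟨mul_nonneg h4 (hle t), by nlinarith [hle t, hle1 t]⟩
  have hq : BddMeas fun t => σ * ε * (β * d2 t - α * d1 t) :=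
    ((hb2.const_mul β).sub (hb1.const_mul α)).const_mul _
  have hj : BddMeas fun t => σ * c t * (Real.exp (r * t) * ε * (H2 t - H1 t)) := by
    refine ⟨by fun_prop, |σ| * C * δ, fun t => ?_⟩
    have hC : 0 ≤ C := (abs_nonneg _).trans (hcC 0)
    by_cases h : s1 < t ∧ t < t2
    · obtain ⟨h3, h4⟩ := hsize t h.1 h.2
      rw [abs_mul, abs_mul, abs_of_nonneg h3]
      exact mul_le_mul (mul_le_mul_of_nonneg_left (hcC t) (abs_nonneg _)) h4 h3 (by positivity)
    · beta_reduce
      rw [hout t h, mul_zero, mul_zero, abs_zero]; positivity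
  have hdisj : ∀ t ∈ B1, t ∉ B2 := fun t h1 h2 => by linarith [(hB1s h1).2, (hB2s h2).1]
  have hopt := hx.optimal _ _ _ hy hq hj
    (fun t ht => by
      by_cases h1 : t ∈ B1
      · have := (hI1 t h1 ht (ε * w1⁻¹) (by positivity) hε1).1
        rw [hd1, hd2, unitFlow_of_mem h1, unitFlow_of_notMem (hdisj t h1), ← hw1]
        convert this using 1; ring
      · by_cases h2 : t ∈ B2
        · have := (hI2 t h2 ht (ε * w2⁻¹) (by positivity) hε2).1
          rw [hd1, hd2, unitFlow_of_mem h2, unitFlow_of_notMem h1, ← hw2]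
          convert this using 1; ring
        · rw [hd1, hd2, unitFlow_of_notMem h1, unitFlow_of_notMem h2]
          simpa using hx.mem0 t)
    (fun t ht => by
      rw [hY]
      by_cases h : s1 < t ∧ t < t2
      · exact (hF t ht h.1 h.2 _ (hsize t h.1 h.2).1 (hsize t h.1 h.2).2).1
      · rw [hout t h]; simpa using hx.mem1 t ht)
    (fun t ht => by
      by_cases h1 : t ∈ B1
      · have := (hI1 t h1 ht (ε * w1⁻¹) (by positivity) hε1).2
        rw [hd1, hd2, unitFlow_of_mem h1, unitFlow_of_notMem (hdisj t h1), ← hw1]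
        convert this using 1
        · ring
        · congr 1; ring
      · by_cases h2 : t ∈ B2
        · have := (hI2 t h2 ht (ε * w2⁻¹) (by positivity) hε2).2
          rw [hd1, hd2, unitFlow_of_mem h2, unitFlow_of_notMem h1, ← hw2]
          convert this using 1
          · ring
          · congr 1; ring
        · rw [hd1, hd2, unitFlow_of_notMem h1, unitFlow_of_notMem h2]
          simp)
    (fun t ht => by
      rw [hY]
      by_cases h : s1 < t ∧ t < t2
      · exact (hF t ht h.1 h.2 _ (hsize t h.1 h.2).1 (hsize t h.1 h.2).2).2
      · rw [hout t h]; simp)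
  have heq : ∀ τ, (∫ s in Ioo 0 τ, r * Real.exp (-r * s) * (σ * ε * (β * d2 s - α * d1 s)))
      + Real.exp (-r * τ) * (σ * c τ * (Real.exp (r * τ) * ε * (H2 τ - H1 τ)))
      = ε * (σ * (β * (∫ s in Ioo 0 τ, r * Real.exp (-r * s) * d2 s)
      - α * (∫ s in Ioo 0 τ, r * Real.exp (-r * s) * d1 s) + c τ * (H2 τ - H1 τ))) := by
    intro τ
    rw [setIntegral_Ioo_eq_max hr hq, setIntegral_Ioo_eq_max hr hb1, setIntegral_Ioo_eq_max hr hb2]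
    have hβ := hb2.const_mul β
    have hα := hb1.const_mul α
    simp only [tailValue_const_mul, tailValue_sub hr hβ hα]
    have := exp_mul_exp_neg r τ
    linear_combination (σ * c τ * ε * (H2 τ - H1 τ)) * this
  simp only [heq] at hopt
  rw [integral_const_mul, integral_const_mul] at hopt
  exact nonpos_of_mul_nonpos_right hopt hε0

/-- First-order condition for shifting flow between the times `t1 < t2`; `σ = 1` raises the reward
in between, and `σ = -1` lowers it. For `t1 = 0` only the flow at `t2` changes. -/
theorem IsOptimalPath.needle (hr : 0 < r) (hG : IsUnboundedDistribution G)
    (hx : IsOptimalPath r I0 I1 f0 f1 G x) {σ s1 t1 t2 α β δ C : ℝ} {S1 S2 : Set ℝ} {c : ℝ → ℝ}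
    (hS1 : MeasurableSet S1) (hS2 : MeasurableSet S2) (hc : Measurable c) (hcC : ∀ t, |c t| ≤ C)
    (ht1 : 0 ≤ t1) (hα : t1 = 0 → α = 0) (hs1 : s1 < t1) (h12 : t1 < t2) (hδ : 0 < δ)
    (hL1 : LeftAcc S1 t1) (hL2 : LeftAcc S2 t2)
    (hI1 : ∀ t ∈ S1, 0 < t → s1 < t → t < t1 → ∀ e, 0 ≤ e → e ≤ δ →
      x t - σ * e ∈ I0 ∧ f0 (x t) - σ * α * e ≤ f0 (x t - σ * e))
    (hI2 : ∀ t ∈ S2, 0 < t → t1 < t → t < t2 → ∀ e, 0 ≤ e → e ≤ δ →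
      x t + σ * e ∈ I0 ∧ f0 (x t) + σ * β * e ≤ f0 (x t + σ * e))
    (hF : ∀ t, 0 ≤ t → s1 < t → t < t2 → ∀ e, 0 ≤ e → e ≤ δ →
      promised r x t + σ * e ∈ I1 ∧
        f1 (promised r x t) + σ * c t * e ≤ f1 (promised r x t + σ * e)) :
    σ * (β * G.real (Ici t2) - α * G.real (Ici t1) + ∫ τ in Ico t1 t2, c τ ∂G) ≤ 0 := by
  have := hG.prob
  -- The windows to the left of `t1` and `t2` must stay in `(s1,t1)` and `(t1,t2)`, and at positive
  -- times if `t1 > 0`. For `t1 = 0` the first window lies at negative times, where the flow is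
  -- free.
  obtain ⟨η, hη, hη1, hη2, hη3⟩ : ∃ η > 0, η ≤ t2 - t1 ∧ η ≤ t1 - s1 ∧ (0 < t1 → η ≤ t1) := by
    rcases ht1.eq_or_lt with h | h
    · exact ⟨min (t2 - t1) (t1 - s1), lt_min (by linarith) (by linarith), min_le_left _ _,
        min_le_right _ _, fun h' => absurd h h'.ne⟩
    · exact ⟨min (min (t2 - t1) (t1 - s1)) t1, lt_min (lt_min (by linarith) (by linarith)) h,
        (min_le_left _ _).trans (min_le_left _ _), (min_le_left _ _).trans (min_le_right _ _),
        fun _ => min_le_right _ _⟩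
  set e : ℕ → ℝ := fun n => η / (n + 1) with he
  have he0 : ∀ n, 0 < e n := fun n => by positivity
  have heη : ∀ n, e n ≤ η := fun n => div_le_self hη.le (by linarith [n.cast_nonneg (α := ℝ)])
  have helim : ∀ {a : ℝ}, 0 < a → ∀ᶠ n in Filter.atTop, e n < a := fun ha =>
    Filter.Tendsto.eventually_lt_const ha <| by
      simpa [he, div_eq_mul_inv] using
        (tendsto_one_div_add_atTop_nhds_zero_nat (𝕜 := ℝ)).const_mul η
  set B1 : ℕ → Set ℝ := fun n => S1 ∩ Ioo (t1 - e n) t1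
  set B2 : ℕ → Set ℝ := fun n => S2 ∩ Ioo (t2 - e n) t2
  have hB1 : ∀ n, MeasurableSet (B1 n) := fun n => hS1.inter measurableSet_Ioo
  have hB2 : ∀ n, MeasurableSet (B2 n) := fun n => hS2.inter measurableSet_Ioo
  have hB1s : ∀ n, B1 n ⊆ Ioo (t1 - e n) t1 := fun n => inter_subset_right
  have hB2s : ∀ n, B2 n ⊆ Ioo (t2 - e n) t2 := fun n => inter_subset_right
  have hp1 : ∀ n, 0 < volume (B1 n) := fun n => hL1 _ (by linarith [he0 n])
  have hp2 : ∀ n, 0 < volume (B2 n) := fun n => hL2 _ (by linarith [he0 n])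
  set H1 : ℕ → ℝ → ℝ := fun n => tailValue r (unitFlow r (B1 n))
  set H2 : ℕ → ℝ → ℝ := fun n => tailValue r (unitFlow r (B2 n))
  set Φ : ℕ → ℝ → ℝ := fun n τ => β * (1 - H2 n τ) - α * (1 - H1 n τ) + c τ * (H2 n τ - H1 n τ)
  have hstep : ∀ n, σ * ∫ τ, Φ n τ ∂G ≤ 0 := by
    intro n
    have h := hx.shift hr hG (hB1 n) (hB2 n) ((hB1s n).trans (Ioo_subset_Ioo (show s1 ≤ _ by linarith [heη n]) le_rfl))
      ((hB2s n).trans (Ioo_subset_Ioo (show t1 ≤ _ by linarith [heη n]) le_rfl)) (hp1 n) (hp2 n) hc hcC h12 hδ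
      (α := α) (β := β)
      (fun t ht h0 => hI1 t ht.1 h0 (by linarith [ht.2.1, heη n]) ht.2.2)
      (fun t ht h0 => hI2 t ht.1 h0 (by linarith [ht.2.1, heη n]) ht.2.2) hF
    refine le_trans (le_of_eq ?_) h
    congr 1
    refine integral_congr_ae ?_
    filter_upwards [hG.ae_nonneg] with τ hτ
    have hK2 := setIntegral_unitFlow_of_nonneg hr (hB2 n) (hB2s n) (by linarith [heη n]) (hp2 n) hτ
    have hK1 : α * (∫ s in Ioo 0 τ, r * Real.exp (-r * s) * unitFlow r (B1 n) s) = α * (1 - H1 n τ) := by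
      rcases ht1.eq_or_lt with h0 | h0
      · rw [hα h0.symm]; simp
      · rw [setIntegral_unitFlow_of_nonneg hr (hB1 n) (hB1s n) (by linarith [heη n, hη3 h0]) (hp1 n) hτ]
    rw [hK1, hK2]
  set Ψ : ℝ → ℝ := fun τ => β * (Ici t2).indicator (fun _ => 1) τ
    - α * (Ici t1).indicator (fun _ => 1) τ + (Ico t1 t2).indicator c τ
  have hlim : ∀ τ, Filter.Tendsto (fun n => Φ n τ) Filter.atTop (nhds (Ψ τ)) := by
    intro τ
    -- As the windows shrink, the two smoothed steps become the indicators of `τ < t1` and `τ < t2`;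
    -- at each fixed `τ` this already holds for all large `n`.
    refine tendsto_const_nhds.congr' ?_
    rcases lt_or_ge τ t1 with h | h
    · filter_upwards [helim (sub_pos.2 h)] with n hn
      have a1 : H1 n τ = 1 := tailValue_unitFlow_of_le hr (hB1 n) (hB1s n) (hp1 n) (by linarith)
      have a2 : H2 n τ = 1 := tailValue_unitFlow_of_le hr (hB2 n) (hB2s n) (hp2 n) (by linarith)
      simp [Ψ, Φ, a1, a2, h, h.trans h12]
    · rcases lt_or_ge τ t2 with h' | h'
      · filter_upwards [helim (sub_pos.2 h')] with n hn
        have a1 : H1 n τ = 0 := tailValue_unitFlow_of_ge (hB1 n) (hB1s n) h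
        have a2 : H2 n τ = 1 := tailValue_unitFlow_of_le hr (hB2 n) (hB2s n) (hp2 n) (by linarith)
        simp [Ψ, Φ, a1, a2, h, h']
      · refine Filter.Eventually.of_forall fun n => ?_
        have a1 : H1 n τ = 0 := tailValue_unitFlow_of_ge (hB1 n) (hB1s n) h
        have a2 : H2 n τ = 0 := tailValue_unitFlow_of_ge (hB2 n) (hB2s n) h'
        simp [Ψ, Φ, a1, a2, h, h', not_lt.2 h']
  have hmeas : ∀ n, AEStronglyMeasurable (Φ n) G := by
    intro n
    have c1 : Measurable (H1 n) := (continuous_tailValue hr (bddMeas_unitFlow (hB1 n))).measurable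
    have c2 : Measurable (H2 n) := (continuous_tailValue hr (bddMeas_unitFlow (hB2 n))).measurable
    exact (by fun_prop : Measurable (Φ n)).aestronglyMeasurable
  have hbd : ∀ n, ∀ᵐ τ ∂G, ‖Φ n τ‖ ≤ |β| + |α| + C := by
    intro n
    refine Filter.Eventually.of_forall fun τ => ?_
    have m1 := tailValue_unitFlow_mem_Icc hr (hB1 n) (hB1s n) (hp1 n) τ
    have m2 := tailValue_unitFlow_mem_Icc hr (hB2 n) (hB2s n) (hp2 n) τ
    have k1 : |β * (1 - H2 n τ)| ≤ |β| := by
      rw [abs_mul]; exact mul_le_of_le_one_right (abs_nonneg _) (abs_le.2 ⟨by linarith [m2.2], by linarith [m2.1]⟩)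
    have k2 : |α * (1 - H1 n τ)| ≤ |α| := by
      rw [abs_mul]; exact mul_le_of_le_one_right (abs_nonneg _) (abs_le.2 ⟨by linarith [m1.2], by linarith [m1.1]⟩)
    have k3 : |c τ * (H2 n τ - H1 n τ)| ≤ C := by
      rw [abs_mul]
      exact (mul_le_of_le_one_right (abs_nonneg _) (abs_le.2 ⟨by linarith [m1.2, m2.1], by linarith [m1.1, m2.2]⟩)).trans (hcC τ)
    calc ‖Φ n τ‖ ≤ |β * (1 - H2 n τ) - α * (1 - H1 n τ)| + |c τ * (H2 n τ - H1 n τ)| := abs_add_le _ _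
      _ ≤ |β * (1 - H2 n τ)| + |α * (1 - H1 n τ)| + |c τ * (H2 n τ - H1 n τ)| := by
          gcongr; exact abs_sub _ _
      _ ≤ _ := by linarith
  have hT := tendsto_integral_of_dominated_convergence (fun _ => |β| + |α| + C) hmeas
    (integrable_const _) hbd (Filter.Eventually.of_forall hlim)
  have hle := le_of_tendsto (hT.const_mul σ) (Filter.Eventually.of_forall hstep)
  have hcI : Integrable c G := Integrable.of_bound hc.aestronglyMeasurable C (Filter.Eventually.of_forall hcC)
  have i1 : Integrable (fun τ => β * (Ici t2).indicator (fun _ => (1 : ℝ)) τ) G :=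
    ((integrable_const _).indicator measurableSet_Ici).const_mul _
  have i2 : Integrable (fun τ => α * (Ici t1).indicator (fun _ => (1 : ℝ)) τ) G :=
    ((integrable_const _).indicator measurableSet_Ici).const_mul _
  have hval : ∫ τ, Ψ τ ∂G = β * G.real (Ici t2) - α * G.real (Ici t1) + ∫ τ in Ico t1 t2, c τ ∂G := by
    have := integral_add (i1.sub i2) (hcI.indicator (measurableSet_Ico (a := t1) (b := t2)))
    simp only [Pi.sub_apply] at this
    rw [this, integral_sub i1 i2, integral_const_mul, integral_const_mul, integral_indicator measurableSet_Ico,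
      integral_indicator_const _ measurableSet_Ici, integral_indicator_const _ measurableSet_Ici]
    simp
  rwa [hval] at hle

end

/-! ### The flow decreases -/

theorem ae_notMem_of_not_leftAcc {S : Set ℝ} {a b : ℝ} (h : ∀ t ∈ Ioo a b, ¬ LeftAcc S t) :
    ∀ᵐ t, t ∈ Ioo a b → t ∉ S := by
  have h0 : volume (S ∩ Ioo a b) = 0 := by
    by_contra hne
    obtain ⟨t, ht, hL⟩ := exists_leftAcc (pos_iff_ne_zero.2 hne)
    exact h t ht hL
  filter_upwards [measure_eq_zero_iff_ae_notMem.1 h0] with t ht htab hS using ht ⟨hS, htab⟩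

theorem ae_notMem_of_not_leftAcc_Ioi {S : Set ℝ} {a : ℝ} (h : ∀ t, a < t → ¬ LeftAcc S t) :
    ∀ᵐ t, a < t → t ∉ S := by
  have : ∀ n : ℕ, ∀ᵐ t, t ∈ Ioo a (n : ℝ) → t ∉ S := fun n =>
    ae_notMem_of_not_leftAcc fun t ht => h t ht.1
  filter_upwards [ae_all_iff.2 this] with t ht hat
  obtain ⟨n, hn⟩ := exists_nat_gt t
  exact ht n ⟨hat, hn⟩

theorem exists_measure_Ico_lt (G : Measure ℝ) [IsFiniteMeasure G] {a b e : ℝ} (hab : a < b)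
    (he : 0 < e) : ∃ s ∈ Ioo a b, G.real (Ico s b) < e := by
  have hanti : Antitone fun n : ℕ => Ico (b - 1 / ((n : ℝ) + 1)) b := by
    intro m n hmn
    refine Ico_subset_Ico_left (sub_le_sub_left ?_ _)
    exact one_div_le_one_div_of_le (by positivity) (by gcongr)
  have hlim := tendsto_measure_iInter_atTop (μ := G)
    (fun n : ℕ => (measurableSet_Ico (a := b - 1 / ((n : ℝ) + 1)) (b := b)).nullMeasurableSet) hanti
    ⟨0, measure_ne_top _ _⟩
  have hempty : ⋂ n : ℕ, Ico (b - 1 / ((n : ℝ) + 1)) b = ∅ := by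
    refine eq_empty_of_forall_notMem fun u hu => ?_
    rw [mem_iInter] at hu
    obtain ⟨n, hn⟩ := exists_nat_one_div_lt (sub_pos.2 (hu 0).2)
    linarith [(hu n).1]
  rw [hempty, measure_empty] at hlim
  have h1 := hlim.eventually_lt_const (ENNReal.ofReal_pos.2 he)
  have h2 := (tendsto_one_div_add_atTop_nhds_zero_nat (𝕜 := ℝ)).eventually_lt_const (sub_pos.2 hab)
  obtain ⟨n, hn1, hn2⟩ := (h1.and h2).exists
  have : (0 : ℝ) < 1 / ((n : ℝ) + 1) := by positivity
  refine ⟨b - 1 / ((n : ℝ) + 1), ⟨by linarith, by linarith⟩, ?_⟩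
  rw [measureReal_def]
  exact (ENNReal.lt_ofReal_iff_toReal_lt (measure_ne_top _ _)).1 hn1

section
variable {r u0 : ℝ} {I0 I1 : Set ℝ} {f0 f1 : ℝ → ℝ} {G : Measure ℝ} {x : ℝ → ℝ}

theorem measureReal_Ici_eq_add (G : Measure ℝ) [IsFiniteMeasure G] {s t : ℝ} (hst : s ≤ t) :
    G.real (Ici s) = G.real (Ico s t) + G.real (Ici t) := by
  rw [← Ico_union_Ici_eq_Ici hst, measureReal_union _ measurableSet_Ici]
  rw [disjoint_left]
  intro u hu hu'
  exact absurd hu.2 (not_lt.2 hu')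

theorem IsUnboundedDistribution.real_Ici_pos (hG : IsUnboundedDistribution G) (t : ℝ) :
    0 < G.real (Ici t) := by
  have := hG.prob
  exact ENNReal.toReal_pos ((hG.tail_pos t).trans_le (measure_mono Ioi_subset_Ici_self)).ne'
    (measure_ne_top _ _)

theorem IsDomain.mem_of_pos (h : IsDomain u0 I0 f0) {u w : ℝ} (hu : 0 < u) (huw : u ≤ w)
    (hw : w ∈ I0) : u ∈ I0 := h.Ioc_subset ⟨hu, huw.trans (h.subset_Icc hw).2⟩

theorem ae_le_of_tailValue (hr : 0 < r) (hx : BddMeas x) {a b c : ℝ}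
    (h : ∀ s t, a < s → s < t → t < b →
      tailValue r x s - tailValue r x t ≤ c * (Real.exp (-r * s) - Real.exp (-r * t))) :
    ∀ᵐ t, t ∈ Ioo a b → x t ≤ c := by
  have hd := (BddMeas.const 0).sub hx
  have := ae_ge_of_tailValue hr hd (a := a) (b := b) (c := -c) fun s t h1 h2 h3 => by
    simp only [tailValue_sub hr (BddMeas.const 0) hx, tailValue_const hr]
    linarith [h s t h1 h2 h3]
  filter_upwards [this] with t ht htab
  linarith [ht htab]

/-- Since the reward decreases, the flow is at least the reward. -/
theorem IsOptimalPath.ae_promised_le (hr : 0 < r) (hx : IsOptimalPath r I0 I1 f0 f1 G x)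
    (hanti : AntitoneOn (promised r x) (Ici 0)) {t : ℝ} (ht : 0 ≤ t) :
    ∀ᵐ s, s ∈ Ioo 0 t → promised r x t ≤ x s := by
  refine ae_ge_of_tailValue hr hx.bddMeas fun s u hs hsu hut => ?_
  have h1 := hanti (show s ∈ Ici 0 from hs.le) (show u ∈ Ici 0 from (hs.trans hsu).le) hsu.le
  have h2 := hanti (show u ∈ Ici 0 from (hs.trans hsu).le) (show t ∈ Ici 0 from ht) hut.le
  have h3 : Real.exp (-r * u) ≤ Real.exp (-r * s) := Real.exp_le_exp.2 (by nlinarith)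
  rw [tailValue_eq_promised, tailValue_eq_promised]
  nlinarith [Real.exp_pos (-r * u), Real.exp_pos (-r * s)]

/-- If the reward is constant in between, the flow equals that constant. -/
theorem ae_le_of_promised_const (hr : 0 < r) (hx : BddMeas x) {a b k : ℝ}
    (h : ∀ t ∈ Ioo a b, promised r x t = k) : ∀ᵐ s, s ∈ Ioo a b → x s ≤ k := by
  refine ae_le_of_tailValue hr hx fun s u hs hsu hut => ?_
  rw [tailValue_eq_promised, tailValue_eq_promised, h s ⟨hs, hsu.trans hut⟩, h u ⟨hs.trans hsu, hut⟩]
  linarith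

/-- As both endpoints of the chord move left over time, concavity makes its slope increase. Clamping
time to `[a,b]` gives a function monotone on the whole line, hence measurable and bounded. -/
theorem secant_monotone (h1 : ConcaveOn ℝ I1 f1) {X Y : ℝ → ℝ} {a b : ℝ} (hab : a ≤ b)
    (hX : AntitoneOn X (Icc a b)) (hY : AntitoneOn Y (Icc a b)) (hXI : ∀ t ∈ Icc a b, X t ∈ I1)
    (hYI : ∀ t ∈ Icc a b, Y t ∈ I1) (hXY : ∀ t ∈ Icc a b, X t < Y t) :
    Monotone fun t => (f1 (Y (max a (min t b))) - f1 (X (max a (min t b))))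
      / (Y (max a (min t b)) - X (max a (min t b))) := by
  intro s t hst
  have hmem : ∀ t, max a (min t b) ∈ Icc a b := fun t =>
    ⟨le_max_left _ _, max_le hab (min_le_right _ _)⟩
  have hle : max a (min s b) ≤ max a (min t b) := max_le_max le_rfl (min_le_min hst le_rfl)
  exact ConcaveOn.secant_le h1 (hXI _ (hmem t)) (hYI _ (hmem s)) (hXY _ (hmem t)) (hXY _ (hmem s))
    (hX (hmem s) (hmem t) hle) (hY (hmem s) (hmem t) hle)

theorem abs_clamp_le {c : ℝ → ℝ} {a b : ℝ} (hab : a ≤ b)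
    (hc : Monotone fun t => c (max a (min t b))) (t : ℝ) :
    |c (max a (min t b))| ≤ max |c a| |c b| := by
  have e1 : c a = c (max a (min a b)) := by rw [min_eq_left hab, max_self]
  have e2 : c b = c (max a (min b b)) := by rw [min_self, max_eq_right hab]
  refine abs_le_max_abs_abs ?_ ?_
  · rw [e1]
    rcases le_total a t with h | h
    · exact hc h
    · rw [min_eq_left hab, max_self, max_eq_left ((min_le_left _ _).trans h)]
  · rw [e2]
    rcases le_total t b with h | h
    · exact hc h
    · rw [min_eq_right h, min_self]

theorem max_min_of_mem {a b t : ℝ} (h1 : a ≤ t) (h2 : t ≤ b) : max a (min t b) = t := by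
  rw [min_eq_left h2, max_eq_right h1]

/-- The flow of an optimal path is decreasing, up to null sets. -/
theorem IsOptimalPath.not_leftAcc (hr : 0 < r) (h0 : IsDomain u0 I0 f0) (h1 : IsDomain u0 I1 f1)
    (hf0 : StrictConcaveOn ℝ I0 f0) (hG : IsUnboundedDistribution G)
    (hx : IsOptimalPath r I0 I1 f0 f1 G x) (hanti : AntitoneOn (promised r x) (Ici 0))
    {v v' t1 t2 : ℝ} (hv : v < v') (ht1 : 0 < t1) (h12 : t1 < t2)
    (hL1 : LeftAcc {t | x t ≤ v} t1) : ¬ LeftAcc {t | v' ≤ x t} t2 := by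
  intro hL2
  have := hG.prob
  have hxb := hx.bddMeas
  have hx0 : ∀ t, x t ∈ Icc 0 u0 := fun t => h0.subset_Icc (hx.mem0 t)
  -- reduce to a positive level `v` and a positive reward at `t2`
  obtain ⟨v, hv0, hv, hL1⟩ : ∃ w, 0 < w ∧ w < v' ∧ LeftAcc {t | x t ≤ w} t1 := by
    obtain ⟨u, -, hu, -⟩ := hL1.exists_mem (sub_one_lt t1) (Filter.Eventually.of_forall fun _ => trivial)
    have : 0 < v' := ((hx0 u).1.trans hu).trans_lt hv
    exact ⟨max v (v' / 2), by positivity, max_lt hv (by linarith),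
      hL1.mono fun t ht => show x t ≤ _ from le_max_of_le_left ht⟩
  obtain ⟨t2, h12, hL2, hpos⟩ : ∃ t, t1 < t ∧ LeftAcc {t | v' ≤ x t} t ∧ 0 < promised r x t := by
    obtain ⟨t, ht, hL⟩ := hL2.exists_lt h12
    refine ⟨t, ht.1, hL, ?_⟩
    -- With a zero reward at `t` the flow would vanish on `(t,t2)`, whereas it is at least `v' > 0`
    -- on a non-null part. A positive reward leaves room to lower it.
    by_contra! hneg
    have h2 := ae_le_of_promised_const hr hxb (a := t) (b := t2) (k := 0) fun s hs => by
      refine le_antisymm ((hanti (show t ∈ Ici 0 from (ht1.trans ht.1).le)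
        (show s ∈ Ici 0 from ((ht1.trans ht.1).trans hs.1).le) hs.1.le).trans hneg) ?_
      exact (h1.subset_Icc (hx.mem1 s ((ht1.trans ht.1).trans hs.1).le)).1
    obtain ⟨u, hu, hu1, hu2⟩ := hL2.exists_mem ht.2 h2
    have hu1 : v' ≤ x u := hu1
    linarith [hu2 hu]
  have ht2 : 0 < t2 := ht1.trans h12
  have hX0 : ∀ t, 0 ≤ t → promised r x t ∈ Icc 0 u0 := fun t ht => h1.subset_Icc (hx.mem1 t ht)
  have hSm1 : MeasurableSet {t | x t ≤ v} := measurableSet_le hxb.1 measurable_const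
  have hSm2 : MeasurableSet {t | v' ≤ x t} := measurableSet_le measurable_const hxb.1
  obtain ⟨u, -, hu, -⟩ := hL2.exists_mem (sub_one_lt t2) (Filter.Eventually.of_forall fun _ => trivial)
  have hv'I : v' ∈ I0 := h0.mem_of_pos (hv0.trans hv) hu (hx.mem0 u)
  obtain ⟨v'', hv1, hv2⟩ := exists_between hv
  have hv''I : v'' ∈ I0 := h0.mem_of_pos (hv0.trans hv1) hv2.le hv'I
  have hvI : v ∈ I0 := h0.mem_of_pos hv0 hv.le hv'I
  set α := (f0 v'' - f0 v) / (v'' - v) with hα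
  set β := (f0 v' - f0 v'') / (v' - v'') with hβ
  -- Moving flow from `t2`, where it is high, to `t1`, where it is low, thus gains at rate `α` and
  -- loses at the smaller rate `β`.
  have hβα : β < α := StrictConcaveOn.secant_lt hf0 hvI hv'I hv1 hv2
  have hraise : ∀ t ∈ {t | x t ≤ v}, ∀ e, 0 ≤ e → e ≤ v'' - v →
      x t + e ∈ I0 ∧ f0 (x t) + α * e ≤ f0 (x t + e) := by
    intro t ht e he0 he
    have ht : x t ≤ v := ht
    constructor
    · rcases he0.eq_or_lt with rfl | he0
      · simpa using hx.mem0 t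
      · exact h0.mem_of_pos (by linarith [(hx0 t).1]) (by linarith) hv''I
    · exact ConcaveOn.raise h0.concave (hx.mem0 t) hv''I ht hv1 he0 (by linarith)
  have hlower : ∀ t ∈ {t | v' ≤ x t}, ∀ e, 0 ≤ e → e ≤ v' - v'' →
      x t - e ∈ I0 ∧ f0 (x t) - β * e ≤ f0 (x t - e) := by
    intro t ht e he0 he
    have ht : v' ≤ x t := ht
    exact ⟨h0.mem_of_pos (by linarith) (by linarith) (hx.mem0 t),
      ConcaveOn.lower h0.concave hv''I (hx.mem0 t) ht hv2 he0 (by linarith)⟩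
  set G2 := G.real (Ici t2) with hG2
  have hG2p : 0 < G2 := hG.real_Ici_pos t2
  have hanti' : ∀ {s t}, 0 ≤ s → s ≤ t → promised r x t ≤ promised r x s := fun hs hst =>
    hanti (show _ ∈ Ici 0 from hs) (show _ ∈ Ici 0 from hs.trans hst) hst
  -- the left slope of `f1` at some reward before `t2` is at least `α`
  set δ := min (min (v'' - v) (v' - v'')) (promised r x t2 / 2) with hδdef
  have hδ : 0 < δ := lt_min (lt_min (by linarith) (by linarith)) (by linarith)
  set b : ℝ → ℝ → ℝ := fun d t => (f1 (promised r x t) - f1 (promised r x t - d)) / d with hb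
  have hlowmem : ∀ d, 0 < d → d ≤ δ → ∀ t, 0 ≤ t → t ≤ t2 → promised r x t - d ∈ I1 := by
    intro d hd0 hd t ht htt
    exact h1.mem_of_pos (by linarith [hanti' ht htt, hd.trans (min_le_right _ _)]) (by linarith)
      (hx.mem1 t ht)
  have hbmono : ∀ d, 0 < d → d ≤ δ → Monotone fun t => b d (max (t1 / 2) (min t t2)) := by
    intro d hd0 hd
    have := secant_monotone h1.concave (X := fun t => promised r x t - d) (Y := promised r x)
      (a := t1 / 2) (b := t2) (by linarith)
      (fun s hs t ht hst => sub_le_sub_right (hanti' (by linarith [hs.1]) hst) d)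
      (fun s hs t ht hst => hanti' (by linarith [hs.1]) hst)
      (fun t ht => hlowmem d hd0 hd t (by linarith [ht.1]) ht.2)
      (fun t ht => hx.mem1 t (by linarith [ht.1])) (fun t _ => by linarith)
    simpa only [sub_sub_cancel] using this
  -- Since that move does not pay, the lower reward in between must be costly: the left slopes `b d`
  -- of `f1` exceed `α` on average.
  have hbint : ∀ d, 0 < d → d ≤ δ →
      α * G.real (Ici t1) - β * G2 ≤ ∫ τ in Ico t1 t2, b d (max (t1 / 2) (min τ t2)) ∂G := by
    intro d hd0 hd
    have := hx.needle hr hG (σ := -1) (s1 := t1 / 2) (t1 := t1) (t2 := t2) (α := α) (β := β) (δ := d)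
      hSm1 hSm2 (hbmono d hd0 hd).measurable (abs_clamp_le (by linarith) (hbmono d hd0 hd)) ht1.le
      (fun h => absurd h ht1.ne') (by linarith) h12 hd0 hL1 hL2
      (fun t ht _ _ _ e he0 he => by
        have := hraise t ht e he0 (he.trans (hd.trans ((min_le_left _ _).trans (min_le_left _ _))))
        simpa using this)
      (fun t ht _ _ _ e he0 he => by
        have := hlower t ht e he0 (he.trans (hd.trans ((min_le_left _ _).trans (min_le_right _ _))))
        simpa [← sub_eq_add_neg] using this)
      (fun t ht hts htt e he0 he => by
        rw [max_min_of_mem hts.le htt.le]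
        constructor
        · have : 0 < promised r x t - e := by
            linarith [hanti' ht htt.le, (he.trans hd).trans (min_le_right _ _)]
          have := h1.mem_of_pos this (by linarith) (hx.mem1 t ht)
          simpa [← sub_eq_add_neg] using this
        · have := ConcaveOn.lower h1.concave (hlowmem d hd0 hd t ht htt.le) (hx.mem1 t ht) le_rfl
            (by linarith) he0 (show promised r x t - d ≤ promised r x t - e by linarith)
          rw [sub_sub_cancel] at this
          simpa [← sub_eq_add_neg, hb] using this)
    linarith
  obtain ⟨t', ht', hslope⟩ : ∃ t' ∈ Ioo t1 t2, ∀ d, 0 < d → d ≤ δ → α ≤ b d t' := by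
    set B := b δ t2 with hB
    -- If `b d t' < α`, then `b d < α` up to `t'` by monotonicity and `b d ≤ B` afterwards, whence
    -- `(α - β) G2 ≤ (B - α) G[t',t2)`. The choice of `t'` rules this out, and it is independent of
    -- `d` because `B` is the slope of the longest chord and bounds the shorter ones at `t2`.
    obtain ⟨t', ht', hGt⟩ := exists_measure_Ico_lt G h12
      (show 0 < (α - β) * G2 / (|B - α| + 1) from by
        have := sub_pos.2 hβα
        positivity)
    rw [lt_div_iff₀ (by positivity)] at hGt
    refine ⟨t', ht', fun d hd0 hd => ?_⟩
    by_contra! hlt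
    have hm := hbmono d hd0 hd
    have hdB : b d t2 ≤ B := by
      have := ConcaveOn.secant_le h1.concave (hlowmem δ hδ le_rfl t2 ht2.le le_rfl) (hx.mem1 t2 ht2.le)
        (w := promised r x t2) (u' := promised r x t2 - d) (by linarith) (by linarith) (by linarith)
        le_rfl
      simpa only [sub_sub_cancel] using this
    have hbI : Integrable (fun τ => b d (max (t1 / 2) (min τ t2))) G :=
      Integrable.of_bound hm.measurable.aestronglyMeasurable _
        (Filter.Eventually.of_forall (abs_clamp_le (by linarith) hm))
    have hsplit : ∫ τ in Ico t1 t2, b d (max (t1 / 2) (min τ t2)) ∂G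
        ≤ α * G.real (Ico t1 t') + B * G.real (Ico t' t2) := by
      rw [← Ico_union_Ico_eq_Ico ht'.1.le ht'.2.le, setIntegral_union (Ico_disjoint_Ico_same)
        measurableSet_Ico hbI.integrableOn hbI.integrableOn]
      refine add_le_add ?_ ?_
      · rw [mul_comm, ← smul_eq_mul, ← setIntegral_const]
        refine setIntegral_mono_on hbI.integrableOn (integrable_const _).integrableOn
          measurableSet_Ico fun τ hτ => ?_
        have := hm (show τ ≤ t' from hτ.2.le)
        simp only [max_min_of_mem (show t1 / 2 ≤ t' by linarith [ht'.1]) ht'.2.le] at this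
        linarith
      · rw [mul_comm, ← smul_eq_mul, ← setIntegral_const]
        refine setIntegral_mono_on hbI.integrableOn (integrable_const _).integrableOn
          measurableSet_Ico fun τ hτ => ?_
        have := hm (show τ ≤ t2 from hτ.2.le)
        simp only [max_min_of_mem (show t1 / 2 ≤ t2 by linarith) le_rfl] at this
        linarith
    have e1 := measureReal_Ici_eq_add G ht'.1.le
    have e2 := measureReal_Ici_eq_add G ht'.2.le
    have e3 := hbint d hd0 hd
    have e4 : 0 ≤ G.real (Ico t' t2) := measureReal_nonneg
    have e5 := mul_le_mul_of_nonneg_right (le_abs_self (B - α)) e4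
    rw [← hG2] at e2
    rw [e1, e2] at e3
    nlinarith
  set k := promised r x t' with hk
  have ht'0 : 0 < t' := ht1.trans ht'.1
  -- By concavity the slope of `f1` is then at least `α` everywhere below the reward `k`.
  have hkslope : ∀ u u', u ∈ I1 → u < u' → u' ≤ k → α ≤ (f1 u' - f1 u) / (u' - u) := by
    intro u u' hu huu hu'
    have hd0 : 0 < min δ (k - u) := lt_min hδ (by linarith)
    have h2 := hslope _ hd0 (min_le_left _ _)
    have h3 := ConcaveOn.secant_le h1.concave hu (hx.mem1 t' ht'0.le) huu
      (show k - min δ (k - u) < k by linarith) (by linarith [min_le_right δ (k - u)]) hu'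
    rw [sub_sub_cancel] at h3
    exact h2.trans h3
  have hle_v : promised r x t2 ≤ v := by
    obtain ⟨u, hu, hu1, hu2⟩ := hL1.exists_mem ht1 (hx.ae_promised_le hr hanti ht2.le)
    exact (hu2 ⟨hu.1, hu.2.trans h12⟩).trans hu1
  -- If the reward is constant on `[t',t2]`, the flow there is at most that constant, hence at most
  -- `v`, against its being at least `v'` near `t2`.
  rcases (hanti' ht'0.le ht'.2.le).eq_or_lt with heq | hlt
  · have h2 := ae_le_of_promised_const hr hxb (a := t') (b := t2) (k := k) fun s hs =>
      le_antisymm (hanti' ht'0.le hs.1.le) (heq.ge.trans (hanti' (ht'0.trans hs.1).le hs.2.le))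
    obtain ⟨u, hu, hu1, hu2⟩ := hL2.exists_mem ht'.2 h2
    have hu1 : v' ≤ x u := hu1
    linarith [hu2 hu]
  -- Otherwise moving flow from `t2` to a later low time `t3` raises rewards that lie below `k`, for
  -- a net gain of at least `(α - β) G2 > 0`. So the flow exceeds `v` after `t2` and hence so does
  -- the reward at `t2`, although that reward is at most the flow near `t1`.
  · have hno : ∀ t3, t2 < t3 → ¬ LeftAcc {t | x t ≤ v} t3 := by
      intro t3 h23 hL3
      obtain ⟨s1, hs1, hs1k⟩ : ∃ s1 ∈ Ioo t' t2, promised r x s1 < (k + promised r x t2) / 2 := by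
        have hev := Filter.Tendsto.eventually_lt_const
          (show promised r x t2 < (k + promised r x t2) / 2 by linarith)
          ((continuous_promised hr hxb).continuousWithinAt (s := Iio t2))
        obtain ⟨s, hs, hs'⟩ := (hev.and (Ioo_mem_nhdsLT ht'.2)).exists
        exact ⟨s, hs', hs⟩
      have hmin : 0 < min (min (v'' - v) (v' - v'')) ((k - promised r x t2) / 2) :=
        lt_min (lt_min (by linarith) (by linarith)) (by linarith)
      have := hx.needle hr hG (σ := 1) (s1 := s1) (t1 := t2) (t2 := t3) (α := β) (β := α) (c := fun _ => α)
        hSm2 hSm1 measurable_const (fun _ => le_rfl) ht2.le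
        (fun h => absurd h ht2.ne') hs1.2 h23 hmin hL2 hL3
        (fun t ht _ _ _ e he0 he => by
          simpa using hlower t ht e he0 (he.trans ((min_le_left _ _).trans (min_le_right _ _))))
        (fun t ht _ _ _ e he0 he => by
          simpa using hraise t ht e he0 (he.trans ((min_le_left _ _).trans (min_le_left _ _))))
        (fun t ht hts _ e he0 he => by
          rcases he0.eq_or_lt with rfl | he0
          · simpa using hx.mem1 t ht
          · have hle : promised r x t + e ≤ k := by
              linarith [hanti' (ht'0.trans hs1.1).le hts.le, he.trans (min_le_right _ _)]
            have := hkslope _ _ (hx.mem1 t ht) (lt_add_of_pos_right _ he0) hle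
            rw [add_sub_cancel_left, le_div_iff₀ he0] at this
            rw [one_mul, one_mul]
            exact ⟨h1.mem_of_pos (by linarith [(hX0 t ht).1]) hle (hx.mem1 t' ht'0.le), by linarith⟩)
      rw [setIntegral_const, smul_eq_mul] at this
      have e1 := measureReal_Ici_eq_add G h23.le
      rw [← hG2] at this e1
      have e2 : α * G2 = α * G.real (Ico t2 t3) + α * G.real (Ici t3) := by rw [e1]; ring
      have e3 := mul_pos (sub_pos.2 hβα) hG2p
      linarith
    have hae := ae_notMem_of_not_leftAcc_Ioi hno
    have := tailValue_lt hr hxb (t := t2) (c := v) (by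
      filter_upwards [hae] with t ht htt
      exact not_le.1 (ht htt))
    rw [tailValue_eq_promised, mul_comm] at this
    exact absurd (lt_of_mul_lt_mul_left this (Real.exp_pos _).le) (not_lt.2 hle_v)

end

/-! ### Comparison of optimal paths under MLR dominance -/

theorem ennreal_rearrange {a b k l : ℝ≥0∞} (hab : a ≤ b) (hkl : l ≤ k) :
    k * a + l * b ≤ k * b + l * a := by
  obtain ⟨d, rfl⟩ := exists_add_of_le hab
  calc k * a + l * (a + d) = k * a + l * a + l * d := by ring
    _ ≤ k * a + l * a + k * d := by gcongr
    _ = k * (a + d) + l * a := by ring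

/-- Tails of an MLR-dominating distribution dominate in the first-order sense. -/
theorem MLRDominates.lintegral_le {G G' : Measure ℝ} (h : MLRDominates G G') {k : ℝ → ℝ≥0∞} {t : ℝ}
    (hk : Measurable k) (hanti : AntitoneOn k (Ici t)) :
    (∫⁻ s in Ici t, k s ∂G) * G' (Ici t) ≤ (∫⁻ s in Ici t, k s ∂G') * G (Ici t) := by
  obtain ⟨g, g', hg, hg', hGg, hGg', hmon⟩ := h
  set T := G.support ∪ G'.support with hT
  have hTm : MeasurableSet T :=
    (Measure.isClosed_support.union Measure.isClosed_support).measurableSet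
  have hA : MeasurableSet (Ici t ∩ T) := measurableSet_Ici.inter hTm
  -- The ratio of densities is monotone only on `T`, which carries both measures.
  have hae : ∀ H : Measure ℝ, H.support ⊆ T → (Ici t : Set ℝ) =ᵐ[H] (Ici t ∩ T : Set ℝ) := by
    intro H hH
    filter_upwards [Measure.support_mem_ae (μ := H)] with s hs
    have : s ∈ T := hH hs
    exact propext ⟨fun h => ⟨h, this⟩, fun h => h.1⟩
  have hGe := hae G subset_union_left
  have hGe' := hae G' subset_union_right
  set μ := volume.restrict (Ici t ∩ T)
  have hgE : Measurable fun s => (g s : ℝ≥0∞) := hg.coe_nnreal_ennreal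
  have hgE' : Measurable fun s => (g' s : ℝ≥0∞) := hg'.coe_nnreal_ennreal
  have e1 : ∫⁻ s in Ici t, k s ∂G = ∫⁻ s, k s * g s ∂μ := by
    rw [Measure.restrict_congr_set hGe, hGg, setLIntegral_withDensity_eq_setLIntegral_mul _ hgE hk hA]
    simp [μ, mul_comm]
  have e1' : ∫⁻ s in Ici t, k s ∂G' = ∫⁻ s, k s * g' s ∂μ := by
    rw [Measure.restrict_congr_set hGe', hGg',
      setLIntegral_withDensity_eq_setLIntegral_mul _ hgE' hk hA]
    simp [μ, mul_comm]
  have e2 : G (Ici t) = ∫⁻ s, g s ∂μ := by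
    rw [measure_congr hGe, hGg, withDensity_apply _ hA]
  have e2' : G' (Ici t) = ∫⁻ s, g' s ∂μ := by
    rw [measure_congr hGe', hGg', withDensity_apply _ hA]
  rw [e1, e1', e2, e2']
  have p1 := lintegral_prod_mul (μ := μ) (ν := μ) (hk.mul hgE).aemeasurable hgE'.aemeasurable
  have p2 := lintegral_prod_mul (μ := μ) (ν := μ) hgE'.aemeasurable (hk.mul hgE).aemeasurable
  have p3 := lintegral_prod_mul (μ := μ) (ν := μ) (hk.mul hgE').aemeasurable hgE.aemeasurable
  have p4 := lintegral_prod_mul (μ := μ) (ν := μ) hgE.aemeasurable (hk.mul hgE').aemeasurable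
  rw [mul_comm (∫⁻ s, (g' s : ℝ≥0∞) ∂μ)] at p2
  rw [mul_comm (∫⁻ s, (g s : ℝ≥0∞) ∂μ)] at p4
  simp only [Pi.mul_apply] at p1 p2 p3 p4
  -- Twice the inequality, symmetrised over pairs `(s,u)`. After adding the swapped pair the
  -- integrands compare pointwise, by rearrangement of the decreasing `k` against the increasing
  -- ratio.
  have key : (∫⁻ s, k s * g s ∂μ) * (∫⁻ s, g' s ∂μ) + (∫⁻ s, k s * g s ∂μ) * (∫⁻ s, g' s ∂μ)
      ≤ (∫⁻ s, k s * g' s ∂μ) * (∫⁻ s, g s ∂μ) + (∫⁻ s, k s * g' s ∂μ) * (∫⁻ s, g s ∂μ) := by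
    nth_rewrite 1 [← p1]
    rw [← p2]
    nth_rewrite 1 [← p3]
    rw [← p4]
    rw [← lintegral_add_left (by fun_prop), ← lintegral_add_left (by fun_prop),
      Measure.prod_restrict]
    refine setLIntegral_mono (by fun_prop) ?_
    have hpt : ∀ s ∈ Ici t ∩ T, ∀ u ∈ Ici t ∩ T, s ≤ u →
        k s * g s * g' u + g' s * (k u * g u) ≤ k s * g' s * g u + g s * (k u * g' u) := by
      intro s hs u hu hsu
      have h1 : (g s : ℝ≥0∞) * g' u ≤ g u * g' s := by exact_mod_cast hmon s hs.2 u hu.2 hsu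
      have h2 := ennreal_rearrange h1 (hanti hs.1 hu.1 hsu)
      calc _ = k s * (g s * g' u) + k u * (g u * g' s) := by ring
        _ ≤ _ := h2
        _ = _ := by ring
    rintro ⟨s, u⟩ ⟨hs, hu⟩
    rcases le_total s u with hsu | hsu
    · exact hpt s hs u hu hsu
    · have := hpt u hu s hs hsu
      calc _ = k u * g u * g' s + g' u * (k s * g s) := by ring
        _ ≤ _ := this
        _ = _ := by ring
  rw [← two_mul, ← two_mul] at key
  exact (ENNReal.mul_le_mul_iff_right (by norm_num) (by norm_num)).1 key

theorem MLRDominates.integral_le {G G' : Measure ℝ} [IsProbabilityMeasure G]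
    [IsProbabilityMeasure G'] (h : MLRDominates G G') {k : ℝ → ℝ} {t C : ℝ} (hk : Measurable k)
    (hanti : AntitoneOn k (Ici t)) (h0 : ∀ s, 0 ≤ k s) (hC : ∀ s, k s ≤ C) :
    (∫ s in Ici t, k s ∂G) * G'.real (Ici t) ≤ (∫ s in Ici t, k s ∂G') * G.real (Ici t) := by
  have h1 := h.lintegral_le (k := fun s => ENNReal.ofReal (k s)) (t := t) hk.ennreal_ofReal
    (fun a ha b hb hab => ENNReal.ofReal_le_ofReal (hanti ha hb hab))
  have hfin : ∀ H : Measure ℝ, IsProbabilityMeasure H →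
      ∫⁻ s in Ici t, ENNReal.ofReal (k s) ∂H ≠ ⊤ := by
    intro H _
    refine ne_top_of_le_ne_top (ENNReal.ofReal_ne_top (r := C)) ?_
    calc ∫⁻ s in Ici t, ENNReal.ofReal (k s) ∂H ≤ ∫⁻ s, ENNReal.ofReal C ∂H :=
          (setLIntegral_le_lintegral _ _).trans
            (lintegral_mono fun s => ENNReal.ofReal_le_ofReal (hC s))
      _ = ENNReal.ofReal C := by simp
  rw [integral_eq_lintegral_of_nonneg_ae (Filter.Eventually.of_forall h0) hk.aestronglyMeasurable,
    integral_eq_lintegral_of_nonneg_ae (Filter.Eventually.of_forall h0) hk.aestronglyMeasurable,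
    measureReal_def, measureReal_def, ← ENNReal.toReal_mul, ← ENNReal.toReal_mul]
  exact ENNReal.toReal_mono (ENNReal.mul_ne_top (hfin G' inferInstance) (measure_ne_top _ _)) h1

/-- If `y > x` on a non-null set, the two are separated by constants near some time. -/
theorem exists_crossing {x y : ℝ → ℝ} {a b : ℝ}
    (h : ¬ ∀ᵐ t, t ∈ Ioo a b → y t ≤ x t) :
    ∃ v v' t, v < v' ∧ t ∈ Ioo a b ∧ LeftAcc {t | x t ≤ v ∧ v' ≤ y t} t := by
  by_contra! hcon
  refine h ?_
  have : ∀ p : ℚ × ℚ, ∀ᵐ t, t ∈ Ioo a b → p.1 < p.2 → ¬ (x t ≤ p.1 ∧ ((p.2 : ℚ) : ℝ) ≤ y t) := by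
    intro p
    by_cases hp : p.1 < p.2
    · filter_upwards [ae_notMem_of_not_leftAcc (S := {t | x t ≤ p.1 ∧ ((p.2 : ℚ) : ℝ) ≤ y t})
        fun t ht => hcon p.1 p.2 t (by exact_mod_cast hp) ht] with t ht hab _ using ht hab
    · exact Filter.Eventually.of_forall fun t _ hp' => absurd hp' hp
  filter_upwards [ae_all_iff.2 this] with t ht hab
  by_contra! hlt
  obtain ⟨v, hv1, hv2⟩ := exists_rat_btwn hlt
  obtain ⟨v', hv1', hv2'⟩ := exists_rat_btwn hv2
  exact ht (v, v') hab (by exact_mod_cast hv1') ⟨hv1.le, hv2'.le⟩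

theorem not_ae_le_of_tailValue {r : ℝ} (hr : 0 < r) {x y : ℝ → ℝ} (hx : BddMeas x) (hy : BddMeas y)
    {a b : ℝ} (hab : a ≤ b)
    (h : tailValue r x a - tailValue r x b < tailValue r y a - tailValue r y b) :
    ¬ ∀ᵐ t, t ∈ Ioo a b → y t ≤ x t := by
  intro hle
  rw [← setIntegral_Ioo_eq hr hx hab, ← setIntegral_Ioo_eq hr hy hab] at h
  refine absurd h (not_lt.2 ?_)
  refine setIntegral_mono_on_ae ((hy.integrableOn_Ioi hr a).mono_set Ioo_subset_Ioi_self)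
    ((hx.integrableOn_Ioi hr a).mono_set Ioo_subset_Ioi_self) measurableSet_Ioo ?_
  filter_upwards [hle] with t ht htab
  exact mul_le_mul_of_nonneg_left (ht htab) (weight_pos hr t).le

section
variable {r u0 : ℝ} {I0 I1 : Set ℝ} {f0 f1 : ℝ → ℝ} {G G' : Measure ℝ} {x x' : ℝ → ℝ}

/-- Since the flow decreases, a level reached near `t2` is met almost everywhere before `t2`. Flow
can therefore be taken away at any earlier time `s` at the same slope. -/
theorem IsOptimalPath.leftAcc_of_lt (hr : 0 < r) (h0 : IsDomain u0 I0 f0) (h1 : IsDomain u0 I1 f1)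
    (hf0 : StrictConcaveOn ℝ I0 f0) (hG : IsUnboundedDistribution G)
    (hx : IsOptimalPath r I0 I1 f0 f1 G x) (hanti : AntitoneOn (promised r x) (Ici 0)) {v t2 s : ℝ}
    (hL : LeftAcc {t | v ≤ x t} t2) (hs0 : 0 < s) (hs : s ≤ t2) : LeftAcc {t | v ≤ x t} s := by
  have hae : ∀ n : ℕ, ∀ᵐ t, t ∈ Ioo 0 t2 → t ∉ {t | x t ≤ v - 1 / ((n : ℝ) + 1)} := fun n =>
    ae_notMem_of_not_leftAcc fun t ht hL' =>
      hx.not_leftAcc hr h0 h1 hf0 hG hanti (sub_lt_self v (by positivity)) ht.1 ht.2 hL' hL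
  have hae' : ∀ᵐ t, t ∈ Ioo 0 t2 → v ≤ x t := by
    filter_upwards [ae_all_iff.2 hae] with t ht htt
    by_contra! hlt
    obtain ⟨n, hn⟩ := exists_nat_one_div_lt (sub_pos.2 hlt)
    exact ht n htt (show x t ≤ _ by linarith)
  intro s' hs'
  have : (Ioo (max s' 0) s : Set ℝ) ≤ᵐ[volume] ({t | v ≤ x t} ∩ Ioo s' s : Set ℝ) := by
    filter_upwards [hae'] with t ht htt
    exact ⟨ht ⟨(le_max_right _ _).trans_lt htt.1, htt.2.trans_le hs⟩,
      (le_max_left _ _).trans_lt htt.1, htt.2⟩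
  refine lt_of_lt_of_le ?_ (measure_mono_ae this)
  rw [Real.volume_Ioo]
  simpa using ⟨hs', hs0⟩

/-- The core of the comparison: a time `t2` at which `x < x'` cannot follow a time `t1` at which
`x' < x` while `X < X'` in between. For `t1 = 0`, the earlier time is not needed. -/
theorem IsOptimalPath.comparison_core (hr : 0 < r) (h0 : IsDomain u0 I0 f0) (h1 : IsDomain u0 I1 f1)
    (hf0 : StrictConcaveOn ℝ I0 f0) (hG : IsUnboundedDistribution G)
    (hG' : IsUnboundedDistribution G') (hMLR : MLRDominates G G')
    (hx : IsOptimalPath r I0 I1 f0 f1 G x) (hx' : IsOptimalPath r I0 I1 f0 f1 G' x')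
    (hanti : AntitoneOn (promised r x) (Ici 0)) (hanti' : AntitoneOn (promised r x') (Ici 0))
    {s1 t1 t2 α β φ δ : ℝ} {S1 S2 : Set ℝ} {v' : ℝ}
    (hS1 : MeasurableSet S1) (hS2 : MeasurableSet S2) (ht1 : 0 ≤ t1) (hα : t1 = 0 → α = 0)
    (hs1 : s1 < t1) (h12 : t1 < t2) (hδ : 0 < δ) (hL1 : LeftAcc S1 t1) (hL2 : LeftAcc S2 t2)
    (hL2' : LeftAcc {t | v' ≤ x' t} t2)
    (hD : ∀ t, 0 ≤ t → s1 ≤ t → t ≤ t2 → promised r x t < promised r x' t)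
    (hI1 : ∀ t ∈ S1, 0 < t → s1 < t → t < t1 → ∀ e, 0 ≤ e → e ≤ δ →
      (x t - e ∈ I0 ∧ f0 (x t) - α * e ≤ f0 (x t - e)) ∧
      (x' t + e ∈ I0 ∧ f0 (x' t) + α * e ≤ f0 (x' t + e)))
    (hI2 : ∀ t ∈ S2, ∀ e, 0 ≤ e → e ≤ δ → x t + e ∈ I0 ∧ f0 (x t) + φ * e ≤ f0 (x t + e))
    (hI2' : ∀ t, v' ≤ x' t → ∀ e, 0 ≤ e → e ≤ δ →
      x' t - e ∈ I0 ∧ f0 (x' t) - β * e ≤ f0 (x' t - e))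
    (hαβ : α ≤ β) (hβφ : β < φ) : False := by
  have := hG.prob
  have := hG'.prob
  have := hG.noAtoms
  set a := max s1 0 with ha
  have hat1 : a ≤ t1 := max_le hs1.le ht1
  have hat2 : a ≤ t2 := hat1.trans h12.le
  have ha0 : 0 ≤ a := le_max_right _ _
  have hX := continuous_promised hr hx.bddMeas
  have hX' := continuous_promised hr hx'.bddMeas
  have hDa : ∀ t ∈ Icc a t2, promised r x t < promised r x' t := fun t ht =>
    hD t (ha0.trans ht.1) ((le_max_left _ _).trans ht.1) ht.2
  -- Shifts that change rewards by at most `ε` keep them between `X` and `X'`, where the secant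
  -- slope bounds the effect on `f1`.
  obtain ⟨ε, hε, hDε⟩ : ∃ ε > 0, ∀ t ∈ Icc a t2, ε ≤ promised r x' t - promised r x t := by
    obtain ⟨t, ht, hmin⟩ := isCompact_Icc.exists_isMinOn (nonempty_Icc.2 hat2)
      (hX'.sub hX).continuousOn
    exact ⟨_, sub_pos.2 (hDa t ht), fun s hs => hmin hs⟩
  set c : ℝ → ℝ := fun t => (f1 (promised r x' t) - f1 (promised r x t)) /
    (promised r x' t - promised r x t) with hc
  have hcm : Monotone fun t => c (max a (min t t2)) :=
    secant_monotone h1.concave hat2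
      (fun s hs t ht hst => hanti (show s ∈ Ici 0 from ha0.trans hs.1) (show t ∈ Ici 0 from ha0.trans ht.1) hst)
      (fun s hs t ht hst => hanti' (show s ∈ Ici 0 from ha0.trans hs.1) (show t ∈ Ici 0 from ha0.trans ht.1) hst)
      (fun t ht => hx.mem1 t (ha0.trans ht.1)) (fun t ht => hx'.mem1 t (ha0.trans ht.1)) hDa
  set C := max |c a| |c t2| with hC
  set cc : ℝ → ℝ := fun t => c (max a (min t t2)) with hcc
  have hcb : ∀ t, |cc t| ≤ C := abs_clamp_le hat2 hcm
  -- For `x` under `G`: flow moves from `t1` to `t2`, raising the reward towards `X'`.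
  have hmin : 0 < min δ ε := lt_min hδ hε
  have hR := hx.needle hr hG (σ := 1) (δ := min δ ε) (α := α) (β := φ) hS1 hS2 hcm.measurable hcb ht1 hα hs1 h12 hmin hL1 hL2
    (fun t ht h0 h1 h2 e he0 he => by
      simpa using (hI1 t ht h0 h1 h2 e he0 (he.trans (min_le_left _ _))).1)
    (fun t ht _ _ _ e he0 he => by simpa using hI2 t ht e he0 (he.trans (min_le_left _ _)))
    (fun t ht hst htt e he0 he => by
      have hta : a ≤ t := max_le hst.le ht
      have hle : promised r x t + e ≤ promised r x' t := by
        linarith [hDε t ⟨hta, htt.le⟩, he.trans (min_le_right _ _)]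
      have hct : cc t = c t := by simp only [hcc, max_min_of_mem hta htt.le]
      rw [one_mul, one_mul, hct]
      exact ⟨h1.concave.1.ordConnected.out (hx.mem1 t ht) (hx'.mem1 t ht) ⟨by linarith, hle⟩,
        ConcaveOn.raise h1.concave (hx.mem1 t ht) (hx'.mem1 t ht) le_rfl (hDa t ⟨hta, htt.le⟩) he0 hle⟩)
  -- For `x'` under `G'`: flow moves from `s` to `t1`, lowering the reward towards `X`. The end time
  -- `s` is left free so as to be matched to the crossing of `β`; at `s = t1` the bound is just `α ≤
  -- β`.
  have hLs : ∀ s, t1 ≤ s → s ≤ t2 →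
      α * G'.real (Ici t1) - β * G'.real (Ici s) - ∫ τ in Ico t1 s, cc τ ∂G' ≤ 0 := by
    intro s hs1s hst
    rcases hs1s.eq_or_lt with rfl | hs1s
    · simp only [lt_self_iff_false, not_false_eq_true, Ico_eq_empty, Measure.restrict_empty,
        integral_zero_measure, sub_zero]
      nlinarith [measureReal_nonneg (μ := G') (s := Ici t1)]
    have hLs := hx'.leftAcc_of_lt hr h0 h1 hf0 hG' hanti' hL2' (ht1.trans_lt hs1s) hst
    have := hx'.needle hr hG' (σ := -1) (δ := min δ ε) (α := α) (β := β) hS1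
      (measurableSet_le measurable_const hx'.bddMeas.1) hcm.measurable hcb ht1 hα hs1 hs1s hmin hL1 hLs
      (fun t ht h0 h1 h2 e he0 he => by
        simpa using (hI1 t ht h0 h1 h2 e he0 (he.trans (min_le_left _ _))).2)
      (fun t ht _ _ _ e he0 he => by
        simpa [← sub_eq_add_neg] using hI2' t ht e he0 (he.trans (min_le_left _ _)))
      (fun t ht hst' htt e he0 he => by
        have hta : a ≤ t := max_le hst'.le ht
        have htt2 : t ≤ t2 := htt.le.trans hst
        have hle : promised r x t ≤ promised r x' t - e := by
          linarith [hDε t ⟨hta, htt2⟩, he.trans (min_le_right _ _)]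
        have hct : cc t = c t := by simp only [hcc, max_min_of_mem hta htt2]
        rw [hct]
        have i1 : promised r x' t - e ∈ I1 :=
          h1.concave.1.ordConnected.out (hx.mem1 t ht) (hx'.mem1 t ht) ⟨hle, by linarith⟩
        have i2 := ConcaveOn.lower h1.concave (hx.mem1 t ht) (hx'.mem1 t ht) le_rfl
          (hDa t ⟨hta, htt2⟩) he0 hle
        exact ⟨by simpa [← sub_eq_add_neg] using i1, by simpa [← sub_eq_add_neg] using i2⟩)
    linarith
  -- the time `s0` at which `c` crosses `β`
  set T := insert t1 {τ | τ ∈ Icc t1 t2 ∧ cc τ < β} with hT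
  have hTb : ∀ τ ∈ T, τ ∈ Icc t1 t2 := by
    rintro τ (rfl | h)
    · exact ⟨le_rfl, h12.le⟩
    · exact h.1
  have hbdd : BddAbove T := ⟨t2, fun τ hτ => (hTb τ hτ).2⟩
  have ht1T : t1 ∈ T := mem_insert _ _
  set s0 := sSup T with hs0
  have hs01 : t1 ≤ s0 := le_csSup hbdd ht1T
  have hs02 : s0 ≤ t2 := csSup_le ⟨t1, ht1T⟩ fun τ hτ => (hTb τ hτ).2
  have hlow : ∀ τ ∈ Ico t1 s0, cc τ < β := by
    intro τ hτ
    obtain ⟨τ', hτ', hlt⟩ := exists_lt_of_lt_csSup ⟨t1, ht1T⟩ hτ.2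
    rcases hτ' with rfl | h
    · exact absurd hτ.1 (not_le.2 hlt)
    · exact (hcm hlt.le).trans_lt h.2
  have hhigh : ∀ τ ∈ Ioo s0 t2, β ≤ cc τ := by
    intro τ hτ
    by_contra! hlt
    exact absurd (le_csSup hbdd (Or.inr ⟨⟨hs01.trans hτ.1.le, hτ.2.le⟩, hlt⟩)) (not_le.2 hτ.1)
  have hcI : ∀ H : Measure ℝ, IsProbabilityMeasure H → Integrable cc H := fun H _ =>
    Integrable.of_bound hcm.measurable.aestronglyMeasurable C (Filter.Eventually.of_forall hcb)
  -- On `[t1,s0)` the function `β - c` is positive and decreasing, so it stays decreasing when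
  -- extended by zero.
  have hk := hMLR.integral_le (k := (Ico t1 s0).indicator fun τ => β - cc τ) (t := t1) (C := |β| + C)
    ((measurable_const.sub hcm.measurable).indicator measurableSet_Ico)
    (fun s hs t ht hst => by
      have hs : t1 ≤ s := hs
      by_cases h : t < s0
      · rw [indicator_of_mem (show t ∈ Ico t1 s0 from ⟨hs.trans hst, h⟩),
          indicator_of_mem (show s ∈ Ico t1 s0 from ⟨hs, hst.trans_lt h⟩)]
        exact sub_le_sub_left (hcm hst) _
      · rw [indicator_of_notMem (show t ∉ Ico t1 s0 from fun h' => h h'.2)]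
        exact indicator_nonneg (fun τ hτ => (sub_pos.2 (hlow τ hτ)).le) s)
    (fun s => indicator_nonneg (fun τ hτ => (sub_pos.2 (hlow τ hτ)).le) s)
    (fun s => by
      have hC0 : 0 ≤ C := (abs_nonneg _).trans (hcb 0)
      by_cases h : s ∈ Ico t1 s0
      · rw [indicator_of_mem h]
        linarith [le_abs_self β, (abs_le.1 (hcb s)).1]
      · rw [indicator_of_notMem h]
        positivity)
  have hKval : ∀ H : Measure ℝ, IsProbabilityMeasure H →
      ∫ s in Ici t1, (Ico t1 s0).indicator (fun τ => β - cc τ) s ∂H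
        = β * H.real (Ico t1 s0) - ∫ τ in Ico t1 s0, cc τ ∂H := by
    intro H hH
    rw [setIntegral_indicator measurableSet_Ico, inter_eq_right.2 (Ico_subset_Ici_self),
      integral_sub (integrable_const _) (hcI H hH).integrableOn, setIntegral_const, smul_eq_mul, mul_comm]
  rw [hKval G inferInstance, hKval G' inferInstance] at hk
  have hsplit : ∫ τ in Ico t1 s0, cc τ ∂G + β * G.real (Ico s0 t2) ≤ ∫ τ in Ico t1 t2, cc τ ∂G := by
    rw [← Ico_union_Ico_eq_Ico hs01 hs02, setIntegral_union (Ico_disjoint_Ico_same)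
      measurableSet_Ico (hcI G inferInstance).integrableOn (hcI G inferInstance).integrableOn]
    gcongr
    rw [mul_comm, ← smul_eq_mul, ← setIntegral_const]
    refine setIntegral_mono_on_ae (integrable_const _).integrableOn (hcI G inferInstance).integrableOn
      measurableSet_Ico ?_
    -- At `s0` itself `c` may still be below `β`; the point is negligible as `G` has no atoms.
    have : ∀ᵐ τ ∂G, τ ≠ s0 := by simp [ae_iff, measure_singleton]
    filter_upwards [this] with τ hτ hτ'
    exact hhigh τ ⟨lt_of_le_of_ne hτ'.1 (Ne.symm hτ), hτ'.2⟩
  have g1 := measureReal_Ici_eq_add G hs01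
  have g2 := measureReal_Ici_eq_add G hs02
  have g1' := measureReal_Ici_eq_add G' hs01
  have hL0 := hLs s0 hs01 hs02
  have p1 := hG.real_Ici_pos t1
  have p2 := hG.real_Ici_pos t2
  have p1' := hG'.real_Ici_pos t1
  set K := β * G.real (Ico t1 s0) - ∫ τ in Ico t1 s0, cc τ ∂G with hK
  set K' := β * G'.real (Ico t1 s0) - ∫ τ in Ico t1 s0, cc τ ∂G' with hK'
  have hp := mul_pos (sub_pos.2 hβφ) p2
  have k1 : (β - α) * G.real (Ici t1) < K := by
    have e : β * G.real (Ici t1) = β * G.real (Ico t1 s0) + β * G.real (Ico s0 t2)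
        + β * G.real (Ici t2) := by rw [g1, g2]; ring
    linarith
  have k2 : K' ≤ (β - α) * G'.real (Ici t1) := by
    have e : β * G'.real (Ici t1) = β * G'.real (Ico t1 s0) + β * G'.real (Ici s0) := by
      rw [g1']; ring
    linarith
  have k3 := mul_lt_mul_of_pos_right k1 p1'
  have k4 := mul_le_mul_of_nonneg_right k2 p1.le
  linarith

/-- The comparison of optimal rewards. -/
theorem IsOptimalPath.promised_le (hr : 0 < r) (h0 : IsDomain u0 I0 f0) (h1 : IsDomain u0 I1 f1)
    (hf0 : StrictConcaveOn ℝ I0 f0) (hmono : MonotoneOn f0 I0) (hG : IsUnboundedDistribution G)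
    (hG' : IsUnboundedDistribution G') (hMLR : MLRDominates G G')
    (hx : IsOptimalPath r I0 I1 f0 f1 G x) (hx' : IsOptimalPath r I0 I1 f0 f1 G' x')
    {t0 : ℝ} (ht0 : 0 ≤ t0) : promised r x' t0 ≤ promised r x t0 := by
  by_contra! hlt
  have hanti := hx.antitoneOn hr h0 h1 hf0 hmono hG
  have hanti' := hx'.antitoneOn hr h0 h1 hf0 hmono hG'
  have hxb := hx.bddMeas
  have hxb' := hx'.bddMeas
  have hDc : Continuous fun t => promised r x' t - promised r x t :=
    (continuous_promised hr hxb').sub (continuous_promised hr hxb)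
  have htail : ∀ t, tailValue r (fun s => x' s - x s) t
      = Real.exp (-r * t) * (promised r x' t - promised r x t) := by
    intro t
    rw [tailValue_sub hr hxb' hxb, tailValue_eq_promised, tailValue_eq_promised]; ring
  have htail0 : 0 < tailValue r (fun s => x' s - x s) t0 := by
    rw [htail]; exact mul_pos (Real.exp_pos _) (sub_pos.2 hlt)
  -- a later time at which `x < x'`
  obtain ⟨b, hb, hDb, htb⟩ : ∃ b, t0 < b ∧ (∀ t ∈ Ico t0 b, promised r x t < promised r x' t) ∧
      tailValue r (fun s => x' s - x s) b < tailValue r (fun s => x' s - x s) t0 := by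
    by_cases h : ∃ τ, t0 ≤ τ ∧ promised r x' τ - promised r x τ ≤ 0
    · obtain ⟨τ, hτ, hτ0⟩ := h
      obtain ⟨b, hb, hb0, hDb⟩ := exists_first_le hDc hτ (sub_pos.2 hlt) hτ0
      exact ⟨b, hb.1, fun t ht => sub_pos.1 (hDb t ht), by rw [htail b, hb0, mul_zero]; exact htail0⟩
    · push Not at h
      obtain ⟨b, hb1, hb2⟩ := (((tendsto_tailValue hr (hxb'.sub hxb)).eventually_lt_const htail0).and
        (Filter.eventually_gt_atTop t0)).exists
      exact ⟨b, hb2, fun t ht => sub_pos.1 (h t ht.1), hb1⟩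
  rw [tailValue_sub hr hxb' hxb, tailValue_sub hr hxb' hxb] at htb
  -- The discounted reward difference falls between `t0` and `b`, so `x'` exceeds `x` on a non-null
  -- set there.
  obtain ⟨v, v', t2, hvv, ht2, hL2⟩ := exists_crossing
    (not_ae_le_of_tailValue hr hxb hxb' hb.le (by linarith))
  have ht02 : 0 < t2 := ht0.trans_lt ht2.1
  have hL2' : LeftAcc {t | v' ≤ x' t} t2 := hL2.mono fun t ht => ht.2
  obtain ⟨u, -, ⟨hu1, hu2⟩, -⟩ := hL2.exists_mem (sub_one_lt t2)
    (Filter.Eventually.of_forall fun _ => trivial)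
  have hv0 : 0 ≤ v := (h0.subset_Icc (hx.mem0 u)).1.trans hu1
  obtain ⟨v'', hv1, hv2⟩ := exists_between hvv
  have hv'I : v' ∈ I0 := h0.mem_of_pos (hv0.trans_lt hvv) hu2 (hx'.mem0 u)
  have hv''I : v'' ∈ I0 := h0.mem_of_pos (hv0.trans_lt hv1) hv2.le hv'I
  -- a strict version of the slopes
  obtain ⟨w, hw1, hw2⟩ := exists_between hv1
  have hwI : w ∈ I0 := h0.mem_of_pos (hv0.trans_lt hw1) hw2.le hv''I
  have hφβ := StrictConcaveOn.secant_lt hf0 hwI hv'I hw2 hv2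
  set β := (f0 v' - f0 v'') / (v' - v'') with hβ
  set φ := (f0 v'' - f0 w) / (v'' - w) with hφ
  have hI2 : ∀ t ∈ {t | x t ≤ v ∧ v' ≤ x' t}, ∀ e, 0 ≤ e → e ≤ v'' - w →
      x t + e ∈ I0 ∧ f0 (x t) + φ * e ≤ f0 (x t + e) := by
    rintro t ⟨ht, -⟩ e he0 he
    constructor
    · rcases he0.eq_or_lt with rfl | he0
      · simpa using hx.mem0 t
      · exact h0.mem_of_pos (by linarith [(h0.subset_Icc (hx.mem0 t)).1]) (by linarith) hv''I
    · exact ConcaveOn.raise h0.concave (hx.mem0 t) hv''I (ht.trans hw1.le) hw2 he0 (by linarith)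
  have hI2' : ∀ t, v' ≤ x' t → ∀ e, 0 ≤ e → e ≤ v' - v'' →
      x' t - e ∈ I0 ∧ f0 (x' t) - β * e ≤ f0 (x' t - e) := fun t ht e he0 he =>
    ⟨h0.mem_of_pos (by linarith) (by linarith) (hx'.mem0 t),
      ConcaveOn.lower h0.concave hv''I (hx'.mem0 t) ht hv2 he0 (by linarith)⟩
  have hSm2 : MeasurableSet {t | x t ≤ v ∧ v' ≤ x' t} :=
    (measurableSet_le hxb.1 measurable_const).inter (measurableSet_le measurable_const hxb'.1)
  by_cases h : ∃ τ ∈ Icc 0 t0, promised r x' τ - promised r x τ ≤ 0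
  · obtain ⟨τ, hτ, hτ0⟩ := h
    obtain ⟨a, ha, ha0, hDa⟩ := exists_last_le hDc hτ.2 hτ0 (sub_pos.2 hlt)
    have haa : 0 ≤ a := hτ.1.trans ha.1
    have hta : tailValue r (fun s => x' s - x s) a < tailValue r (fun s => x' s - x s) t0 := by
      rw [htail a, ha0, mul_zero]; exact htail0
    rw [tailValue_sub hr hxb' hxb, tailValue_sub hr hxb' hxb] at hta
    -- The discounted reward difference rises from zero at `a`, so `x` exceeds `x'` on a non-null
    -- set before `t0`.
    obtain ⟨y, y', t1, hyy, ht1, hL1⟩ := exists_crossing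
      (not_ae_le_of_tailValue hr hxb' hxb ha.2.le (by linarith))
    have h12 : t1 < t2 := ht1.2.trans ht2.1
    have ht01 : 0 < t1 := haa.trans_lt ht1.1
    -- As `x'` decreases, its level near `t1` is no lower than near `t2`. The chord `[y,y']` thus
    -- lies to the right of `[v'',v']`, which gives `α ≤ β`.
    have hy : v' ≤ y := by
      by_contra! hlt'
      exact hx'.not_leftAcc hr h0 h1 hf0 hG' hanti' hlt' ht01 h12 (hL1.mono fun t ht => ht.1) hL2'
    obtain ⟨u, -, ⟨hu1, hu2⟩, -⟩ := hL1.exists_mem (sub_one_lt t1)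
      (Filter.Eventually.of_forall fun _ => trivial)
    have hy'I : y' ∈ I0 := h0.mem_of_pos (by linarith) hu2 (hx.mem0 u)
    have hyI : y ∈ I0 := h0.mem_of_pos (by linarith) hyy.le hy'I
    refine IsOptimalPath.comparison_core hr h0 h1 hf0 hG hG' hMLR hx hx' hanti hanti'
      (s1 := (a + t1) / 2) (t1 := t1) (t2 := t2) (α := (f0 y' - f0 y) / (y' - y)) (β := β) (φ := φ)
      (δ := min (min (v'' - w) (v' - v'')) (y' - y)) (v' := v')
      (S1 := {t | x' t ≤ y ∧ y' ≤ x t}) (S2 := {t | x t ≤ v ∧ v' ≤ x' t})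
      ((measurableSet_le hxb'.1 measurable_const).inter (measurableSet_le measurable_const hxb.1))
      hSm2 ht01.le (fun h => absurd h ht01.ne') (by linarith [ht1.1]) h12
      (lt_min (lt_min (by linarith) (by linarith)) (by linarith)) hL1 hL2 hL2' ?_ ?_ ?_ ?_ ?_ hφβ
    · intro t _ hst htt
      rcases le_total t t0 with h | h
      · exact sub_pos.1 (hDa t ⟨by linarith [ht1.1], h⟩)
      · exact hDb t ⟨h, htt.trans_lt ht2.2⟩
    · rintro t ⟨hty, hty'⟩ _ _ _ e he0 he
      have he := he.trans (min_le_right _ _)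
      refine ⟨⟨?_, ConcaveOn.lower h0.concave hyI (hx.mem0 t) hty' hyy he0 (by linarith)⟩,
        ⟨?_, ConcaveOn.raise h0.concave (hx'.mem0 t) hy'I hty hyy he0 (by linarith)⟩⟩
      · exact h0.mem_of_pos (by linarith) (by linarith) (hx.mem0 t)
      · rcases he0.eq_or_lt with rfl | he0
        · simpa using hx'.mem0 t
        · exact h0.mem_of_pos (by linarith [(h0.subset_Icc (hx'.mem0 t)).1]) (by linarith) hy'I
    · exact fun t ht e he0 he =>
        hI2 t ht e he0 (he.trans ((min_le_left _ _).trans (min_le_left _ _)))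
    · exact fun t ht e he0 he =>
        hI2' t ht e he0 (he.trans ((min_le_left _ _).trans (min_le_right _ _)))
    · exact ConcaveOn.secant_le h0.concave hv''I hy'I hv2 hyy (by linarith) (by linarith)
  · push Not at h
    -- Here `X < X'` from time `0` on, and flow at `t2` can be changed without compensation. Taking
    -- `α = 0` is consistent with `α ≤ β` because `f0` increases up to its peak.
    refine IsOptimalPath.comparison_core hr h0 h1 hf0 hG hG' hMLR hx hx' hanti hanti'
      (s1 := -1) (t1 := 0) (t2 := t2) (α := 0) (β := β) (φ := φ)
      (δ := min (v'' - w) (v' - v'')) (v' := v')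
      (S1 := univ) (S2 := {t | x t ≤ v ∧ v' ≤ x' t}) MeasurableSet.univ
      hSm2 le_rfl (fun _ => rfl) (by norm_num) ht02
      (lt_min (by linarith) (by linarith)) (fun s hs => by simpa using hs) hL2 hL2' ?_ ?_ ?_ ?_ ?_ hφβ
    · intro t ht _ htt
      rcases le_total t t0 with h' | h'
      · exact sub_pos.1 (h t ⟨ht, h'⟩)
      · exact hDb t ⟨h', htt.trans_lt ht2.2⟩
    · intro t _ h1 _ h2
      exact absurd h2 h1.not_gt
    · exact fun t ht e he0 he => hI2 t ht e he0 (he.trans (min_le_left _ _))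
    · exact fun t ht e he0 he => hI2' t ht e he0 (he.trans (min_le_right _ _))
    · exact div_nonneg (sub_nonneg.2 (hmono hv''I hv'I hv2.le)) (by linarith)

end

/-! ### Extended-real integrals -/

theorem erealIntegral_mono {μ : Measure ℝ} {f g : ℝ → EReal} (h : ∀ᵐ t ∂μ, f t ≤ g t) :
    erealIntegral μ f ≤ erealIntegral μ g := by
  refine EReal.sub_le_sub ?_ ?_
  · exact EReal.coe_ennreal_le_coe_ennreal_iff.2 (lintegral_mono_ae (h.mono fun t ht =>
      EReal.toENNReal_le_toENNReal ht))
  · exact EReal.coe_ennreal_le_coe_ennreal_iff.2 (lintegral_mono_ae (h.mono fun t ht =>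
      EReal.toENNReal_le_toENNReal (EReal.neg_le_neg_iff.2 ht)))

theorem erealIntegral_congr {μ : Measure ℝ} {f g : ℝ → EReal} (h : ∀ᵐ t ∂μ, f t = g t) :
    erealIntegral μ f = erealIntegral μ g :=
  (erealIntegral_mono (h.mono fun _ => le_of_eq)).antisymm
    (erealIntegral_mono (h.mono fun _ => ge_of_eq))

theorem erealIntegral_coe {μ : Measure ℝ} {f : ℝ → ℝ} (hf : Integrable f μ) :
    erealIntegral μ (fun t => (f t : EReal)) = ((∫ t, f t ∂μ : ℝ) : EReal) := by
  have h1 : ∫⁻ t, ENNReal.ofReal (f t) ∂μ ≠ ⊤ := hf.lintegral_lt_top.ne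
  have h2 : ∫⁻ t, ENNReal.ofReal (-f t) ∂μ ≠ ⊤ := hf.neg.lintegral_lt_top.ne
  rw [integral_eq_lintegral_pos_part_sub_lintegral_neg_part hf]
  simp only [erealIntegral, ← EReal.coe_neg, EReal.real_coe_toENNReal, EReal.coe_sub]
  rw [EReal.coe_ennreal_toReal h1, EReal.coe_ennreal_toReal h2]

/-- An extended-real function, bounded above by an integrable function, whose integral exceeds
`-∞` is almost everywhere an integrable real function. -/
theorem integrable_toReal_of_erealIntegral_ne_bot {μ : Measure ℝ} {f : ℝ → EReal} {c : ℝ → ℝ}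
    (hf : AEMeasurable f μ) (hc : Integrable c μ) (hb : ∀ᵐ t ∂μ, f t ≤ c t)
    (h : erealIntegral μ f ≠ ⊥) :
    (∀ᵐ t ∂μ, f t ≠ ⊥) ∧ Integrable (fun t => (f t).toReal) μ ∧
      erealIntegral μ f = ((∫ t, (f t).toReal ∂μ : ℝ) : EReal) := by
  have hn : ∫⁻ t, (-f t).toENNReal ∂μ ≠ ⊤ := by
    intro h'
    refine h ?_
    rw [erealIntegral, h', EReal.coe_ennreal_top, EReal.sub_top]
  have hbot : ∀ᵐ t ∂μ, f t ≠ ⊥ := by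
    filter_upwards [ae_lt_top' (measurable_ereal_toENNReal.comp_aemeasurable
      (measurable_neg.comp_aemeasurable hf)) hn] with t ht h'
    simp [h'] at ht
  have heq : ∀ᵐ t ∂μ, f t = ((f t).toReal : EReal) := by
    filter_upwards [hbot, hb] with t h1 h2
    exact (EReal.coe_toReal (h2.trans_lt (EReal.coe_lt_top _)).ne h1).symm
  have hi : Integrable (fun t => (f t).toReal) μ := by
    refine ⟨hf.ereal_toReal.aestronglyMeasurable, ?_⟩
    have hle : ∫⁻ t, ‖(f t).toReal‖ₑ ∂μ ≤ ∫⁻ t, (‖c t‖ₑ + (-f t).toENNReal) ∂μ := by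
      refine lintegral_mono_ae ?_
      filter_upwards [heq, hb] with t h1 h2
      rw [h1] at h2 ⊢
      have h2 : (f t).toReal ≤ c t := by exact_mod_cast h2
      rw [← EReal.coe_neg, EReal.real_coe_toENNReal, EReal.toReal_coe, Real.enorm_eq_ofReal_abs,
        Real.enorm_eq_ofReal_abs]
      rcases le_total 0 (f t).toReal with h | h
      · exact (ENNReal.ofReal_le_ofReal (abs_le_abs_of_nonneg h h2)).trans le_self_add
      · rw [abs_of_nonpos h]
        exact le_add_self
    refine hle.trans_lt ?_
    rw [lintegral_add_left' hc.1.enorm]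
    exact ENNReal.add_lt_top.2 ⟨hc.2, hn.lt_top⟩
  exact ⟨hbot, hi, by rw [← erealIntegral_coe hi]; exact erealIntegral_congr heq⟩

theorem erealIntegral_dirac (t : ℝ) (f : ℝ → EReal) :
    erealIntegral (Measure.dirac t) f = f t := by
  rw [erealIntegral, lintegral_dirac, lintegral_dirac]
  induction h : f t with
  | bot => simp
  | top => simp
  | coe x =>
    rw [← EReal.coe_neg, EReal.real_coe_toENNReal, EReal.real_coe_toENNReal,
      EReal.coe_ennreal_ofReal, EReal.coe_ennreal_ofReal, ← EReal.coe_sub]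
    congr 1
    rcases le_total 0 x with h | h
    · simp [h]
    · simp [h]

theorem coe_mul_eq_bot_iff {a : ℝ} (ha : 0 < a) {x : EReal} : (a : EReal) * x = ⊥ ↔ x = ⊥ := by
  induction x with
  | bot => simp [EReal.coe_mul_bot_of_pos ha]
  | top => simp [EReal.coe_mul_top_of_pos ha]
  | coe x => exact iff_of_false (by rw [← EReal.coe_mul]; exact EReal.coe_ne_bot _) (EReal.coe_ne_bot _)

theorem coe_mul_ne_top {a : ℝ} (ha : 0 < a) {x : EReal} (hx : x ≠ ⊤) : (a : EReal) * x ≠ ⊤ := by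
  induction x with
  | bot => simp [EReal.coe_mul_bot_of_pos ha]
  | top => exact absurd rfl hx
  | coe x => rw [← EReal.coe_mul]; exact EReal.coe_ne_top _

/-! ### Frontiers as real concave functions -/

section
variable {F : ℝ≥0 → EReal} {p : ℝ≥0}

theorem IsFrontier.le_peak (hF : IsFrontier F p) (u : ℝ≥0) : F u ≤ F p := by
  rcases eq_or_ne u p with rfl | h
  · exact le_rfl
  · exact (hF.peak u h).le

theorem IsFrontier.peak_ne_bot (hF : IsFrontier F p) : F p ≠ ⊥ :=
  fun h => absurd (hF.peak (p + 1) (by simp)) (by simp [h])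

theorem IsFrontier.lt_of_convexCombo (hF : IsFrontier F p) {u a b : ℝ≥0} (hu : u ≠ p) (hb : 0 < b)
    (hab : a + b = 1) (hv : F (a * u + b * p) ≠ ⊥) : F u < F (a * u + b * p) := by
  rcases eq_or_ne (F u) ⊥ with h | h
  · rw [h]; exact bot_lt_iff_ne_bot.2 hv
  refine lt_of_lt_of_le ?_ (hF.concave u p a b hab)
  have h1 := hF.peak u hu
  rw [← EReal.coe_toReal (hF.lt_top u).ne h, ← EReal.coe_toReal (hF.lt_top p).ne hF.peak_ne_bot] at *
  have hab' : (a : ℝ) + b = 1 := by exact_mod_cast hab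
  have hb' : (0 : ℝ) < b := by exact_mod_cast hb
  have h1 := EReal.coe_lt_coe_iff.1 h1
  rw [← EReal.coe_mul, ← EReal.coe_mul, ← EReal.coe_add, EReal.coe_lt_coe_iff,
    show (a : ℝ) = 1 - b by linarith]
  linarith [mul_pos hb' (sub_pos.2 h1)]

/-- A frontier is strictly increasing towards its peak, where it is finite. -/
theorem IsFrontier.lt_of_between (hF : IsFrontier F p) {u v : ℝ≥0}
    (h : u < v ∧ v ≤ p ∨ p ≤ v ∧ v < u) (hv : F v ≠ ⊥) : F u < F v := by
  have hup : u ≠ p := by rcases h with h | h <;> [exact (h.1.trans_le h.2).ne; exact (h.1.trans_lt h.2).ne']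
  have hupR : (u : ℝ) - p ≠ 0 := sub_ne_zero.2 (by exact_mod_cast hup)
  have hb : 0 < ((u : ℝ) - v) / (u - p) ∧ ((u : ℝ) - v) / (u - p) ≤ 1 := by
    rcases h with ⟨h1, h2⟩ | ⟨h1, h2⟩
    · have h1 : (u : ℝ) < v := by exact_mod_cast h1
      have h2 : (v : ℝ) ≤ p := by exact_mod_cast h2
      exact ⟨div_pos_of_neg_of_neg (by linarith) (by linarith),
        (div_le_one_of_neg (by linarith)).2 (by linarith)⟩
    · have h1 : (p : ℝ) ≤ v := by exact_mod_cast h1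
      have h2 : (v : ℝ) < u := by exact_mod_cast h2
      exact ⟨div_pos (by linarith) (by linarith), (div_le_one (by linarith)).2 (by linarith)⟩
  -- The weight on the peak in writing `v` as a mixture of `u` and `p`; the same formula serves on
  -- both sides of the peak.
  set b : ℝ≥0 := ⟨((u : ℝ) - v) / (u - p), hb.1.le⟩ with hbdef
  have hb1 : b ≤ 1 := by rw [← NNReal.coe_le_coe]; exact hb.2
  have hcombo : (1 - b) * u + b * p = v := by
    rw [← NNReal.coe_inj]
    push_cast [NNReal.coe_sub hb1]
    rw [show (b : ℝ) = ((u : ℝ) - v) / (u - p) from rfl]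
    field_simp
    ring
  have := hF.lt_of_convexCombo hup (b := b) (a := 1 - b) (by rw [← NNReal.coe_pos]; exact hb.1)
    (tsub_add_cancel_of_le hb1)
  rw [hcombo] at this
  exact this hv

theorem IsFrontier.measurable (hF : IsFrontier F p) : Measurable F := hF.usc.measurable

theorem IsFrontier.measurable_extend (hF : IsFrontier F p) : Measurable (extendFrontier F) :=
  Measurable.ite (measurableSet_singleton ⊤) measurable_const
    (hF.measurable.comp ENNReal.measurable_toNNReal)

theorem IsFrontier.extend_le_peak (hF : IsFrontier F p) (X : ℝ≥0∞) : extendFrontier F X ≤ F p := by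
  unfold extendFrontier
  split_ifs
  · exact bot_le
  · exact hF.le_peak _

theorem extendFrontier_coe (F : ℝ≥0 → EReal) (u : ℝ≥0) : extendFrontier F u = F u := by
  simp [extendFrontier]

/-- The part of the effective domain of `F` on `[0,p]`. -/
def domain (F : ℝ≥0 → EReal) (p : ℝ≥0) : Set ℝ := {u | u ∈ Icc 0 (p : ℝ) ∧ F u.toNNReal ≠ ⊥}

/-- A frontier as a real function. -/
def realValue (F : ℝ≥0 → EReal) (u : ℝ) : ℝ := (F u.toNNReal).toReal

theorem coe_realValue (hF : ∀ u, F u < ⊤) {u : ℝ} (hu : u ∈ domain F p) :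
    (realValue F u : EReal) = F u.toNNReal :=
  EReal.coe_toReal (hF _).ne hu.2

theorem isDomain_domain (hc : IsConcave F) (ht : ∀ u, F u < ⊤)
    (h : ∀ u, 0 < u → u ≤ p → F u ≠ ⊥) : IsDomain p (domain F p) (realValue F) := by
  have key : ∀ u ∈ domain F p, ∀ v ∈ domain F p, ∀ a b : ℝ, 0 ≤ a → 0 ≤ b → a + b = 1 →
      ((a * realValue F u + b * realValue F v : ℝ) : EReal) ≤ F (a * u + b * v).toNNReal := by
    intro u hu v hv a b ha hb hab
    have := hc u.toNNReal v.toNNReal a.toNNReal b.toNNReal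
      (by rw [← Real.toNNReal_add ha hb, hab, Real.toNNReal_one])
    rw [← coe_realValue ht hu, ← coe_realValue ht hv, Real.coe_toNNReal a ha, Real.coe_toNNReal b hb,
      ← Real.toNNReal_mul ha, ← Real.toNNReal_mul hb,
      ← Real.toNNReal_add (mul_nonneg ha hu.1.1) (mul_nonneg hb hv.1.1)] at this
    exact_mod_cast this
  have hconv : ∀ u ∈ domain F p, ∀ v ∈ domain F p, ∀ a b : ℝ, 0 ≤ a → 0 ≤ b → a + b = 1 →
      a * u + b * v ∈ domain F p := fun u hu v hv a b ha hb hab =>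
    ⟨convex_Icc 0 (p : ℝ) hu.1 hv.1 ha hb hab, fun h' => by
      have := key u hu v hv a b ha hb hab
      rw [h', le_bot_iff] at this
      exact EReal.coe_ne_bot _ this⟩
  refine ⟨fun u hu => ⟨⟨hu.1.le, hu.2⟩, h _ (Real.toNNReal_pos.2 hu.1) ?_⟩, fun u hu => hu.1,
    fun u hu v hv a b ha hb hab => hconv u hu v hv a b ha hb hab,
    fun u hu v hv a b ha hb hab => ?_⟩
  · exact Real.toNNReal_le_iff_le_coe.2 hu.2
  · have := key u hu v hv a b ha hb hab
    rw [← coe_realValue ht (hconv u hu v hv a b ha hb hab)] at this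
    exact_mod_cast this

theorem IsStrictlyConcave.strictConcaveOn (hs : IsStrictlyConcave F) (ht : ∀ u, F u < ⊤)
    (hconv : Convex ℝ (domain F p)) : StrictConcaveOn ℝ (domain F p) (realValue F) := by
  refine ⟨hconv, fun u hu v hv huv a b ha hb hab => ?_⟩
  have := hs u.toNNReal v.toNNReal a.toNNReal b.toNNReal hu.2 hv.2
    (fun h => huv ((Real.toNNReal_eq_toNNReal_iff hu.1.1 hv.1.1).1 h))
    (Real.toNNReal_pos.2 ha) (Real.toNNReal_pos.2 hb)
    (by rw [← Real.toNNReal_add ha.le hb.le, hab, Real.toNNReal_one])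
  rw [← coe_realValue ht hu, ← coe_realValue ht hv, Real.coe_toNNReal a ha.le,
    Real.coe_toNNReal b hb.le, ← Real.toNNReal_mul ha.le, ← Real.toNNReal_mul hb.le,
    ← Real.toNNReal_add (mul_nonneg ha.le hu.1.1) (mul_nonneg hb.le hv.1.1)] at this
  have hm : a * u + b * v ∈ domain F p := hconv hu hv ha.le hb.le hab
  rw [← coe_realValue ht hm] at this
  exact_mod_cast this

theorem IsFrontier.monotoneOn_realValue (hF : IsFrontier F p) :
    MonotoneOn (realValue F) (domain F p) := by
  intro u hu v hv huv
  rcases huv.eq_or_lt with rfl | h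
  · exact le_rfl
  · rw [← EReal.coe_le_coe_iff, coe_realValue hF.lt_top hu, coe_realValue hF.lt_top hv]
    exact (hF.lt_of_between (Or.inl ⟨(Real.toNNReal_lt_toNNReal_iff (hu.1.1.trans_lt h)).2 h,
      Real.toNNReal_le_iff_le_coe.2 hv.1.2⟩) hv.2).le

end

/-! ### Payoffs, incentive constraints and deviations -/

theorem erealIntegral_eq_bot_iff {μ : Measure ℝ} {f : ℝ → EReal} :
    erealIntegral μ f = ⊥ ↔ ∫⁻ t, (-f t).toENNReal ∂μ = ⊤ := by
  rw [erealIntegral, sub_eq_add_neg, EReal.add_eq_bot_iff, EReal.neg_eq_bot_iff]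
  simp

section
variable {r : ℝ} {F0 F1 : ℝ≥0 → EReal} {u0 u1 : ℝ≥0} {G : Measure ℝ} {m : Mechanism}

theorem IsTechnology.F0_ne_bot (hF : IsTechnology F0 F1 u0 u1) {u : ℝ≥0} (h : 0 < u) (h' : u ≤ u0) :
    F0 u ≠ ⊥ := (hF.finite0 u h h').ne'

theorem IsTechnology.F1_ne_bot (hF : IsTechnology F0 F1 u0 u1) {u : ℝ≥0} (h : 0 < u) (h' : u ≤ u0) :
    F1 u ≠ ⊥ := ((hF.finite0 u h h').trans_le (hF.le u)).ne'

/-- The principal's payoff from disclosing the breakthrough at its arrival time `τ`. -/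
def payoffAt (r : ℝ) (F0 F1 : ℝ≥0 → EReal) (m : Mechanism) (τ : ℝ) : EReal :=
  erealIntegral (volume.restrict (Ioo 0 τ))
      (fun t => ((r * Real.exp (-r * t) : ℝ) : EReal) * F0 (m.flow t))
    + ((Real.exp (-r * τ) : ℝ) : EReal) * extendFrontier F1 (m.reward τ)

/-- `payoffAt` as a real number. -/
def realPayoffAt (r : ℝ) (F0 F1 : ℝ≥0 → EReal) (m : Mechanism) (τ : ℝ) : ℝ :=
  (∫ t in Ioo 0 τ, r * Real.exp (-r * t) * (F0 (m.flow t)).toReal)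
    + Real.exp (-r * τ) * (extendFrontier F1 (m.reward τ)).toReal

/-- All payoffs of `m` under `G` are real. -/
structure HasRealPayoff (r : ℝ) (F0 F1 : ℝ≥0 → EReal) (G : Measure ℝ) (m : Mechanism) : Prop where
  flow_ne_bot : ∀ᵐ t, 0 < t → F0 (m.flow t) ≠ ⊥
  integrableOn : ∀ T, IntegrableOn (fun t => r * Real.exp (-r * t) * (F0 (m.flow t)).toReal) (Ioo 0 T)
  inner : ∀ T, erealIntegral (volume.restrict (Ioo 0 T))
      (fun t => ((r * Real.exp (-r * t) : ℝ) : EReal) * F0 (m.flow t))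
    = ((∫ t in Ioo 0 T, r * Real.exp (-r * t) * (F0 (m.flow t)).toReal : ℝ) : EReal)
  reward_ne_bot : ∀ᵐ τ ∂G, extendFrontier F1 (m.reward τ) ≠ ⊥
  integrable : Integrable (realPayoffAt r F0 F1 m) G
  payoff_eq : payoff r F0 F1 G m = ((∫ τ, realPayoffAt r F0 F1 m τ ∂G : ℝ) : EReal)

/-- Along an incentive-compatible mechanism, the discounted reward decreases. -/
theorem IsIC.antitoneOn (hm : IsIC r m) :
    AntitoneOn (fun t => ENNReal.ofReal (Real.exp (-r * t)) * m.reward t) (Ici 0) := by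
  intro s hs t ht hst
  rcases hst.eq_or_lt with rfl | hlt
  · exact le_rfl
  have h := (le_add_self.trans ((hm s hs).1 (t - s) (sub_pos.2 hlt)))
  rw [add_sub_cancel] at h
  calc ENNReal.ofReal (Real.exp (-r * t)) * m.reward t
      = ENNReal.ofReal (Real.exp (-r * s)) * (ENNReal.ofReal (Real.exp (-r * (t - s))) * m.reward t) := by
        rw [← mul_assoc, ← ENNReal.ofReal_mul (Real.exp_nonneg _), ← Real.exp_add]
        ring_nf
    _ ≤ _ := mul_le_mul' le_rfl h

/-- A reward is an arbitrary function, but under incentive-compatibility it is an exponential times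
a monotone function. -/
theorem IsIC.aemeasurable_reward (hm : IsIC r m) (hG : IsUnboundedDistribution G) :
    AEMeasurable m.reward G := by
  have h1 := aemeasurable_restrict_of_antitoneOn (μ := G) measurableSet_Ici hm.antitoneOn
  rw [Measure.restrict_eq_self_of_ae_mem (s := Ici 0) hG.ae_nonneg] at h1
  have h2 : Measurable fun t => ENNReal.ofReal (Real.exp (r * t)) := by fun_prop
  refine (h2.aemeasurable.mul h1).congr (Filter.Eventually.of_forall fun t => ?_)
  simp only [Pi.mul_apply]
  rw [← mul_assoc, ← ENNReal.ofReal_mul (Real.exp_nonneg _), ← Real.exp_add]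
  simp

theorem Mechanism.aemeasurable_frontier (m : Mechanism) {F : ℝ≥0 → EReal} {p : ℝ≥0}
    (hF : IsFrontier F p) : AEMeasurable (fun t => F (m.flow t)) volume :=
  hF.measurable.comp_aemeasurable m.measurable_flow

theorem measurable_setIntegral_Ioo {a : ℝ → ℝ} (ha : AEStronglyMeasurable a volume) :
    Measurable fun τ => ∫ t in Ioo 0 τ, a t := by
  have h : ∀ τ, ∫ t in Ioo 0 τ, a t = ∫ t, {p : ℝ × ℝ | 0 < p.2 ∧ p.2 < p.1}.indicator
      (fun p => ha.mk a p.2) (τ, t) := by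
    intro τ
    rw [setIntegral_congr_ae measurableSet_Ioo (ha.ae_eq_mk.mono fun t ht _ => ht),
      ← integral_indicator measurableSet_Ioo]
    rfl
  simp_rw [h]
  refine (StronglyMeasurable.integral_prod_right' ?_).measurable
  refine (ha.stronglyMeasurable_mk.comp_measurable measurable_snd).indicator ?_
  exact (measurableSet_lt measurable_const measurable_snd).inter
    (measurableSet_lt measurable_snd measurable_fst)

theorem lintegral_Ioi_top (hG : IsUnboundedDistribution G) {f : ℝ → ℝ≥0∞} {T : ℝ}
    (h : ∀ τ, T < τ → f τ = ⊤) : ∫⁻ τ, f τ ∂G = ⊤ := by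
  rw [eq_top_iff]
  calc ⊤ = ⊤ * G (Ioi T) := (ENNReal.top_mul (hG.tail_pos T).ne').symm
    _ = ∫⁻ _ in Ioi T, ⊤ ∂G := by rw [setLIntegral_const]
    _ = ∫⁻ τ in Ioi T, f τ ∂G := setLIntegral_congr_fun measurableSet_Ioi fun τ hτ => (h τ hτ).symm
    _ ≤ ∫⁻ τ, f τ ∂G := setLIntegral_le_lintegral _ _

theorem HasRealPayoff.of_payoff_ne_bot (hr : 0 < r) (hF : IsTechnology F0 F1 u0 u1)
    (hG : IsUnboundedDistribution G) (hm : IsIC r m) (h : payoff r F0 F1 G m ≠ ⊥) :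
    HasRealPayoff r F0 F1 G m := by
  have := hG.prob
  have hmeas : AEMeasurable (fun t => ((r * Real.exp (-r * t) : ℝ) : EReal) * F0 (m.flow t)) volume := by
    refine AEMeasurable.mul ?_ (m.aemeasurable_frontier hF.frontier0)
    exact (Measurable.coe_real_ereal (by fun_prop)).aemeasurable
  -- A flow payoff of `-∞` up to `T` persists for every later breakthrough time, an event of
  -- positive probability under unbounded support.
  have hJ : ∀ T, erealIntegral (volume.restrict (Ioo 0 T))
      (fun t => ((r * Real.exp (-r * t) : ℝ) : EReal) * F0 (m.flow t)) ≠ ⊥ := by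
    intro T hT
    refine h (erealIntegral_eq_bot_iff.2 (lintegral_Ioi_top hG (T := T) fun τ hτ => ?_))
    rw [EReal.toENNReal_eq_top_iff, EReal.neg_eq_top_iff, EReal.add_eq_bot_iff]
    left
    rw [erealIntegral_eq_bot_iff, eq_top_iff] at hT ⊢
    exact hT.trans (lintegral_mono_set (Ioo_subset_Ioo_right hτ.le))
  set c0 := (F0 u0).toReal
  set c1 := (F1 u1).toReal
  have hc0 : ∀ u, F0 u ≤ c0 := fun u => (hF.frontier0.le_peak u).trans
    (EReal.le_coe_toReal (hF.frontier0.lt_top _).ne)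
  have hc1 : ∀ X, extendFrontier F1 X ≤ c1 := fun X => (hF.frontier1.extend_le_peak X).trans
    (EReal.le_coe_toReal (hF.frontier1.lt_top _).ne)
  have hin : ∀ T, _ := fun T => integrable_toReal_of_erealIntegral_ne_bot
    (μ := volume.restrict (Ioo 0 T)) (c := fun t => r * Real.exp (-r * t) * c0) hmeas.restrict
    (((integrableOn_weight hr 0).mono_set Ioo_subset_Ioi_self).mul_const c0)
    (Filter.Eventually.of_forall fun t => by
      rw [EReal.coe_mul]
      exact mul_le_mul_of_nonneg_left (hc0 _) (by exact_mod_cast (weight_pos hr t).le)) (hJ T)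
  simp only [EReal.toReal_mul, EReal.toReal_coe] at hin
  have hfl : ∀ᵐ t, 0 < t → F0 (m.flow t) ≠ ⊥ := by
    have h1 : ∀ n : ℕ, ∀ᵐ t, t ∈ Ioo (0 : ℝ) n →
        ((r * Real.exp (-r * t) : ℝ) : EReal) * F0 (m.flow t) ≠ ⊥ := fun n =>
      (ae_restrict_iff' measurableSet_Ioo).1 (hin n).1
    filter_upwards [ae_all_iff.2 h1] with t ht ht0
    obtain ⟨n, hn⟩ := exists_nat_gt t
    exact fun h' => ht n ⟨ht0, hn⟩ ((coe_mul_eq_bot_iff (weight_pos hr t)).2 h')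
  set K : ℝ → ℝ := fun τ => ∫ t in Ioo 0 τ, r * Real.exp (-r * t) * (F0 (m.flow t)).toReal
  have hKm : Measurable K := by
    refine measurable_setIntegral_Ioo (AEMeasurable.aestronglyMeasurable ?_)
    exact AEMeasurable.mul (by fun_prop) (m.aemeasurable_frontier hF.frontier0).ereal_toReal
  have hKb : ∀ τ, K τ ≤ |c0| := by
    intro τ
    have h1 : K τ ≤ ∫ t in Ioo 0 τ, r * Real.exp (-r * t) * |c0| := by
      refine setIntegral_mono_on_ae (hin τ).2.1
        (((integrableOn_weight hr 0).mono_set Ioo_subset_Ioi_self).mul_const _) measurableSet_Ioo ?_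
      filter_upwards [hfl] with t ht ht'
      refine mul_le_mul_of_nonneg_left ((EReal.coe_le_coe_iff.1 ?_).trans (le_abs_self c0))
        (weight_pos hr t).le
      rw [EReal.coe_toReal (hF.frontier0.lt_top _).ne (ht ht'.1)]
      exact hc0 _
    refine h1.trans ((setIntegral_mono_set ((integrableOn_weight hr 0).mul_const _)
      (Filter.Eventually.of_forall fun t => mul_nonneg (weight_pos hr t).le (abs_nonneg _))
      Ioo_subset_Ioi_self.eventuallyLE).trans ?_)
    rw [integral_mul_const, integral_weight hr]
    simp
  have hWeq : ∀ τ, payoffAt r F0 F1 m τ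
      = (K τ : EReal) + ((Real.exp (-r * τ) : ℝ) : EReal) * extendFrontier F1 (m.reward τ) := fun τ => by
    rw [payoffAt, (hin τ).2.2]
  have hWm : AEMeasurable (payoffAt r F0 F1 m) G := by
    rw [funext hWeq]
    refine AEMeasurable.add hKm.coe_real_ereal.aemeasurable (AEMeasurable.mul ?_
      (hF.frontier1.measurable_extend.comp_aemeasurable (hm.aemeasurable_reward hG)))
    exact (Measurable.coe_real_ereal (by fun_prop)).aemeasurable
  obtain ⟨h1, h2, h3⟩ := integrable_toReal_of_erealIntegral_ne_bot (c := fun _ => |c0| + |c1|) hWm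
    (integrable_const _) (by
      filter_upwards [hG.ae_nonneg] with τ hτ
      rw [hWeq, EReal.coe_add]
      refine add_le_add (by exact_mod_cast hKb τ) ?_
      refine (mul_le_mul_of_nonneg_left (hc1 _) (by exact_mod_cast (Real.exp_nonneg _))).trans ?_
      rw [← EReal.coe_mul, EReal.coe_le_coe_iff]
      have he : Real.exp (-r * τ) ≤ 1 := Real.exp_le_one_iff.2 (by nlinarith)
      calc Real.exp (-r * τ) * c1 ≤ Real.exp (-r * τ) * |c1| := by gcongr; exact le_abs_self _
        _ ≤ 1 * |c1| := by gcongr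
        _ = |c1| := one_mul _) h
  have hrw : ∀ᵐ τ ∂G, extendFrontier F1 (m.reward τ) ≠ ⊥ := by
    filter_upwards [h1] with τ hτ
    rw [hWeq, EReal.add_ne_bot_iff] at hτ
    exact fun h' => hτ.2 ((coe_mul_eq_bot_iff (Real.exp_pos _)).2 h')
  have heq : (fun τ => (payoffAt r F0 F1 m τ).toReal) =ᵐ[G] realPayoffAt r F0 F1 m := by
    filter_upwards [hrw] with τ hτ
    rw [hWeq, EReal.toReal_add (EReal.coe_ne_top _) (EReal.coe_ne_bot _)
      (coe_mul_ne_top (Real.exp_pos _) ((hc1 _).trans_lt (EReal.coe_lt_top _)).ne)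
      (fun h' => hτ ((coe_mul_eq_bot_iff (Real.exp_pos _)).1 h')), EReal.toReal_mul,
      EReal.toReal_coe, EReal.toReal_coe]
    rfl
  exact ⟨hfl, fun T => (hin T).2.1, fun T => (hin T).2.2, hrw, h2.congr heq,
    h3.trans (by rw [integral_congr_ae heq])⟩

theorem le_payoff {a b : ℝ → ℝ} (ha : ∀ᵐ t, 0 < t → (a t : EReal) ≤ F0 (m.flow t)) (hr : 0 < r)
    (hai : ∀ T, IntegrableOn (fun t => r * Real.exp (-r * t) * a t) (Ioo 0 T))
    (hb : ∀ᵐ τ ∂G, (b τ : EReal) ≤ extendFrontier F1 (m.reward τ))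
    (hi : Integrable (fun τ => (∫ t in Ioo 0 τ, r * Real.exp (-r * t) * a t)
      + Real.exp (-r * τ) * b τ) G) :
    ((∫ τ, ((∫ t in Ioo 0 τ, r * Real.exp (-r * t) * a t) + Real.exp (-r * τ) * b τ) ∂G : ℝ) : EReal)
      ≤ payoff r F0 F1 G m := by
  rw [← erealIntegral_coe hi]
  refine erealIntegral_mono ?_
  filter_upwards [hb] with τ hτ
  rw [EReal.coe_add, EReal.coe_mul]
  refine add_le_add ?_ (mul_le_mul_of_nonneg_left hτ (by exact_mod_cast (Real.exp_nonneg _)))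
  rw [← erealIntegral_coe (hai τ)]
  refine erealIntegral_mono ((ae_restrict_iff' measurableSet_Ioo).2 ?_)
  filter_upwards [ha] with t ht ht'
  rw [EReal.coe_mul]
  exact mul_le_mul_of_nonneg_left (ht ht'.1) (by exact_mod_cast (weight_pos hr t).le)

theorem payoff_mono (hr : 0 < r) {m' : Mechanism} (hG : G (Iio 0) = 0)
    (h0 : ∀ᵐ t, 0 < t → F0 (m.flow t) ≤ F0 (m'.flow t))
    (h1 : ∀ τ, 0 ≤ τ → extendFrontier F1 (m.reward τ) ≤ extendFrontier F1 (m'.reward τ)) :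
    payoff r F0 F1 G m ≤ payoff r F0 F1 G m' := by
  refine erealIntegral_mono ?_
  have hG' : ∀ᵐ τ ∂G, 0 ≤ τ := by rw [ae_iff]; simpa [Iio] using hG
  filter_upwards [hG'] with τ hτ
  refine add_le_add ?_ (mul_le_mul_of_nonneg_left (h1 τ hτ) (by exact_mod_cast (Real.exp_nonneg _)))
  refine erealIntegral_mono ((ae_restrict_iff' measurableSet_Ioo).2 ?_)
  filter_upwards [h0] with t ht ht'
  exact mul_le_mul_of_nonneg_left (ht ht'.1) (by exact_mod_cast (weight_pos hr t).le)

end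

section
variable {r : ℝ} {F0 F1 : ℝ≥0 → EReal} {u0 u1 : ℝ≥0} {G : Measure ℝ} {m : Mechanism}

/-- A flow that agrees with the bounded real flow `x ≥ 0` has the values that `x` has. -/
theorem flowValue_eq (hr : 0 < r) {x : ℝ → ℝ} (hx : BddMeas x) {z : ℝ → ℝ≥0} {t : ℝ} (ht : 0 ≤ t)
    (hz : ∀ᵐ s, 0 < s → (z s : ℝ) = x s) {S : Set ℝ} (hS : MeasurableSet S) (hSt : S ⊆ Ioi t) :
    flowValue r z t S = ENNReal.ofReal (Real.exp (r * t) * ∫ s in S, r * Real.exp (-r * s) * x s) := by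
  have hi : IntegrableOn (fun s => r * Real.exp (-r * s) * x s) S :=
    (hx.integrableOn_Ioi hr t).mono_set hSt
  have hz' : ∀ᵐ s ∂volume.restrict S, (z s : ℝ) = x s := by
    refine (ae_restrict_iff' hS).2 ?_
    filter_upwards [hz] with s hs hsS
    exact hs (ht.trans_lt (hSt hsS))
  rw [← integral_const_mul, ofReal_integral_eq_lintegral_ofReal (hi.const_mul _)]
  · refine lintegral_congr_ae ?_
    filter_upwards [hz'] with s hs
    rw [← hs, ← ENNReal.ofReal_coe_nnreal, ← ENNReal.ofReal_mul (by positivity), ← mul_assoc,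
      mul_left_comm, ← Real.exp_add]
    ring_nf
  · filter_upwards [hz'] with s hs
    rw [← hs]
    positivity

/-- Incentive-compatibility in terms of the value of a real flow. -/
theorem isIC_iff (hr : 0 < r) {x : ℝ → ℝ} (hx : BddMeas x) (hz : ∀ᵐ s, 0 < s → (m.flow s : ℝ) = x s) :
    IsIC r m ↔ ∀ t, 0 ≤ t → (∀ s, t < s →
      ENNReal.ofReal (tailValue r x t - tailValue r x s)
        + ENNReal.ofReal (Real.exp (-r * s)) * m.reward s
          ≤ ENNReal.ofReal (Real.exp (-r * t)) * m.reward t) ∧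
      ENNReal.ofReal (tailValue r x t) ≤ ENNReal.ofReal (Real.exp (-r * t)) * m.reward t := by
  have hmul : ∀ t : ℝ, ∀ a b : ℝ≥0∞, a ≤ b ↔
      ENNReal.ofReal (Real.exp (-r * t)) * a ≤ ENNReal.ofReal (Real.exp (-r * t)) * b := fun t a b =>
    (ENNReal.mul_le_mul_iff_right (by simpa using Real.exp_pos _) ENNReal.ofReal_ne_top).symm
  have hcancel : ∀ t a : ℝ, ENNReal.ofReal (Real.exp (-r * t)) * ENNReal.ofReal (Real.exp (r * t) * a)
      = ENNReal.ofReal a := fun t a => by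
    rw [← ENNReal.ofReal_mul (Real.exp_nonneg _), ← mul_assoc, ← Real.exp_add]
    simp
  refine forall₂_congr fun t ht => and_congr ⟨fun h s hs => ?_, fun h d hd => ?_⟩ ?_
  · have := h (s - t) (sub_pos.2 hs)
    rw [add_sub_cancel, hmul t, mul_add, flowValue_eq hr hx ht hz measurableSet_Ioo Ioo_subset_Ioi_self,
      hcancel, setIntegral_Ioo_eq hr hx hs.le, ← mul_assoc, ← ENNReal.ofReal_mul (Real.exp_nonneg _),
      ← Real.exp_add] at this
    convert this using 4
    ring_nf
  · have := h (t + d) (by linarith)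
    rw [hmul t, mul_add, flowValue_eq hr hx ht hz measurableSet_Ioo Ioo_subset_Ioi_self,
      hcancel, setIntegral_Ioo_eq hr hx (by linarith), ← mul_assoc,
      ← ENNReal.ofReal_mul (Real.exp_nonneg _), ← Real.exp_add]
    convert this using 4
    ring_nf
  · rw [hmul t, flowValue_eq hr hx ht hz measurableSet_Ioi le_rfl, hcancel]
    rfl

/-- Incentive-compatibility for real rewards, discounted to time `0`. -/
theorem isIC_of_le (hr : 0 < r) {x P : ℝ → ℝ} (hx : BddMeas x)
    (hz : ∀ᵐ s, 0 < s → (m.flow s : ℝ) = x s)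
    (hP : ∀ t, 0 ≤ t → m.reward t = ENNReal.ofReal (Real.exp (r * t) * P t)) (hP0 : ∀ t, 0 ≤ P t)
    (hdec : ∀ s t, s < t → tailValue r x s - tailValue r x t ≤ P s - P t)
    (htail : ∀ t, tailValue r x t ≤ P t) (hx0 : ∀ t, 0 ≤ x t) : IsIC r m := by
  have hcancel : ∀ t, 0 ≤ t → ENNReal.ofReal (Real.exp (-r * t)) * m.reward t
      = ENNReal.ofReal (P t) := fun t ht => by
    rw [hP t ht, ← ENNReal.ofReal_mul (Real.exp_nonneg _), ← mul_assoc, ← Real.exp_add]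
    simp
  refine (isIC_iff hr hx hz).2 fun t ht => ⟨fun s hs => ?_, ?_⟩
  · rw [hcancel t ht, hcancel s (ht.trans hs.le), ← ENNReal.ofReal_add _ (hP0 s)]
    · exact ENNReal.ofReal_le_ofReal (by linarith [hdec t s hs])
    · rw [← setIntegral_Ioo_eq hr hx hs.le]
      exact integral_nonneg fun u => mul_nonneg (weight_pos hr u).le (hx0 u)
  · rw [hcancel t ht]
    exact ENNReal.ofReal_le_ofReal (htail t)

/-- The constant mechanism at `u0` is incentive-compatible with a finite payoff. -/
theorem IsOptimal.payoff_ne_bot (hr : 0 < r) (hF : IsTechnology F0 F1 u0 u1)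
    (hG : IsUnboundedDistribution G) (hm : IsOptimal r F0 F1 G m) : payoff r F0 F1 G m ≠ ⊥ := by
  have := hG.prob
  let k : Mechanism := ⟨fun _ => u0, measurable_const.aemeasurable, fun _ => u0⟩
  have hk : IsIC r k := by
    refine isIC_of_le hr (x := fun _ => (u0 : ℝ)) (P := tailValue r fun _ => (u0 : ℝ)) (BddMeas.const _)
      (Filter.Eventually.of_forall fun s _ => rfl) (fun t _ => ?_) (fun t => ?_)
      (fun s t _ => le_rfl) (fun t => le_rfl) fun t => u0.2
    · rw [tailValue_const hr, mul_left_comm, ← Real.exp_add]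
      simp [k]
    · rw [tailValue_const hr]
      positivity
  have hc := (BddMeas.const (F0 u0).toReal).of_setIntegral hr
  refine ((bot_lt_iff_ne_bot.2 (EReal.coe_ne_bot _)).trans_le ((le_payoff (m := k) (G := G)
    (a := fun _ => (F0 u0).toReal) (b := fun _ => (F1 u0).toReal)
    (Filter.Eventually.of_forall fun t _ => EReal.coe_toReal_le (hF.F0_ne_bot hF.u0_pos le_rfl)) hr
    (fun T => ((integrableOn_weight hr 0).mono_set Ioo_subset_Ioi_self).mul_const _)
    (Filter.Eventually.of_forall fun τ => ?_) ?_).trans (hm.2 k hk))).ne'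
  · rw [extendFrontier_coe]
    exact EReal.coe_toReal_le (hF.F1_ne_bot hF.u0_pos le_rfl)
  · refine (hc.integrable G).add (Integrable.mul_const ?_ _)
    refine Integrable.of_bound (by fun_prop) 1 ?_
    filter_upwards [hG.ae_nonneg] with τ hτ
    rw [Real.norm_of_nonneg (Real.exp_nonneg _)]
    exact Real.exp_le_one_iff.2 (by nlinarith)

theorem IsOptimal.hasRealPayoff (hr : 0 < r) (hF : IsTechnology F0 F1 u0 u1)
    (hG : IsUnboundedDistribution G) (hm : IsOptimal r F0 F1 G m) : HasRealPayoff r F0 F1 G m :=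
  .of_payoff_ne_bot hr hF hG hm.1.1 (hm.payoff_ne_bot hr hF hG)

theorem BddMeas.integrable_exp_mul (hr : 0 < r) (hG : IsUnboundedDistribution G) {j : ℝ → ℝ}
    (hj : BddMeas j) : Integrable (fun τ => Real.exp (-r * τ) * j τ) G := by
  have := hG.prob
  refine (hj.integrable G).bdd_mul (c := 1) (by fun_prop) ?_
  filter_upwards [hG.ae_nonneg] with τ hτ
  rw [Real.norm_of_nonneg (Real.exp_nonneg _)]
  exact Real.exp_le_one_iff.2 (by nlinarith)

/-- No incentive-compatible deviation from an optimal mechanism gains: bounded lower bounds `q` and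
`j` of its flow and reward gains have a nonpositive expected value. -/
theorem IsOptimal.deviation (hr : 0 < r) (hF : IsTechnology F0 F1 u0 u1)
    (hG : IsUnboundedDistribution G) (hm : IsOptimal r F0 F1 G m) {k : Mechanism} (hk : IsIC r k)
    {q j : ℝ → ℝ} (hq : BddMeas q) (hj : BddMeas j)
    (h0 : ∀ᵐ t, 0 < t → (((F0 (m.flow t)).toReal + q t : ℝ) : EReal) ≤ F0 (k.flow t))
    (h1 : ∀ᵐ τ ∂G, (((extendFrontier F1 (m.reward τ)).toReal + j τ : ℝ) : EReal)
      ≤ extendFrontier F1 (k.reward τ)) :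
    ∫ τ, ((∫ s in Ioo 0 τ, r * Real.exp (-r * s) * q s) + Real.exp (-r * τ) * j τ) ∂G ≤ 0 := by
  have := hG.prob
  have hR := hm.hasRealPayoff hr hF hG
  have hqi : ∀ T, IntegrableOn (fun s => r * Real.exp (-r * s) * q s) (Ioo 0 T) := fun T =>
    (hq.integrableOn_Ioi hr 0).mono_set Ioo_subset_Ioi_self
  have hsum : ∀ τ, (∫ t in Ioo 0 τ, r * Real.exp (-r * t) * ((F0 (m.flow t)).toReal + q t))
      + Real.exp (-r * τ) * ((extendFrontier F1 (m.reward τ)).toReal + j τ)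
      = realPayoffAt r F0 F1 m τ
        + ((∫ s in Ioo 0 τ, r * Real.exp (-r * s) * q s) + Real.exp (-r * τ) * j τ) := by
    intro τ
    simp only [mul_add]
    rw [integral_add (hR.integrableOn τ) (hqi τ), realPayoffAt]
    ring
  have hgi : Integrable (fun τ => (∫ s in Ioo 0 τ, r * Real.exp (-r * s) * q s)
      + Real.exp (-r * τ) * j τ) G :=
    ((hq.of_setIntegral hr).integrable G).add (hj.integrable_exp_mul hr hG)
  have h := (le_payoff (m := k) h0 hr (fun T => by simpa only [mul_add] using! (hR.integrableOn T).add (hqi T))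
    h1 (by simpa only [hsum] using! hR.integrable.add hgi)).trans (hm.2 k hk)
  rw [hR.payoff_eq, EReal.coe_le_coe_iff] at h
  simp only [hsum] at h
  rw [integral_add hR.integrable hgi] at h
  linarith

/-- A weak improvement on an optimal mechanism leaves the flow payoff unchanged. -/
theorem IsOptimal.flow_eq_of_le (hr : 0 < r) (hF : IsTechnology F0 F1 u0 u1)
    (hG : IsUnboundedDistribution G) (hm : IsOptimal r F0 F1 G m) {k : Mechanism} (hk : IsIC r k)
    (h0 : ∀ᵐ t, 0 < t → F0 (m.flow t) ≤ F0 (k.flow t))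
    (h1 : ∀ τ, 0 ≤ τ → extendFrontier F1 (m.reward τ) ≤ extendFrontier F1 (k.reward τ)) :
    ∀ᵐ t, 0 < t → F0 (m.flow t) = F0 (k.flow t) := by
  have hR := hm.hasRealPayoff hr hF hG
  have hA := (m.aemeasurable_frontier hF.frontier0).ereal_toReal
  have hB := (k.aemeasurable_frontier hF.frontier0).ereal_toReal
  -- Truncating the gain to `[0,1]` makes it bounded without changing where it is positive.
  set q : ℝ → ℝ := fun t => max 0 (min 1 (hB.mk _ t - hA.mk _ t))
  have hq0 : ∀ t, 0 ≤ q t := fun t => le_max_left _ _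
  have hq : BddMeas q := by
    refine BddMeas.of_mem_Icc (a := 0) (b := 1) ?_ fun t => ⟨hq0 t, max_le zero_le_one (min_le_left _ _)⟩
    exact measurable_const.max (measurable_const.min (hB.measurable_mk.sub hA.measurable_mk))
  have hreal : ∀ᵐ t, 0 < t → ∃ a b : ℝ, F0 (m.flow t) = a ∧ F0 (k.flow t) = b ∧ a ≤ b ∧
      q t = max 0 (min 1 (b - a)) := by
    filter_upwards [h0, hR.flow_ne_bot, hA.ae_eq_mk, hB.ae_eq_mk] with t h0 hb ha' hb' ht
    have e1 := EReal.coe_toReal (hF.frontier0.lt_top _).ne (hb ht)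
    have e2 := EReal.coe_toReal (hF.frontier0.lt_top (k.flow t)).ne
      ((bot_lt_iff_ne_bot.2 (hb ht)).trans_le (h0 ht)).ne'
    refine ⟨_, _, e1.symm, e2.symm, ?_, ?_⟩
    · rw [← EReal.coe_le_coe_iff, e1, e2]
      exact h0 ht
    · simp only [q, ← ha', ← hb']
  have hdev := hm.deviation hr hF hG hk hq (BddMeas.const 0) (by
      filter_upwards [hreal] with t h ht
      obtain ⟨a, b, e1, e2, hab, hqt⟩ := h ht
      rw [e1, e2, EReal.toReal_coe, EReal.coe_le_coe_iff, hqt]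
      have : max 0 (min 1 (b - a)) ≤ b - a := max_le (by linarith) (min_le_right _ _)
      linarith) (by
      filter_upwards [hG.ae_nonneg, hR.reward_ne_bot] with τ hτ hb
      rw [add_zero]
      exact (EReal.coe_toReal_le hb).trans (h1 τ hτ))
  simp only [mul_zero, add_zero] at hdev
  filter_upwards [ae_eq_zero_of_integral hr hG hq hq0 hdev, hreal] with t hq h ht
  obtain ⟨a, b, e1, e2, hab, hqt⟩ := h ht
  rw [hq ht] at hqt
  rw [e1, e2]
  have : min 1 (b - a) ≤ 0 := by rw [hqt]; exact le_max_right _ _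
  have : b - a ≤ 0 := by
    rcases min_le_iff.1 this with h | h
    · linarith
    · exact h
  congr 1
  linarith

end

/-! ### Promises and the flows that deliver them -/

section
variable {r p : ℝ} {x P N : ℝ → ℝ}

theorem tailValue_antitone (hr : 0 < r) (hx : BddMeas x) (hx0 : ∀ t, 0 ≤ x t) :
    Antitone (tailValue r x) := by
  intro s t hst
  rw [← sub_nonneg, ← setIntegral_Ioo_eq hr hx hst]
  exact integral_nonneg fun u => mul_nonneg (weight_pos hr u).le (hx0 u)

theorem tailValue_sub_le (hr : 0 < r) (hx : BddMeas x) (hxp : ∀ t, x t ≤ p) {s t : ℝ} (hst : s ≤ t) :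
    tailValue r x s - tailValue r x t ≤ p * Real.exp (-r * s) - p * Real.exp (-r * t) := by
  have := tailValue_antitone hr ((BddMeas.const p).sub hx) (fun t => sub_nonneg.2 (hxp t)) hst
  simp only [tailValue_sub hr (BddMeas.const p) hx, tailValue_const hr] at this
  linarith

/-- The value at time `t` of promising `N` at the best time `s`, when the flow between `t` and `s`
is `x` for `t < s` and `p` for `s < t`. -/
def bestPromise (r p : ℝ) (x N : ℝ → ℝ) (t : ℝ) : ℝ :=
  ⨆ s : Ici (0 : ℝ), Real.exp (-r * s) * N s
    + min (tailValue r x t - tailValue r x s) (p * Real.exp (-r * t) - p * Real.exp (-r * s))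

section
variable (hNp : ∀ t, N t ≤ p)
include hNp

theorem bestPromise_bddAbove (t : ℝ) : BddAbove (range fun s : Ici (0 : ℝ) =>
    Real.exp (-r * s) * N s
      + min (tailValue r x t - tailValue r x s) (p * Real.exp (-r * t) - p * Real.exp (-r * s))) := by
  refine ⟨p * Real.exp (-r * t), ?_⟩
  rintro _ ⟨s, rfl⟩
  have := mul_le_mul_of_nonneg_left (hNp s) (Real.exp_nonneg (-r * s))
  have := min_le_right (tailValue r x t - tailValue r x s) (p * Real.exp (-r * t) - p * Real.exp (-r * s))
  dsimp only
  linarith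

theorem bestPromise_le_peak (t : ℝ) : bestPromise r p x N t ≤ p * Real.exp (-r * t) := by
  refine ciSup_le fun s => ?_
  have := mul_le_mul_of_nonneg_left (hNp s) (Real.exp_nonneg (-r * s))
  have := min_le_right (tailValue r x t - tailValue r x s) (p * Real.exp (-r * t) - p * Real.exp (-r * s))
  linarith

theorem le_bestPromise {t : ℝ} (ht : 0 ≤ t) : Real.exp (-r * t) * N t ≤ bestPromise r p x N t := by
  refine le_trans ?_ (le_ciSup (bestPromise_bddAbove hNp t) ⟨t, ht⟩)
  simp

/-- Both bounds hold for each candidate time separately and pass to the supremum. The lower bound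
makes the promise incentive-compatible with the flow `x`; the upper bound lets a flow in `[0,p]`
deliver it. -/
theorem bestPromise_sub_mem (hr : 0 < r) (hx : BddMeas x) (hxp : ∀ t, x t ≤ p) {s t : ℝ} (hst : s ≤ t) :
    bestPromise r p x N s - bestPromise r p x N t ∈
      Icc (tailValue r x s - tailValue r x t) (p * Real.exp (-r * s) - p * Real.exp (-r * t)) := by
  have hd := tailValue_sub_le hr hx hxp hst
  constructor
  · suffices bestPromise r p x N t ≤ bestPromise r p x N s - (tailValue r x s - tailValue r x t) by
      linarith
    refine ciSup_le fun u => ?_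
    have := le_ciSup (bestPromise_bddAbove (r := r) (x := x) hNp s) u
    have h2 : min (tailValue r x t - tailValue r x u) (p * Real.exp (-r * t) - p * Real.exp (-r * u))
        + (tailValue r x s - tailValue r x t)
        ≤ min (tailValue r x s - tailValue r x u) (p * Real.exp (-r * s) - p * Real.exp (-r * u)) := by
      refine le_min ?_ ?_
      · linarith [min_le_left (tailValue r x t - tailValue r x u)
          (p * Real.exp (-r * t) - p * Real.exp (-r * u))]
      · linarith [min_le_right (tailValue r x t - tailValue r x u)
          (p * Real.exp (-r * t) - p * Real.exp (-r * u))]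
    rw [bestPromise]
    linarith
  · suffices bestPromise r p x N s ≤ bestPromise r p x N t
        + (p * Real.exp (-r * s) - p * Real.exp (-r * t)) by linarith
    refine ciSup_le fun u => ?_
    have := le_ciSup (bestPromise_bddAbove (r := r) (x := x) hNp t) u
    have h2 : min (tailValue r x s - tailValue r x u) (p * Real.exp (-r * s) - p * Real.exp (-r * u))
        - (p * Real.exp (-r * s) - p * Real.exp (-r * t))
        ≤ min (tailValue r x t - tailValue r x u) (p * Real.exp (-r * t) - p * Real.exp (-r * u)) := by
      refine le_min ?_ ?_
      · linarith [min_le_left (tailValue r x s - tailValue r x u)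
          (p * Real.exp (-r * s) - p * Real.exp (-r * u))]
      · linarith [min_le_right (tailValue r x s - tailValue r x u)
          (p * Real.exp (-r * s) - p * Real.exp (-r * u))]
    rw [bestPromise]
    linarith

end

/-- The best promise does not exceed a reward that is worth more than any later promise. -/
theorem bestPromise_le (hr : 0 < r) {n t R : ℝ} (hNn : ∀ t, N t ≤ n) (hnp : n ≤ p) (hnR : n ≤ R)
    (h : ∀ s, t < s → tailValue r x t - tailValue r x s + Real.exp (-r * s) * N s
      ≤ Real.exp (-r * t) * R) :
    bestPromise r p x N t ≤ Real.exp (-r * t) * R := by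
  refine ciSup_le fun s => ?_
  rcases lt_or_ge t s with hs | hs
  · linarith [h s hs, min_le_left (tailValue r x t - tailValue r x s)
      (p * Real.exp (-r * t) - p * Real.exp (-r * s))]
  · have h1 := min_le_right (tailValue r x t - tailValue r x s)
      (p * Real.exp (-r * t) - p * Real.exp (-r * s))
    have h2 := mul_le_mul_of_nonneg_left (hNn s) (Real.exp_nonneg (-r * s))
    have h3 : Real.exp (-r * t) ≤ Real.exp (-r * s) := Real.exp_le_exp.2 (by nlinarith)
    have h4 := mul_le_mul_of_nonneg_left hnR (Real.exp_nonneg (-r * t))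
    nlinarith [mul_nonneg (sub_nonneg.2 hnp) (sub_nonneg.2 h3)]

/-- A discounted promise that decreases no faster than under the constant flow `p` is the value of
a flow in `[0,p]`. -/
theorem exists_flow_of_promise (hr : 0 < r) (hP0 : ∀ t, 0 ≤ P t)
    (hPp : ∀ t, P t ≤ p * Real.exp (-r * t)) (hanti : Antitone P)
    (hmono : Monotone fun t => P t - p * Real.exp (-r * t)) :
    ∃ z, BddMeas z ∧ (∀ t, z t ∈ Icc 0 p) ∧ ∀ t, tailValue r z t = P t := by
  have hp : 0 ≤ p := by simpa using (hP0 0).trans (hPp 0)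
  have hdE : ∀ t, HasDerivAt (fun t => p * Real.exp (-r * t)) (-(p * (r * Real.exp (-r * t)))) t := by
    intro t
    have := (((hasDerivAt_id t).const_mul (-r)).exp).const_mul p
    exact this.congr_deriv (by simp only [id]; ring)
  have hd0 : ∀ t, deriv P t ≤ 0 := fun t => by
    have : 0 ≤ deriv (fun t => -P t) t := (hanti.neg).deriv_nonneg
    rw [deriv.fun_neg] at this
    linarith
  have hdp : ∀ t, -(p * (r * Real.exp (-r * t))) ≤ deriv P t := by
    intro t
    by_cases hd : DifferentiableAt ℝ P t
    · have h := (hd.hasDerivAt.sub (hdE t)).deriv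
      have := hmono.deriv_nonneg (x := t)
      have h' : deriv (fun t => P t - p * Real.exp (-r * t)) t = _ := h
      rw [h'] at this
      linarith
    · rw [deriv_zero_of_not_differentiableAt hd]
      have := weight_pos hr t
      nlinarith
  -- The flow that delivers `P` is minus its derivative, undiscounted. Since `P` is Lipschitz on
  -- bounded intervals, it is recovered from its derivative.
  set z : ℝ → ℝ := fun t => -deriv P t / (r * Real.exp (-r * t)) with hz
  have hzmem : ∀ t, z t ∈ Icc 0 p := fun t =>
    ⟨div_nonneg (neg_nonneg.2 (hd0 t)) (weight_pos hr t).le,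
      (div_le_iff₀ (weight_pos hr t)).2 (by linarith [hdp t])⟩
  have hzb : BddMeas z := BddMeas.of_mem_Icc ((measurable_deriv P).neg.div (by fun_prop)) hzmem
  have hinc : ∀ s t, s ≤ t → tailValue r z s - tailValue r z t = P s - P t := by
    intro s t hst
    have hac : AbsolutelyContinuousOnInterval P s t := by
      refine LipschitzOnWith.absolutelyContinuousOnInterval
        (K := ⟨p * (r * Real.exp (-r * s)), by positivity⟩) ?_
      refine LipschitzOnWith.of_dist_le_mul fun u hu v hv => ?_
      rw [uIcc_of_le hst] at hu hv
      have key : ∀ u v, s ≤ u → u ≤ v → |P u - P v| ≤ p * (r * Real.exp (-r * s)) * |u - v| := by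
        intro u v hsu huv
        rw [abs_of_nonneg (sub_nonneg.2 (hanti huv)), abs_sub_comm, abs_of_nonneg (sub_nonneg.2 huv)]
        have h1 : P u - P v ≤ p * (Real.exp (-r * u) - Real.exp (-r * v)) := by
          have : P u - p * Real.exp (-r * u) ≤ P v - p * Real.exp (-r * v) := hmono huv
          linarith
        have h2 : Real.exp (-r * v) = Real.exp (-r * u) * Real.exp (-r * (v - u)) := by
          rw [← Real.exp_add]; ring_nf
        have h3 := Real.add_one_le_exp (-r * (v - u))
        have h4 : Real.exp (-r * u) ≤ Real.exp (-r * s) := Real.exp_le_exp.2 (by nlinarith)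
        have h5 : Real.exp (-r * u) - Real.exp (-r * v) ≤ Real.exp (-r * s) * (r * (v - u)) := by
          rw [h2]
          have h6 : 0 ≤ r * (v - u) := by nlinarith
          nlinarith [Real.exp_pos (-r * u), mul_le_mul_of_nonneg_right h4 h6]
        nlinarith [mul_le_mul_of_nonneg_left h5 hp]
      rw [Real.dist_eq, Real.dist_eq]
      rcases le_total u v with h | h
      · exact key u v hu.1 h
      · rw [abs_sub_comm, abs_sub_comm u]
        exact key v u hv.1 h
    have h := hac.integral_deriv_eq_sub
    rw [← setIntegral_Ioo_eq hr hzb hst, ← neg_sub, ← h, intervalIntegral.integral_of_le hst,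
      ← integral_Ioc_eq_integral_Ioo, ← integral_neg]
    congr 1
    ext u
    rw [hz]
    field_simp
  refine ⟨z, hzb, hzmem, fun t => ?_⟩
  have hPlim : Filter.Tendsto P Filter.atTop (nhds 0) := by
    have := tendsto_tailValue hr (BddMeas.const p)
    rw [show tailValue r (fun _ => p) = fun t => p * Real.exp (-r * t) from
      funext (tailValue_const hr p)] at this
    exact squeeze_zero hP0 hPp this
  have h1 := ((tendsto_tailValue hr hzb).const_sub (tailValue r z t)).sub (hPlim.const_sub (P t))
  have h2 := h1.congr' (f₂ := fun _ => (0 : ℝ)) (by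
    filter_upwards [Filter.eventually_ge_atTop t] with u hu
    rw [hinc t u hu, sub_self])
  have := tendsto_nhds_unique tendsto_const_nhds h2
  linarith

/-- If the value of `x` decreases no faster than that of `z`, then `x ≤ z`. -/
theorem ae_le_of_tailValue_sub (hr : 0 < r) {z : ℝ → ℝ} (hx : BddMeas x) (hz : BddMeas z)
    (h : ∀ s t, s < t → tailValue r x s - tailValue r x t ≤ tailValue r z s - tailValue r z t) :
    ∀ᵐ t, 0 < t → x t ≤ z t := by
  have h1 : ∀ n : ℕ, ∀ᵐ t, t ∈ Ioo (0 : ℝ) n → 0 ≤ z t - x t := fun n =>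
    ae_ge_of_tailValue hr (hz.sub hx) fun s t _ hst _ => by
      simp only [tailValue_sub hr hz hx]
      linarith [h s t hst]
  filter_upwards [ae_all_iff.2 h1] with t ht ht0
  obtain ⟨n, hn⟩ := exists_nat_gt t
  linarith [ht n ⟨ht0, hn⟩]

end

/-! ### Optimality makes incentive-compatibility bind -/

theorem coe_mul_lt_coe_mul {a : ℝ} (ha : 0 < a) {x y : EReal} (h : x < y) :
    (a : EReal) * x < (a : EReal) * y := by
  refine lt_of_not_ge fun hle => not_le.2 h ?_
  have hinv : ∀ z : EReal, ((a⁻¹ : ℝ) : EReal) * ((a : EReal) * z) = z := fun z => by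
    rw [← mul_assoc, ← EReal.coe_mul, inv_mul_cancel₀ ha.ne', EReal.coe_one, one_mul]
  have := mul_le_mul_of_nonneg_left hle (show (0 : EReal) ≤ ((a⁻¹ : ℝ) : EReal) by
    exact_mod_cast (inv_nonneg.2 ha.le))
  rwa [hinv, hinv] at this

section
variable {r : ℝ} {F0 F1 : ℝ≥0 → EReal} {u0 u1 : ℝ≥0} {G : Measure ℝ} {m : Mechanism}

theorem IsIC.of_flow_le {k : Mechanism} (hm : IsIC r m) (h : ∀ t, k.flow t ≤ m.flow t)
    (hr : k.reward = m.reward) : IsIC r k := by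
  have hle : ∀ t S, flowValue r k.flow t S ≤ flowValue r m.flow t S := fun t S =>
    lintegral_mono fun s => mul_le_mul' le_rfl (ENNReal.coe_le_coe.2 (h s))
  intro t ht
  rw [hr]
  exact ⟨fun d hd => (add_le_add (hle _ _) le_rfl).trans ((hm t ht).1 d hd), (hle _ _).trans (hm t ht).2⟩

/-- The flow of an optimal mechanism does not exceed the peak. -/
theorem IsOptimal.exists_flow (hr : 0 < r) (hF : IsTechnology F0 F1 u0 u1)
    (hG : IsUnboundedDistribution G) (hm : IsOptimal r F0 F1 G m) :
    ∃ x, BddMeas x ∧ (∀ t, x t ∈ Icc 0 (u0 : ℝ)) ∧ ∀ᵐ t, 0 < t → (m.flow t : ℝ) = x t := by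
  -- Capping the flow at the peak relaxes the incentive constraints and is a strict improvement
  -- wherever the cap binds.
  let k : Mechanism := ⟨fun t => min (m.flow t) u0, m.measurable_flow.min aemeasurable_const, m.reward⟩
  have h := hm.flow_eq_of_le hr hF hG (k := k) (hm.1.1.of_flow_le (fun t => min_le_left _ _) rfl)
    (Filter.Eventually.of_forall fun t _ => by
      show F0 (m.flow t) ≤ F0 (min (m.flow t) u0)
      rcases le_total (m.flow t) u0 with h | h
      · rw [min_eq_left h]
      · rw [min_eq_right h]
        exact hF.frontier0.le_peak _) fun τ _ => le_rfl
  have hx : AEMeasurable (fun t => (m.flow t : ℝ)) volume := m.measurable_flow.coe_nnreal_real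
  have hmem : ∀ t, max 0 (min (u0 : ℝ) (hx.mk _ t)) ∈ Icc 0 (u0 : ℝ) := fun t =>
    ⟨le_max_left _ _, max_le u0.2 (min_le_left _ _)⟩
  refine ⟨_, BddMeas.of_mem_Icc (measurable_const.max (measurable_const.min hx.measurable_mk)) hmem,
    hmem, ?_⟩
  filter_upwards [h, hx.ae_eq_mk] with t ht hxt ht0
  rw [← hxt, min_eq_right, max_eq_right (NNReal.coe_nonneg _)]
  by_contra! hlt
  have hlt : u0 < m.flow t := by exact_mod_cast hlt
  have := ht ht0
  rw [show k.flow t = u0 from min_eq_right hlt.le] at this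
  exact (hF.frontier0.peak _ hlt.ne').ne this

theorem IsTechnology.extend_lt (hF : IsTechnology F0 F1 u0 u1) {X : ℝ≥0∞} {Z : ℝ≥0} (hZ : Z ≤ u0)
    (h1 : min X u1 ≤ Z) (h2 : Z ≤ max X u1) (hne : X ≠ Z) :
    extendFrontier F1 X < extendFrontier F1 Z := by
  have hbot : 0 < Z ∨ Z = u1 → F1 Z ≠ ⊥ := by
    rintro (h | rfl)
    · exact hF.F1_ne_bot h hZ
    · exact hF.frontier1.peak_ne_bot
  have hbot' : u1 ≤ Z → F1 Z ≠ ⊥ := fun h => hbot (by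
    rcases h.eq_or_lt with h | h
    · exact Or.inr h.symm
    · exact Or.inl ((zero_le).trans_lt h))
  rw [extendFrontier_coe]
  induction X with
  | top =>
    rw [extendFrontier, if_pos rfl, bot_lt_iff_ne_bot]
    exact hbot' (by simpa using h1)
  | coe X =>
    rw [extendFrontier_coe]
    norm_cast at h1 h2 hne
    rcases le_total X u1 with h | h
    · rw [min_eq_left h] at h1
      rw [max_eq_right h] at h2
      have h1 := h1.lt_of_ne hne
      exact hF.frontier1.lt_of_between (Or.inl ⟨h1, h2⟩) (hbot (Or.inl (zero_le.trans_lt h1)))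
    · rw [min_eq_right h] at h1
      rw [max_eq_left h] at h2
      exact hF.frontier1.lt_of_between (Or.inr ⟨h1, h2.lt_of_ne (Ne.symm hne)⟩) (hbot' h1)

/-- Undominated mechanisms: with the flow of `m`, no incentive-compatible reward lies between the
reward and `u1`. -/
theorem IsOptimal.reward_eq (hr : 0 < r) (hF : IsTechnology F0 F1 u0 u1)
    (hG : IsUnboundedDistribution G) (hm : IsOptimal r F0 F1 G m) {k : Mechanism} (hk : IsIC r k)
    (hfl : k.flow = m.flow) {Z : ℝ → ℝ≥0} (hkZ : ∀ t, k.reward t = Z t) (hZ : ∀ t, 0 ≤ t → Z t ≤ u0)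
    (h1 : ∀ t, 0 ≤ t → min (m.reward t) u1 ≤ Z t) (h2 : ∀ t, 0 ≤ t → Z t ≤ max (m.reward t) u1)
    {t : ℝ} (ht : 0 ≤ t) : m.reward t = Z t := by
  by_contra hne
  have hle : ∀ τ, 0 ≤ τ → extendFrontier F1 (m.reward τ) ≤ extendFrontier F1 (k.reward τ) := by
    intro τ hτ
    rw [hkZ]
    by_cases h : m.reward τ = Z τ
    · rw [h]
    · exact (hF.extend_lt (hZ τ hτ) (h1 τ hτ) (h2 τ hτ) h).le
  -- Optimality for `G` sees rewards only up to `G`-null sets. Undominatedness pins them down at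
  -- every time: a breakthrough surely at `t` reveals the strict gain.
  refine hm.1.2 k hk ⟨fun H hH => payoff_mono hr hH.2 (Filter.Eventually.of_forall fun s _ => by rw [hfl]) hle,
    Measure.dirac t, ⟨inferInstance, by simpa using ht⟩, ?_⟩
  rw [payoff, payoff, erealIntegral_dirac, erealIntegral_dirac, hfl,
    (hm.hasRealPayoff hr hF hG).inner t, hkZ]
  exact EReal.add_lt_add_left_coe (coe_mul_lt_coe_mul (Real.exp_pos _)
    (hF.extend_lt (hZ t ht) (h1 t ht) (h2 t ht) hne)) _

/-- The discounted reward of an optimal mechanism decreases at least as fast as the value of its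
flow, and at most as fast as under the constant flow `u0`. -/
theorem IsOptimal.exists_promise (hr : 0 < r) (hF : IsTechnology F0 F1 u0 u1)
    (hG : IsUnboundedDistribution G) (hm : IsOptimal r F0 F1 G m) {x : ℝ → ℝ} (hx : BddMeas x)
    (hxm : ∀ t, x t ∈ Icc 0 (u0 : ℝ)) (hfl : ∀ᵐ t, 0 < t → (m.flow t : ℝ) = x t) :
    ∃ P : ℝ → ℝ, (∀ t, tailValue r x t ≤ P t) ∧ (∀ t, P t ≤ u0 * Real.exp (-r * t)) ∧
      (∀ s t, s ≤ t → P s - P t ∈ Icc (tailValue r x s - tailValue r x t)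
        (u0 * Real.exp (-r * s) - u0 * Real.exp (-r * t))) ∧
      ∀ t, 0 ≤ t → m.reward t = ENNReal.ofReal (Real.exp (r * t) * P t) := by
  have hu : (u1 : ℝ) ≤ u0 := by exact_mod_cast hF.conflict.le
  set N : ℝ → ℝ := fun t => (min (m.reward t) u1).toReal with hN
  have hfin : ∀ t, min (m.reward t) (u1 : ℝ≥0∞) ≠ ⊤ := fun t =>
    ((min_le_right _ _).trans_lt ENNReal.coe_lt_top).ne
  have hNn : ∀ t, N t ≤ u1 := fun t => ENNReal.toReal_mono ENNReal.coe_ne_top (min_le_right _ _)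
  have hNo : ∀ t, ENNReal.ofReal (N t) = min (m.reward t) u1 := fun t => ENNReal.ofReal_toReal (hfin t)
  have hNp : ∀ t, N t ≤ u0 := fun t => (hNn t).trans hu
  -- Promises are built from the part of the reward below `u1`. The resulting reward is
  -- incentive-compatible with the same flow and lies between the old reward and `u1`, so by
  -- undominatedness it is the old reward, which inherits the bounds on `P`.
  set P := bestPromise r u0 x N
  have hdec : ∀ s t, s ≤ t → _ := fun s t hst =>
    bestPromise_sub_mem hNp hr hx (fun t => (hxm t).2) (s := s) (t := t) hst
  have hanti := tailValue_antitone hr hx fun t => (hxm t).1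
  have hPge : ∀ t, 0 ≤ t → 0 ≤ P t := fun t ht =>
    (mul_nonneg (Real.exp_nonneg _) ENNReal.toReal_nonneg).trans (le_bestPromise hNp ht)
  have htail : ∀ t, tailValue r x t ≤ P t := by
    intro t
    have hlim := (tendsto_tailValue hr hx).const_sub (tailValue r x t)
    rw [sub_zero] at hlim
    refine le_of_tendsto hlim ?_
    filter_upwards [Filter.eventually_ge_atTop (max 0 t)] with s hs
    linarith [(hdec t s (le_of_max_le_right hs)).1, hPge s (le_of_max_le_left hs)]
  have hPle : ∀ t, P t ≤ u0 * Real.exp (-r * t) := bestPromise_le_peak hNp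
  have hP0 : ∀ t, 0 ≤ P t := fun t => le_trans
    (integral_nonneg fun u => mul_nonneg (weight_pos hr u).le (hxm u).1) (htail t)
  refine ⟨P, htail, hPle, hdec, ?_⟩
  let Z : ℝ → ℝ≥0 := fun t => (Real.exp (r * t) * P t).toNNReal
  let k : Mechanism := ⟨m.flow, m.measurable_flow, fun t => Z t⟩
  have hexp : ∀ t a : ℝ, Real.exp (r * t) * (Real.exp (-r * t) * a) = a := fun t a => by
    rw [← mul_assoc, ← Real.exp_add]; simp
  have hk : IsIC r k := isIC_of_le hr hx hfl (P := P) (fun t _ => rfl) hP0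
    (fun s t hst => (hdec s t hst.le).1) htail fun t => (hxm t).1
  intro t ht
  refine hm.reward_eq hr hF hG hk rfl (fun _ => rfl) (fun s _ => ?_) (fun s hs => ?_) (fun s hs => ?_) ht
  · refine Real.toNNReal_le_iff_le_coe.2 ?_
    have := mul_le_mul_of_nonneg_left (hPle s) (Real.exp_nonneg (r * s))
    rwa [mul_comm (u0 : ℝ), hexp] at this
  · rw [← hNo]
    refine ENNReal.ofReal_le_ofReal ?_
    have := mul_le_mul_of_nonneg_left (le_bestPromise (r := r) (x := x) hNp hs) (Real.exp_nonneg (r * s))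
    rwa [hexp] at this
  · rcases eq_or_ne (m.reward s) ⊤ with htop | htop
    · rw [htop]; simp
    have hR : ENNReal.ofReal (max (m.reward s) u1).toReal = max (m.reward s) u1 :=
      ENNReal.ofReal_toReal (max_lt htop.lt_top ENNReal.coe_lt_top).ne
    rw [← hR]
    refine ENNReal.ofReal_le_ofReal ?_
    have hle : P s ≤ Real.exp (-r * s) * (max (m.reward s) u1).toReal := by
      refine bestPromise_le hr hNn hu ?_ fun u hsu => ?_
      · exact ENNReal.toReal_mono (max_lt htop.lt_top ENNReal.coe_lt_top).ne (le_max_right _ _)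
      · have h := ((isIC_iff hr hx hfl).1 hm.1.1 s hs).1 u hsu
        refine (ENNReal.ofReal_le_ofReal_iff (by positivity)).1 ?_
        rw [ENNReal.ofReal_add (sub_nonneg.2 (hanti hsu.le)) (by positivity),
          ENNReal.ofReal_mul (Real.exp_nonneg _), ENNReal.ofReal_mul (Real.exp_nonneg _), hR, hNo]
        exact (add_le_add le_rfl (mul_le_mul' le_rfl (min_le_left _ _))).trans
          (h.trans (mul_le_mul' le_rfl (le_max_left _ _)))
    have := mul_le_mul_of_nonneg_left hle (Real.exp_nonneg (r * s))
    rwa [hexp] at this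

/-- In an optimal mechanism incentive-compatibility binds: the reward is the value of the flow. -/
theorem IsOptimal.reward_eq_promised (hr : 0 < r) (hF : IsTechnology F0 F1 u0 u1)
    (hG : IsUnboundedDistribution G) (hm : IsOptimal r F0 F1 G m) {x : ℝ → ℝ} (hx : BddMeas x)
    (hxm : ∀ t, x t ∈ Icc 0 (u0 : ℝ)) (hfl : ∀ᵐ t, 0 < t → (m.flow t : ℝ) = x t) {t : ℝ} (ht : 0 ≤ t) :
    m.reward t = ENNReal.ofReal (promised r x t) := by
  obtain ⟨P, hVP, hPp, hdec, hrew⟩ := hm.exists_promise hr hF hG hx hxm hfl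
  have hanti := tailValue_antitone hr hx fun t => (hxm t).1
  have hP0 : ∀ t, 0 ≤ P t := fun t => le_trans
    (integral_nonneg fun u => mul_nonneg (weight_pos hr u).le (hxm u).1) (hVP t)
  -- The flow `z` delivers the given reward exactly and is at least `x`. Since `F0` increases up to
  -- `u0`, switching to `z` would improve wherever `z > x`; hence `z = x` almost everywhere.
  obtain ⟨z, hz, hzm, hzP⟩ := exists_flow_of_promise hr hP0 hPp
    (fun s t hst => by linarith [(hdec s t hst).1, hanti hst])
    (fun s t hst => by dsimp only; linarith [(hdec s t hst).2])
  have hxz : ∀ᵐ t, 0 < t → x t ≤ z t := ae_le_of_tailValue_sub hr hx hz fun s t hst => by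
    rw [hzP, hzP]; exact (hdec s t hst.le).1
  let k : Mechanism := ⟨fun t => (z t).toNNReal, hz.1.real_toNNReal.aemeasurable, m.reward⟩
  have hkz : ∀ t, (k.flow t : ℝ) = z t := fun t => Real.coe_toNNReal _ (hzm t).1
  have hk : IsIC r k := isIC_of_le hr hz (Filter.Eventually.of_forall fun s _ => hkz s) (P := P) hrew hP0
    (fun s t _ => by rw [hzP, hzP]) (fun t => (hzP t).le) fun t => (hzm t).1
  have hlt : ∀ᵐ t, 0 < t → m.flow t = k.flow t ∨ F0 (m.flow t) < F0 (k.flow t) := by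
    filter_upwards [hfl, hxz] with t h1 h2 ht
    have h : m.flow t ≤ k.flow t := by
      rw [← NNReal.coe_le_coe, h1 ht, hkz]
      exact h2 ht
    have hu : k.flow t ≤ u0 := by
      rw [← NNReal.coe_le_coe, hkz]
      exact (hzm t).2
    rcases h.eq_or_lt with h | h
    · exact Or.inl h
    · exact Or.inr (hF.frontier0.lt_of_between (Or.inl ⟨h, hu⟩) (hF.F0_ne_bot (zero_le.trans_lt h) hu))
  have heq := hm.flow_eq_of_le hr hF hG hk (hlt.mono fun t h ht => by
    rcases h ht with h | h
    · rw [h]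
    · exact h.le) fun τ _ => le_rfl
  rw [hrew t ht, ← hzP t, promised, tailValue_congr_ae]
  filter_upwards [heq, hlt, hfl] with s h1 h2 h3 hs
  have hs0 := ht.trans_lt hs
  rw [← h3 hs0, ← hkz, (h2 hs0).resolve_right fun h => h.ne (h1 hs0)]

end

/-! ### From optimal mechanisms to optimal paths -/

section
variable {r : ℝ} {F0 F1 : ℝ≥0 → EReal} {u0 u1 : ℝ≥0} {G : Measure ℝ} {m : Mechanism}

theorem IsTechnology.isDomain0 (hF : IsTechnology F0 F1 u0 u1) :
    IsDomain u0 (domain F0 u0) (realValue F0) :=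
  isDomain_domain hF.frontier0.concave hF.frontier0.lt_top fun _ => hF.F0_ne_bot

theorem IsTechnology.isDomain1 (hF : IsTechnology F0 F1 u0 u1) :
    IsDomain u0 (domain F1 u0) (realValue F1) :=
  isDomain_domain hF.frontier1.concave hF.frontier1.lt_top fun _ => hF.F1_ne_bot

theorem isUnboundedDistribution_of_support (hG : IsDistribution G) (hac : G ≪ volume)
    (h : ¬ BddAbove G.support) : IsUnboundedDistribution G := by
  refine ⟨hG.1, hG.2, ⟨fun x => hac Real.volume_singleton⟩, fun t => ?_⟩
  obtain ⟨s, hs, hts⟩ := not_bddAbove_iff.1 h t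
  exact (Measure.mem_support_iff_forall s).1 hs _ (Ioi_mem_nhds hts)

/-- The reward never leaves the effective domain of `F1`. -/
theorem IsOptimal.promised_mem (hr : 0 < r) (hF : IsTechnology F0 F1 u0 u1)
    (hG : IsUnboundedDistribution G) (hm : IsOptimal r F0 F1 G m) {x : ℝ → ℝ} (hx : BddMeas x)
    (hxm : ∀ t, x t ∈ Icc 0 (u0 : ℝ))
    (hrew : ∀ t, 0 ≤ t → m.reward t = ENNReal.ofReal (promised r x t)) {t : ℝ} (ht : 0 ≤ t) :
    promised r x t ∈ domain F1 u0 := by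
  have hV0 : ∀ t, 0 ≤ tailValue r x t := fun t =>
    integral_nonneg fun u => mul_nonneg (weight_pos hr u).le (hxm u).1
  have hmem : promised r x t ∈ Icc 0 (u0 : ℝ) := by
    refine ⟨mul_nonneg (Real.exp_nonneg _) (hV0 t), ?_⟩
    have h := mul_le_mul_of_nonneg_left (tailValue_mono hr hx (BddMeas.const (u0 : ℝ)) (t := t)
      (Filter.Eventually.of_forall fun s _ => (hxm s).2)) (Real.exp_nonneg (r * t))
    rw [tailValue_const hr, mul_left_comm, ← Real.exp_add] at h
    simpa [promised] using h
  refine ⟨hmem, ?_⟩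
  rcases hmem.1.eq_or_lt with h | h
  -- A zero reward stays at zero, so it is received with positive probability; the payoff being
  -- finite, `F1` is then finite at `0`.
  · have hV : tailValue r x t = 0 := by
      rw [tailValue_eq_promised, ← h, mul_zero]
    have hne : ∃ᵐ τ ∂G, t < τ := frequently_ae_iff.2 (hG.tail_pos t).ne'
    obtain ⟨τ, hτ, hb⟩ := (hne.and_eventually (hm.hasRealPayoff hr hF hG).reward_ne_bot).exists
    have h0 : promised r x τ = 0 := by
      rw [promised, le_antisymm ((tailValue_antitone hr hx (fun t => (hxm t).1) hτ.le).trans hV.le)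
        (hV0 τ), mul_zero]
    rw [hrew τ (ht.trans hτ.le), h0] at hb
    rw [← h]
    simpa [extendFrontier] using hb
  · exact hF.F1_ne_bot (Real.toNNReal_pos.2 h) (Real.toNNReal_le_iff_le_coe.2 hmem.2)

/-- Finiteness of the payoff controls the flow almost everywhere only; resetting the exceptional
times to `u0` puts it in the domain at all times. -/
theorem exists_path_mem_domain (hF : IsTechnology F0 F1 u0 u1) {x : ℝ → ℝ} (hx : BddMeas x)
    (hxm : ∀ t, x t ∈ Icc 0 (u0 : ℝ)) (h : ∀ᵐ t, 0 < t → F0 (x t).toNNReal ≠ ⊥) :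
    ∃ y, BddMeas y ∧ (∀ t, y t ∈ domain F0 u0) ∧ ∀ᵐ t, 0 < t → x t = y t := by
  have hS : MeasurableSet {t | F0 (x t).toNNReal = ⊥} :=
    (hF.frontier0.measurable.comp hx.1.real_toNNReal) (measurableSet_singleton ⊥)
  classical
  set y : ℝ → ℝ := fun t => if F0 (x t).toNNReal = ⊥ then (u0 : ℝ) else x t
  have hy : ∀ t, y t ∈ domain F0 u0 := by
    intro t
    by_cases ht : F0 (x t).toNNReal = ⊥
    · simp only [y, if_pos ht]
      exact hF.isDomain0.Ioc_subset ⟨hF.u0_pos, le_rfl⟩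
    · simp only [y, if_neg ht]
      exact ⟨hxm t, ht⟩
  refine ⟨y, BddMeas.of_mem_Icc (Measurable.ite hS measurable_const hx.1) fun t => (hy t).1, hy, ?_⟩
  filter_upwards [h] with t ht ht0
  exact (if_neg (ht ht0)).symm

/-- An optimal mechanism is determined by an optimal path. -/
theorem IsOptimal.exists_isOptimalPath (hr : 0 < r) (hF : IsTechnology F0 F1 u0 u1)
    (hG : IsUnboundedDistribution G) (hm : IsOptimal r F0 F1 G m) :
    ∃ x, IsOptimalPath r (domain F0 u0) (domain F1 u0) (realValue F0) (realValue F1) G x ∧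
      ∀ t, 0 ≤ t → m.reward t = ENNReal.ofReal (promised r x t) := by
  obtain ⟨x₀, hx₀, hxm₀, hfl₀⟩ := hm.exists_flow hr hF hG
  obtain ⟨x, hx, hxd, hxx⟩ := exists_path_mem_domain hF hx₀ hxm₀ (by
    filter_upwards [hfl₀, (hm.hasRealPayoff hr hF hG).flow_ne_bot] with t h1 h2 ht
    rw [← h1 ht, Real.toNNReal_coe]
    exact h2 ht)
  have hxm : ∀ t, x t ∈ Icc 0 (u0 : ℝ) := fun t => (hxd t).1
  have hfl : ∀ᵐ t, 0 < t → m.flow t = (x t).toNNReal := by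
    filter_upwards [hfl₀, hxx] with t h1 h2 ht
    rw [← h2 ht, ← h1 ht, Real.toNNReal_coe]
  have hrew : ∀ t, 0 ≤ t → m.reward t = ENNReal.ofReal (promised r x t) := fun t ht =>
    hm.reward_eq_promised hr hF hG hx hxm (by
      filter_upwards [hfl] with t h ht
      rw [h ht, Real.coe_toNNReal _ (hxm t).1]) ht
  have hmem1 : ∀ t, 0 ≤ t → promised r x t ∈ domain F1 u0 := fun t ht =>
    hm.promised_mem hr hF hG hx hxm hrew ht
  refine ⟨x, ⟨hx, hxd, hmem1, fun y q j hy hq hj hy0 hy1 h0 h1 => ?_⟩, hrew⟩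
  -- A deviation is constrained only at positive times; cutting it off elsewhere makes it
  -- nonnegative everywhere without affecting rewards.
  set y' : ℝ → ℝ := (Ioi 0).indicator y
  have hyy : ∀ t, 0 < t → y' t = y t := fun t ht => indicator_of_mem (show t ∈ Ioi (0 : ℝ) from ht) _
  have hy' : BddMeas y' := hy.indicator measurableSet_Ioi
  have hy'0 : ∀ t, 0 ≤ y' t := fun t => indicator_nonneg (fun s hs => (hy0 s hs).1.1) t
  have hpr : ∀ t, 0 ≤ t → promised r y' t = promised r y t := fun t ht => by
    rw [promised, promised, tailValue_congr_ae (Filter.Eventually.of_forall fun s hs =>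
      hyy s (ht.trans_lt hs))]
  let k : Mechanism := ⟨fun t => (y' t).toNNReal, hy'.1.real_toNNReal.aemeasurable,
    fun t => ENNReal.ofReal (promised r y' t)⟩
  have hk : IsIC r k := isIC_of_le hr hy' (P := tailValue r y')
    (Filter.Eventually.of_forall fun s _ => Real.coe_toNNReal _ (hy'0 s)) (fun t _ => rfl)
    (fun t => integral_nonneg fun u => mul_nonneg (weight_pos hr u).le (hy'0 u))
    (fun s t _ => le_rfl) (fun t => le_rfl) hy'0
  refine hm.deviation hr hF hG hk hq hj ?_ ?_
  · filter_upwards [hfl] with t ht ht0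
    rw [ht ht0]
    have h := EReal.coe_le_coe_iff.2 (h0 t ht0)
    rw [coe_realValue hF.frontier0.lt_top (hy0 t ht0), ← hyy t ht0] at h
    exact h
  · filter_upwards [hG.ae_nonneg] with t ht
    have h := EReal.coe_le_coe_iff.2 (h1 t ht)
    rw [coe_realValue hF.frontier1.lt_top (hy1 t ht), ← hpr t ht] at h
    rw [hrew t ht]
    exact (extendFrontier_coe F1 _).symm ▸ h

end

end Breakthrough

end

/-! ### The theorem -/

theorem mainTheorem7 (r : ℝ) (hr : 0 < r) (F0 F1 : ℝ≥0 → EReal) (u0 u1 : ℝ≥0)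
    (hF : Breakthrough.IsTechnology F0 F1 u0 u1)
    (hF0 : Breakthrough.IsStrictlyConcave F0)
    (G G' : Measure ℝ)
    (hG : Breakthrough.IsDistribution G) (hG' : Breakthrough.IsDistribution G')
    (hGac : G ≪ volume) (hG'ac : G' ≪ volume)
    (hsupp : G.support = G'.support) (hunb : ¬ BddAbove G.support)
    (hMLR : Breakthrough.MLRDominates G G')
    (m m' : Breakthrough.Mechanism)
    (hm : Breakthrough.IsOptimal r F0 F1 G m)
    (hm' : Breakthrough.IsOptimal r F0 F1 G' m') :
    ∀ t : ℝ, 0 ≤ t → m'.reward t ≤ m.reward t := by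
  intro t ht
  have hGu := Breakthrough.isUnboundedDistribution_of_support hG hGac hunb
  have hGu' := Breakthrough.isUnboundedDistribution_of_support hG' hG'ac (hsupp ▸ hunb)
  obtain ⟨x, hx, hmx⟩ := hm.exists_isOptimalPath hr hF hGu
  obtain ⟨x', hx', hmx'⟩ := hm'.exists_isOptimalPath hr hF hGu'
  rw [hmx t ht, hmx' t ht]
  exact ENNReal.ofReal_le_ofReal (hx.promised_le hr hF.isDomain0 hF.isDomain1
    (hF0.strictConcaveOn hF.frontier0.lt_top hF.isDomain0.concave.1)
    hF.frontier0.monotoneOn_realValue hGu hGu' hMLR hx' ht)
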